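/- Let $d\in\{1,2,3\}$, let $\Omega\subset\mathbb{R}^d$ be a bounded domain with smooth boundary, and let $0<\alpha<1$. Let $a_{ij}=a_{ji}\in C^1(\overline\Omega)$, $b_j\in C^1(\Omega)$ bounded, and $c\in C(\overline\Omega)$ with $c\le 0$ be real-valued ($1\le i,j\le d$). Let $\sigma>0$ satisfy $\sum_{i,j}a_{ij}(x)\zeta_i\zeta_j\ge\sigma|\zeta|^2$ for all $x\in\overline\Omega$, $\zeta\in\mathbb{R}^d$. Let $C(\Omega)>0$ be a constant in the Poincaré inequality $C(\Omega)\int_\Omega|w|^2dx\le\int_\Omega|\nabla w|^2dx$ for $w\in H^1_0(\Omega)$, and assume $$\inf_{x\in\Omega}\Big(\tfrac12\sum_j\partial_jb_j(x)-c(x)\Big)+C(\Omega)\,\sigma>0 .$$ Let $A$ be the operator in the complex space $L^2(\Omega)$ with domain $H^2(\Omega)\cap H^1_0(\Omega)$ given by $-Av=\sum_{i,j}\partial_i(a_{ij}\partial_jv)+\sum_jb_j\partial_jv+cv$. Let $\lambda_n$ be a point of the spectrum of $A$, let $\gamma_n$ be a positively oriented circle centered at $\lambda_n$ such that the closed disc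 bounded by $\gamma_n$ contains no other point of the spectrum, and let $P_n=\frac1{2\pi\sqrt{-1}}\int_{\gamma_n}(z-A)^{-1}dz$ be the eigenprojection for $\lambda_n$. Let $a\in P_nL^2(\Omega)$, and let $u_n$ be the solution with values in $L^2(\Omega)$ of $$\partial_t^\alpha u_n=-Au_n\ (t>0),\qquad u_n|_{\partial\Omega}=0,\qquad u_n(\cdot,0)=a,$$ where $\partial_t^\alpha g(t)=\frac1{\Gamma(1-\alpha)}\int_0^t(t-s)^{-\alpha}g'(s)\,ds$ is the Caputo derivative; that is, $u_n\in C([0,\infty);L^2(\Omega))$ is differentiable at every $t>0$, the function $s\mapsto (t-s)^{-\alpha}u_n'(s)$ is integrable on $(0,t)$ for every $t>0$, and $u_n(t)\in H^2(\Omega)\cap H^1_0(\Omega)$ satisfies the equation for every $t>0$. Then there is exactly one element $A^{-1}(P_na)$ of the domain of $A$ that $A$ maps to $P_na$, and it has a representative in $C(\overline\Omega)$. For each $t_0>0$ there exists a constant $C(n)>0$ (which may depend on $t_0$, $a$ and $\alpha$, but not on $t$ or $x$) such that, for $t\ge t_0$, $u_n(\cdot,t)$ has a representative in $C(\overline\Omega)$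 and $$u_n(x,t)=\frac{A^{-1}(P_na)(x)}{\Gamma(1-\alpha)\,t^\alpha}+R_n(x,t),\qquad t\ge t_0,\ x\in\overline\Omega,$$ where $R_n(\cdot,t)\in C(\overline\Omega)$ and $$\|R_n(\cdot,t)\|_{C(\overline\Omega)}\le\frac{C(n)}{t^{2\alpha}},\qquad t\ge t_0 .$$ Moreover, define $\theta_{11}=\frac1\alpha$ and, for $j\ge1$, $\theta_{j+1,1}=\frac{\theta_{j1}(1-\alpha j)}\alpha$, $\theta_{j+1,\ell}=\frac{\theta_{j\ell}(\ell-\alpha j)}\alpha+\frac{\theta_{j,\ell-1}}\alpha$ for $2\le\ell\le j$, and $\theta_{j+1,j+1}=\frac{\theta_{jj}}\alpha$. Then $$\Phi_j:=\frac{(-1)^j}{j!}\sum_{\ell=1}^j\frac{\theta_{j\ell}}{\Gamma(1-\ell-\alpha)}=\frac1{\Gamma(1-\alpha)}\qquad\text{for all integers } j\ge1 .$$ -/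

import Mathlib

open MeasureTheory Set Filter Topology
open scoped ContDiff

noncomputable section

namespace FracDiff

/-- The space `ℝ^d` with the Euclidean norm. -/
abbrev E (d : ℕ) : Type := EuclideanSpace ℝ (Fin d)

/-- The complex Hilbert space `L²(Ω)`, with respect to Lebesgue measure on `Ω`. -/
abbrev L2 {d : ℕ} (Ω : Set (E d)) : Type :=
  Lp ℂ 2 ((volume : Measure (E d)).restrict Ω)

/-- Smooth boundary: near each boundary point, `Ω` is the sublevel set `{φ < 0}` of a smooth
function with non-vanishing derivative at that point. -/
def HasSmoothBoundary {d : ℕ} (Ω : Set (E d)) : Prop :=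
  ∀ x ∈ frontier Ω, ∃ φ : E d → ℝ, ContDiff ℝ ∞ φ ∧ fderiv ℝ φ x ≠ 0 ∧
    ∀ᶠ y in 𝓝 x, (y ∈ Ω ↔ φ y < 0)

/-- A bounded domain (nonempty, open, connected) with smooth boundary. -/
structure IsSmoothBoundedDomain {d : ℕ} (Ω : Set (E d)) : Prop where
  isOpen : IsOpen Ω
  isConnected : IsConnected Ω
  isBounded : Bornology.IsBounded Ω
  smoothBoundary : HasSmoothBoundary Ω

/-- `f ∈ C¹(Ω̄)`: `f` is continuous on the closure, and it is differentiable in `Ω` with a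
derivative that extends continuously to the closure. -/
def IsC1Closure {d : ℕ} (Ω : Set (E d)) (f : E d → ℝ) : Prop :=
  ContinuousOn f (closure Ω) ∧
    ∃ f' : E d → (E d →L[ℝ] ℝ), ContinuousOn f' (closure Ω) ∧
      ∀ x ∈ Ω, HasFDerivAt f (f' x) x

/-- The partial derivative `∂ⱼ f`. -/
def partialDeriv {d : ℕ} {F : Type} [NormedAddCommGroup F] [NormedSpace ℝ F]
    (j : Fin d) (f : E d → F) (x : E d) : F :=
  fderiv ℝ f x (EuclideanSpace.single j (1 : ℝ))

/-- `φ ∈ C_c^∞(Ω)`, with values in `F` (`F = ℝ` or `F = ℂ`). -/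
structure IsTestFunction {d : ℕ} {F : Type} [NormedAddCommGroup F] [NormedSpace ℝ F]
    (Ω : Set (E d)) (φ : E d → F) : Prop where
  smooth : ContDiff ℝ ∞ φ
  compactSupport : HasCompactSupport φ
  support_subset : tsupport φ ⊆ Ω

/-- `g` is the weak partial derivative `∂ᵢ v` in `Ω`. -/
def IsWeakDeriv {d : ℕ} (Ω : Set (E d)) (i : Fin d) (v g : E d → ℂ) : Prop :=
  ∀ φ : E d → ℝ, IsTestFunction Ω φ →
    ∫ x in Ω, partialDeriv i φ x • v x = -∫ x in Ω, φ x • g x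

/-- `v ∈ H²(Ω)`: all weak derivatives of order one and two exist in `L²(Ω)`. -/
def MemH2 {d : ℕ} (Ω : Set (E d)) (v : L2 Ω) : Prop :=
  ∃ (g : Fin d → L2 Ω) (h : Fin d → Fin d → L2 Ω),
    (∀ j, IsWeakDeriv Ω j v (g j)) ∧ ∀ i j, IsWeakDeriv Ω i (g j) (h i j)

/-- `v ∈ H¹₀(Ω)`: `v` is in `H¹(Ω)` and is a limit of functions in `C_c^∞(Ω)` in the norm
of `H¹(Ω)`. -/
def MemH10 {d : ℕ} (Ω : Set (E d)) (v : L2 Ω) : Prop :=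
  ∃ g : Fin d → L2 Ω, (∀ j, IsWeakDeriv Ω j v (g j)) ∧
    ∀ ε : ℝ, 0 < ε → ∃ φ : E d → ℂ, IsTestFunction Ω φ ∧
      eLpNorm (fun x => φ x - v x) 2 (volume.restrict Ω) < ENNReal.ofReal ε ∧
      ∀ j, eLpNorm (fun x => partialDeriv j φ x - g j x) 2 (volume.restrict Ω)
        < ENNReal.ofReal ε

/-- `C` is a constant in the Poincaré inequality `C ∫ |w|² ≤ ∫ |∇w|²` on `H¹₀(Ω)`. -/
def IsPoincareConstant {d : ℕ} (Ω : Set (E d)) (C : ℝ) : Prop :=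
  ∀ (w : L2 Ω) (g : Fin d → L2 Ω), MemH10 Ω w → (∀ j, IsWeakDeriv Ω j w (g j)) →
    C * ‖w‖ ^ 2 ≤ ∑ j, ‖g j‖ ^ 2

/-- The graph of the operator `A` in `L²(Ω)` with domain `H²(Ω) ∩ H¹₀(Ω)` and
`-A v = ∑ᵢⱼ ∂ᵢ (aᵢⱼ ∂ⱼ v) + ∑ⱼ bⱼ ∂ⱼ v + c v`: `IsImage Ω a b c v f` says that `v` is in the
domain and that `A v = f`. Here `g j` is `∂ⱼ v` and `h i` is `∂ᵢ (∑ⱼ aᵢⱼ ∂ⱼ v)`. -/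
def IsImage {d : ℕ} (Ω : Set (E d)) (a : Fin d → Fin d → E d → ℝ) (b : Fin d → E d → ℝ)
    (c : E d → ℝ) (v f : L2 Ω) : Prop :=
  MemH2 Ω v ∧ MemH10 Ω v ∧
    ∃ g h : Fin d → L2 Ω, (∀ j, IsWeakDeriv Ω j v (g j)) ∧
      (∀ i, IsWeakDeriv Ω i (fun x => ∑ j, (a i j x : ℂ) * g j x) (h i)) ∧
      ∀ᵐ x ∂(volume.restrict Ω),
        f x = -(∑ i, h i x + ∑ j, (b j x : ℂ) * g j x + (c x : ℂ) * v x)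

section Spectral

/-- For an operator `A` in `X` given by its graph (`G v f` means `A v = f`): the bounded
operator `R` is the two-sided inverse `(z - A)⁻¹`. -/
def IsResolvent {X : Type} [NormedAddCommGroup X] [NormedSpace ℂ X]
    (G : X → X → Prop) (z : ℂ) (R : X →L[ℂ] X) : Prop :=
  (∀ g : X, ∃ f : X, G (R g) f ∧ z • R g - f = g) ∧
    ∀ v f : X, G v f → R (z • v - f) = v

/-- The spectrum: the set of all `z` for which `z - A` has no bounded inverse. -/
def spectrumOf {X : Type} [NormedAddCommGroup X] [NormedSpace ℂ X]
    (G : X → X → Prop) : Set ℂ :=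
  {z | ¬ ∃ R : X →L[ℂ] X, IsResolvent G z R}

open Classical in
/-- The resolvent `(z - A)⁻¹` (and `0` for `z` in the spectrum). -/
def resolventOf {X : Type} [NormedAddCommGroup X] [NormedSpace ℂ X]
    (G : X → X → Prop) (z : ℂ) : X →L[ℂ] X :=
  if h : ∃ R : X →L[ℂ] X, IsResolvent G z R then h.choose else 0

/-- The eigenprojection `(2πi)⁻¹ ∮ (z - A)⁻¹ dz` over the circle with centre `lam` and
radius `r`. -/
def eigenprojection {X : Type} [NormedAddCommGroup X] [NormedSpace ℂ X]
    (G : X → X → Prop) (lam : ℂ) (r : ℝ) : X →L[ℂ] X :=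
  (2 * (Real.pi : ℂ) * Complex.I)⁻¹ • ∮ z in C(lam, r), resolventOf G z

end Spectral

/-- The Caputo derivative
`∂_t^α g(t) = Γ(1-α)⁻¹ ∫₀ᵗ (t-s)^{-α} g'(s) ds` of a function with values in `X`. -/
def caputo {X : Type} [NormedAddCommGroup X] [NormedSpace ℝ X] (α : ℝ) (g : ℝ → X) (t : ℝ) :
    X :=
  (Real.Gamma (1 - α))⁻¹ • ∫ s in (0 : ℝ)..t, (t - s) ^ (-α) • deriv g s

/-- `u` solves `∂_t^α u = -A u` for `t > 0`, `u|_{∂Ω} = 0`, `u(0) = u₀`, as a function of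
time with values in `L²(Ω)`. The boundary condition is that `u t` lies in the domain of `A`. -/
structure IsSolution {d : ℕ} (Ω : Set (E d)) (a : Fin d → Fin d → E d → ℝ)
    (b : Fin d → E d → ℝ) (c : E d → ℝ) (α : ℝ) (u₀ : L2 Ω) (u : ℝ → L2 Ω) : Prop where
  continuousOn : ContinuousOn u (Ici 0)
  initial : u 0 = u₀
  differentiableAt : ∀ t : ℝ, 0 < t → DifferentiableAt ℝ u t
  integrable : ∀ t : ℝ, 0 < t →
    IntervalIntegrable (fun s => (t - s) ^ (-α) • deriv u s) volume 0 t
  equation : ∀ t : ℝ, 0 < t → ∃ f : L2 Ω, IsImage Ω a b c (u t) f ∧ caputo α u t = -f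

/-- `w ∈ C(Ω̄)` is the continuous representative of `v ∈ L²(Ω)`. -/
def IsContRep {d : ℕ} (Ω : Set (E d)) (v : L2 Ω) (w : E d → ℂ) : Prop :=
  ContinuousOn w (closure Ω) ∧ ∀ᵐ x ∂(volume.restrict Ω), v x = w x

/-- The coefficients `θ_{jℓ}`, `1 ≤ ℓ ≤ j`, defined recursively (and `0` for other indices). -/
def theta (α : ℝ) : ℕ → ℕ → ℝ
  | 0, _ => 0
  | 1, l => if l = 1 then 1 / α else 0
  | j + 2, l =>
    if l = 1 then theta α (j + 1) 1 * (1 - α * ((j : ℝ) + 1)) / α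
    else if 2 ≤ l ∧ l ≤ j + 1 then
      theta α (j + 1) l * ((l : ℝ) - α * ((j : ℝ) + 1)) / α + theta α (j + 1) (l - 1) / α
    else if l = j + 2 then theta α (j + 1) (j + 1) / α
    else 0

/-- `Φ_j = ((-1)^j / j!) ∑_{ℓ=1}^j θ_{jℓ} / Γ(1-ℓ-α)`. -/
def Phi (α : ℝ) (j : ℕ) : ℝ :=
  (-1) ^ j / (j.factorial : ℝ) *
    ∑ l ∈ Finset.Icc 1 j, theta α j l / Real.Gamma (1 - (l : ℝ) - α)

end FracDiff

end

/-!
The argument has four parts.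

*Reduction to a bounded coercive operator.* The resolvent identity and Cauchy's theorem show that
the eigenprojection `P` is a projection, and that `A` restricts to a bounded operator `B` of the
closed subspace `P L²(Ω)` (`exists_bounded_on_eigenspace`). Integrating by parts against
approximating test functions, ellipticity, the Poincaré inequality and the positivity condition
give `Re ⟨v, A v⟩ ≥ δ ‖v‖²` on the whole domain (`IsImage.re_inner_ge`). Therefore `A⁻¹` is
single-valued, and by Lax-Milgram `w + B` has an inverse of norm at most `δ⁻¹` for all `w` with
`Re w ≥ 0`.

*The solution and its uniqueness.* As `B` is bounded, `t ↦ E_α(-t^α B) u₀` is a convergent power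
series in `t^α`, which solves the equation term by term by the Beta integral
(`caputo_mittagLeffler`). The difference `v` of two solutions vanishes: at a maximum point `T` of
`‖v‖` the extremum principle for the Caputo derivative of `t ↦ Re ⟨v T, v t⟩` contradicts the
accretivity of `A`, unless `v T = 0` (`eq_zero_of_re_inner_caputo_nonpos`).

*Asymptotics.* With `ζ` for the logarithm of the usual variable, and `w = t^{-α} e^{αζ}`,
`2πi E_α(-t^α B)` is the integral of `e^{e^ζ} w (w + B)⁻¹` over a Hankel contour: far to the right
this follows from the Neumann series and Hankel's formula for `1 / Γ` (`hankel_resolvent_eq`).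
The opening `2 θ` of the contour satisfies `π / 2 < θ` and `α θ < π / 2`, so that the integrand
decays along the rays while `Re w ≥ 0`. Since `w (w + B)⁻¹ = w B⁻¹ - w² B⁻¹ (w + B)⁻¹`, a second
application of Hankel's formula yields the first term `B⁻¹ / (Γ(1 - α) t^α)`, and the remainder is
bounded by a multiple of `t^{-2α}` after shifting the contour to a fixed position
(`exists_norm_mittagLeffler_sub_le`).

*Continuity up to the boundary.* A smooth bounded domain has the cone property, and Taylor's
formula along the segments of a cone represents an element of `H²(Ω)` near each boundary point by
averages of it and of its derivatives, which are continuous if `d ≤ 3` because the kernel is then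
square integrable (`MemH2.exists_contRep`). By the closed graph theorem the supremum norm is bounded
by the norm of `L²(Ω)` on `P L²(Ω)` (`exists_norm_contRep_le`), which turns the estimate in `L²(Ω)`
into a uniform one.

The identity for `Φ_j` (`Phi_eq`) is the chain rule for the `j`-th derivative of a function of
`x^{1/α}`: the coefficients `θ_{jℓ}` turn the falling factorials of `m` into that of `m / α`, and
`m = -α` gives `(-1)^j j!`.
-/

namespace FracDiff

/-! ### The coefficients `θ_{jℓ}` -/

section Theta

lemma theta_zero_right (α : ℝ) (j : ℕ) : theta α j 0 = 0 := by
  match j with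
  | 0 => rfl
  | 1 => simp [theta]
  | j + 2 => simp [theta]

lemma theta_of_lt (α : ℝ) {j l : ℕ} (h : j < l) : theta α j l = 0 := by
  match j, h with
  | 0, _ => simp [theta]
  | 1, h => simp [theta, h.ne']
  | j + 2, h =>
    have h1 : l ≠ 1 := by omega
    have h2 : ¬ (l ≤ j + 1) := by omega
    have h3 : l ≠ j + 2 := by omega
    simp [theta, h1, h2, h3]

/-- The three cases of the recursion for `θ` are one formula, since `θ` vanishes outside its
triangle. -/
lemma theta_succ_succ (α : ℝ) (j l : ℕ) :
    theta α (j + 2) (l + 1) =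
      theta α (j + 1) (l + 1) * (((l : ℝ) + 1) - α * ((j : ℝ) + 1)) / α
        + theta α (j + 1) l / α := by
  rcases Nat.eq_zero_or_pos l with rfl | hl
  · simp [theta, theta_zero_right]
  rcases lt_trichotomy l (j + 1) with h | rfl | h
  · have h1 : l ≠ 0 := by omega
    have h2 : 1 ≤ l := hl
    have h3 : l ≤ j := by omega
    simp [theta, h1, h2, h3]
  · rw [theta_of_lt α (show j + 1 < j + 1 + 1 by omega)]
    simp [theta]
  · rw [theta_of_lt α (show j + 2 < l + 1 by omega), theta_of_lt α (show j + 1 < l + 1 by omega),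
      theta_of_lt α (show j + 1 < l by omega)]
    simp

/-- The falling factorials of `m` are turned by `θ` into those of `m / α`: this is the chain rule
for the `j`-th derivative of `x ↦ f (x ^ (1 / α))` evaluated at `f y = y ^ m`. -/
lemma sum_theta_mul_descFactorial (α : ℝ) (hα : α ≠ 0) (m : ℝ) (j : ℕ) :
    ∑ l ∈ Finset.range (j + 2), theta α (j + 1) l * ∏ i ∈ Finset.range l, (m - i) =
      ∏ i ∈ Finset.range (j + 1), (m / α - i) := by
  induction j with
  | zero =>
    simp [theta]
    ring
  | succ j ih =>
    rw [Finset.prod_range_succ, ← ih, Finset.sum_range_succ', theta_zero_right, zero_mul,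
      add_zero]
    have hshift : ∑ l ∈ Finset.range (j + 2), theta α (j + 1) (l + 1) *
        (((l : ℝ) + 1) - α * ((j : ℝ) + 1)) / α * ∏ i ∈ Finset.range (l + 1), (m - i) =
        ∑ l ∈ Finset.range (j + 2), theta α (j + 1) l *
        ((l : ℝ) - α * ((j : ℝ) + 1)) / α * ∏ i ∈ Finset.range l, (m - i) := by
      have h := Finset.sum_range_succ' (fun l : ℕ => theta α (j + 1) l *
        ((l : ℝ) - α * ((j : ℝ) + 1)) / α * ∏ i ∈ Finset.range l, (m - i)) (j + 2)
      rw [Finset.sum_range_succ, theta_of_lt α (show j + 1 < j + 2 by omega),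
        theta_zero_right] at h
      simp only [zero_mul, zero_div, add_zero] at h
      rw [h]
      exact Finset.sum_congr rfl fun l _ => by push_cast; ring
    have hexp : ∀ l ∈ Finset.range (j + 1 + 1),
        theta α (j + 1 + 1) (l + 1) * ∏ i ∈ Finset.range (l + 1), (m - (i : ℝ)) =
        theta α (j + 1) (l + 1) * (((l : ℝ) + 1) - α * ((j : ℝ) + 1)) / α *
            ∏ i ∈ Finset.range (l + 1), (m - i) +
          theta α (j + 1) l / α * ((m - l) * ∏ i ∈ Finset.range l, (m - i)) := by
      intro l _
      rw [theta_succ_succ, Finset.prod_range_succ]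
      ring
    rw [Finset.sum_congr rfl hexp, Finset.sum_add_distrib, hshift, ← Finset.sum_add_distrib,
      Finset.sum_mul]
    refine Finset.sum_congr rfl fun l _ => ?_
    push_cast
    field_simp
    ring

lemma inv_Gamma_one_sub_sub (α : ℝ) (hα0 : 0 < α) (l : ℕ) :
    1 / Real.Gamma (1 - (l : ℝ) - α) =
      (∏ i ∈ Finset.range l, (-α - i)) / Real.Gamma (1 - α) := by
  induction l with
  | zero => simp
  | succ l ih =>
    have hne : (-α - l : ℝ) ≠ 0 := by
      have : (0 : ℝ) ≤ l := l.cast_nonneg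
      linarith
    have h1 : (1 - (l : ℝ) - α) = (-α - l) + 1 := by ring
    have h2 : (1 - ((l + 1 : ℕ) : ℝ) - α) = -α - l := by push_cast; ring
    rw [h1, Real.Gamma_add_one hne] at ih
    rw [h2, Finset.prod_range_succ, mul_div_right_comm, ← ih]
    field_simp

theorem Phi_eq (α : ℝ) (hα0 : 0 < α) (j : ℕ) (hj : 1 ≤ j) :
    Phi α j = 1 / Real.Gamma (1 - α) := by
  obtain ⟨j, rfl⟩ : ∃ k, j = k + 1 := ⟨j - 1, by omega⟩
  have hsum : ∑ l ∈ Finset.Icc 1 (j + 1), theta α (j + 1) l / Real.Gamma (1 - (l : ℝ) - α) =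
      (∑ l ∈ Finset.range (j + 2), theta α (j + 1) l * ∏ i ∈ Finset.range l, (-α - i)) /
        Real.Gamma (1 - α) := by
    rw [Finset.range_eq_Ico, Finset.sum_eq_sum_Ico_succ_bot (by omega), theta_zero_right, zero_mul,
      zero_add, Finset.sum_div]
    refine Finset.sum_congr rfl fun l _ => ?_
    rw [mul_div_assoc, ← inv_Gamma_one_sub_sub α hα0 l, mul_one_div]
  have hprod : ∏ i ∈ Finset.range (j + 1), (-α / α - (i : ℝ)) =
      (-1) ^ (j + 1) * ((j + 1).factorial : ℝ) := by
    rw [← Finset.prod_range_add_one_eq_factorial, Nat.cast_prod]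
    conv_rhs => rw [← Finset.card_range (j + 1), ← Finset.prod_const, Finset.card_range,
      ← Finset.prod_mul_distrib]
    refine Finset.prod_congr rfl fun i _ => ?_
    rw [neg_div, div_self hα0.ne']
    push_cast
    ring
  rw [Phi, hsum, sum_theta_mul_descFactorial α hα0.ne', hprod]
  have hf : ((j + 1).factorial : ℝ) ≠ 0 := by positivity
  have hs : ((-1 : ℝ) ^ (j + 1)) * (-1) ^ (j + 1) = 1 := by
    rw [← mul_pow]; norm_num
  calc _ = ((-1 : ℝ) ^ (j + 1) * (-1) ^ (j + 1)) *
        (((j + 1).factorial : ℝ) / ((j + 1).factorial : ℝ)) / Real.Gamma (1 - α) := by ring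
    _ = _ := by rw [hs, div_self hf, one_mul]

end Theta

/-! ### Resolvents and the eigenprojection of an operator given by its graph -/

section Resolvent

variable {X : Type} [NormedAddCommGroup X] [NormedSpace ℂ X] {G : X → X → Prop}

lemma isResolvent_resolventOf {z : ℂ} (hz : z ∉ spectrumOf G) :
    IsResolvent G z (resolventOf G z) := by
  have h : ∃ R : X →L[ℂ] X, IsResolvent G z R := not_not.mp hz
  rw [resolventOf, dif_pos h]
  exact h.choose_spec

/-- The graph is recovered from any resolvent; in particular it is a closed linear relation. -/
lemma IsResolvent.graph_iff {z : ℂ} {R : X →L[ℂ] X} (hR : IsResolvent G z R) (v f : X) :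
    G v f ↔ R (z • v - f) = v := by
  refine ⟨hR.2 v f, fun h => ?_⟩
  obtain ⟨f', hf', hz⟩ := hR.1 (z • v - f)
  rw [h] at hf' hz
  rwa [← sub_right_injective hz]

/-- The resolvent identity. -/
lemma IsResolvent.sub_eq {z w : ℂ} {R S : X →L[ℂ] X} (hR : IsResolvent G z R)
    (hS : IsResolvent G w S) : R - S = (w - z) • (R * S) := by
  ext g
  obtain ⟨f, hf, hg⟩ := hS.1 g
  have h1 := hR.2 _ _ hf
  have h2 : z • S g - f = g + (z - w) • S g := by
    have hf' : f = w • S g - g := by rw [eq_sub_iff_add_eq, ← eq_sub_iff_add_eq', hg]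
    rw [hf']
    module
  rw [h2, map_add, map_smul] at h1
  change R g - S g = (w - z) • R (S g)
  rw [show (w - z) = -(z - w) by ring, neg_smul, sub_eq_iff_eq_add, add_comm, ← sub_eq_add_neg]
  exact eq_sub_of_add_eq h1

lemma IsResolvent.commute {z w : ℂ} {R S : X →L[ℂ] X} (hR : IsResolvent G z R)
    (hS : IsResolvent G w S) : R * S = S * R := by
  rcases eq_or_ne z w with rfl | hzw
  · have h := hR.sub_eq hS
    rw [sub_self, zero_smul, sub_eq_zero] at h
    rw [h]
  · have h1 := hR.sub_eq hS
    have h2 := hS.sub_eq hR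
    have h3 : (w - z) • (R * S) = (w - z) • (S * R) := by
      rw [← h1, ← neg_sub S R, h2, ← neg_smul, neg_sub]
    exact smul_right_injective _ (sub_ne_zero.mpr hzw.symm) h3

lemma IsResolvent.inverse_one_add {z w : ℂ} {R S : X →L[ℂ] X} (hR : IsResolvent G z R)
    (hS : IsResolvent G w S) :
    IsUnit (1 + (z - w) • S) ∧ R = S * Ring.inverse (1 + (z - w) • S) := by
  have h1 := hR.sub_eq hS
  have hc := hR.commute hS
  have h0 : R - S - (w - z) • (R * S) = 0 := by rw [h1, sub_self]
  have e1 : (1 + (z - w) • S) * (1 - (z - w) • R) = 1 := by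
    have : (1 + (z - w) • S) * (1 - (z - w) • R) =
        1 - (z - w) • (R - S - (w - z) • (R * S)) := by
      simp only [add_mul, mul_sub, one_mul, mul_one, smul_mul_assoc, mul_smul_comm, ← hc]
      module
    rw [this, h0, smul_zero, sub_zero]
  have e2 : (1 - (z - w) • R) * (1 + (z - w) • S) = 1 := by
    have : (1 - (z - w) • R) * (1 + (z - w) • S) =
        1 - (z - w) • (R - S - (w - z) • (R * S)) := by
      simp only [sub_mul, mul_add, one_mul, mul_one, smul_mul_assoc, mul_smul_comm]
      module
    rw [this, h0, smul_zero, sub_zero]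
  have hu : IsUnit (1 + (z - w) • S) := ⟨⟨_, _, e1, e2⟩, rfl⟩
  refine ⟨hu, ?_⟩
  have h3 : R * (1 + (z - w) • S) = S := by
    have : R * (1 + (z - w) • S) = S + (R - S - (w - z) • (R * S)) := by
      simp only [mul_add, mul_one, mul_smul_comm]
      module
    rw [this, h0, add_zero]
  calc R = R * (1 + (z - w) • S) * Ring.inverse (1 + (z - w) • S) := by
        rw [mul_assoc, Ring.mul_inverse_cancel _ hu, mul_one]
    _ = _ := by rw [h3]

variable [CompleteSpace X]

/-- On the resolvent set the resolvent agrees, near each point, with a holomorphic function. -/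
lemma exists_differentiableAt_resolventOf {w : ℂ} (hw : w ∉ spectrumOf G) :
    ∃ F : ℂ → X →L[ℂ] X, DifferentiableAt ℂ F w ∧
      ∀ z, z ∉ spectrumOf G → resolventOf G z = F z := by
  refine ⟨fun z => resolventOf G w * Ring.inverse (1 + (z - w) • resolventOf G w), ?_,
    fun z hz => ((isResolvent_resolventOf hz).inverse_one_add (isResolvent_resolventOf hw)).2⟩
  have h1 : DifferentiableAt ℂ (fun z : ℂ => 1 + (z - w) • resolventOf G w) w := by fun_prop
  have h2 : DifferentiableAt ℂ (Ring.inverse : (X →L[ℂ] X) → _)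
      (1 + (w - w) • resolventOf G w) := by
    apply differentiableAt_inverse
    simp
  exact (h2.comp w h1).const_mul _

lemma continuousOn_resolventOf {S : Set ℂ} (hS : ∀ z ∈ S, z ∉ spectrumOf G) :
    ContinuousOn (resolventOf G) S := by
  intro w hw
  obtain ⟨F, hF, hFe⟩ := exists_differentiableAt_resolventOf (hS w hw)
  exact hF.continuousAt.continuousWithinAt.congr (fun z hz => hFe z (hS z hz)) (hFe w (hS w hw))

lemma differentiableAt_resolventOf {w : ℂ} (hw : ∀ᶠ z in 𝓝 w, z ∉ spectrumOf G) :
    DifferentiableAt ℂ (resolventOf G) w := by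
  obtain ⟨F, hF, hFe⟩ := exists_differentiableAt_resolventOf hw.self_of_nhds
  exact hF.congr_of_eventuallyEq (hw.mono fun z hz => hFe z hz)

end Resolvent

section CircleIntegral

variable {V W : Type} [NormedAddCommGroup V] [NormedSpace ℂ V]
  [NormedAddCommGroup W] [NormedSpace ℂ W]

lemma circleIntegral_clm_comm [CompleteSpace V] [CompleteSpace W] (L : V →L[ℂ] W)
    {f : ℂ → V} {c : ℂ} {r : ℝ}
    (hf : CircleIntegrable f c r) : L (∮ z in C(c, r), f z) = ∮ z in C(c, r), L (f z) := by
  simp only [circleIntegral]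
  rw [← ContinuousLinearMap.intervalIntegral_comp_comm L hf.out]
  simp

lemma circleIntegral_swap {f : ℂ → ℂ → V} {c : ℂ} {r s : ℝ} (hr : 0 ≤ r) (hs : 0 ≤ s)
    (hf : ContinuousOn (fun p : ℂ × ℂ => f p.1 p.2) (Metric.sphere c r ×ˢ Metric.sphere c s)) :
    (∮ z in C(c, r), ∮ w in C(c, s), f z w) = ∮ w in C(c, s), ∮ z in C(c, r), f z w := by
  have hcont : Continuous fun p : ℝ × ℝ => deriv (circleMap c r) p.1 •
      deriv (circleMap c s) p.2 • f (circleMap c r p.1) (circleMap c s p.2) := by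
    have h1 : Continuous fun p : ℝ × ℝ => f (circleMap c r p.1) (circleMap c s p.2) := by
      rw [← continuousOn_univ]
      refine hf.comp (f := fun p : ℝ × ℝ => (circleMap c r p.1, circleMap c s p.2))
        (by fun_prop) fun p _ => ?_
      exact ⟨circleMap_mem_sphere c hr _, circleMap_mem_sphere c hs _⟩
    have h2 : Continuous fun p : ℝ × ℝ => circleMap 0 r p.1 * Complex.I := by fun_prop
    have h3 : Continuous fun p : ℝ × ℝ => circleMap 0 s p.2 * Complex.I := by fun_prop
    simp only [deriv_circleMap]
    exact h2.smul (h3.smul h1)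
  simp only [circleIntegral]
  simp_rw [← intervalIntegral.integral_smul]
  rw [intervalIntegral.integral_of_le Real.two_pi_pos.le]
  simp_rw [intervalIntegral.integral_of_le Real.two_pi_pos.le]
  rw [integral_integral_swap]
  · refine integral_congr_ae (Eventually.of_forall fun x => ?_)
    refine integral_congr_ae (Eventually.of_forall fun y => ?_)
    exact smul_comm _ _ _
  · rw [Measure.prod_restrict, ← IntegrableOn]
    exact (hcont.continuousOn.integrableOn_compact
      (isCompact_Icc.prod isCompact_Icc)).mono_set
      (prod_mono Ioc_subset_Icc_self Ioc_subset_Icc_self)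

end CircleIntegral

section Eigenprojection

variable {X : Type} [NormedAddCommGroup X] [NormedSpace ℂ X] [CompleteSpace X]
  {G : X → X → Prop} {lam : ℂ} {r : ℝ}

lemma eigenprojection_eq_of_le {s : ℝ} (hs : 0 < s) (hsr : s ≤ r)
    (h : ∀ z ∈ Metric.closedBall lam r, z ∈ spectrumOf G → z = lam) :
    eigenprojection G lam r = eigenprojection G lam s := by
  unfold eigenprojection
  congr 1
  refine Complex.circleIntegral_eq_of_differentiable_on_annulus_off_countable hs hsr
    countable_empty (continuousOn_resolventOf fun z hz hzs => ?_) fun z hz =>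
      differentiableAt_resolventOf ?_
  · rw [h z hz.1 hzs] at hz
    exact hz.2 (Metric.mem_ball_self hs)
  · have hopen : IsOpen (Metric.ball lam r \ Metric.closedBall lam s) :=
      Metric.isOpen_ball.sdiff Metric.isClosed_closedBall
    filter_upwards [hopen.mem_nhds hz.1] with y hy hys
    rw [h y (Metric.ball_subset_closedBall hy.1) hys] at hy
    exact hy.2 (Metric.mem_closedBall_self hs.le)

/-- The eigenprojection is idempotent: multiply its integrals over two concentric circles and use
the resolvent identity. -/
lemma eigenprojection_mul_self (hr : 0 < r)
    (h : ∀ z ∈ Metric.closedBall lam r, z ∈ spectrumOf G → z = lam) :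
    eigenprojection G lam r * eigenprojection G lam r = eigenprojection G lam r := by
  have hs : 0 < r / 2 := half_pos hr
  have hsr : r / 2 < r := half_lt_self hr
  have hout : ∀ z ∈ Metric.sphere lam r, z ∉ spectrumOf G := fun z hz hzs =>
    Metric.ne_of_mem_sphere hz hr.ne' (h z (Metric.sphere_subset_closedBall hz) hzs)
  have hin : ∀ z ∈ Metric.sphere lam (r / 2), z ∉ spectrumOf G := fun z hz hzs =>
    Metric.ne_of_mem_sphere hz hs.ne'
      (h z (Metric.closedBall_subset_closedBall hsr.le (Metric.sphere_subset_closedBall hz)) hzs)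
  have hne : ∀ z ∈ Metric.sphere lam r, ∀ w ∈ Metric.closedBall lam (r / 2), w - z ≠ 0 := by
    intro z hz w hw h0
    rw [sub_eq_zero.mp h0] at hw
    rw [mem_sphere_iff_norm] at hz
    rw [mem_closedBall_iff_norm, hz] at hw
    linarith
  have hcr := continuousOn_resolventOf hout
  have hcs := continuousOn_resolventOf hin
  have hi1 : CircleIntegrable (resolventOf G) lam (r / 2) := hcs.circleIntegrable hs.le
  have hi2 : CircleIntegrable (resolventOf G) lam r := hcr.circleIntegrable hr.le
  -- the inner integral, for `z` on the outer circle
  have hinner : ∀ z ∈ Metric.sphere lam r,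
      resolventOf G z * (∮ w in C(lam, r / 2), resolventOf G w) =
        ∮ w in C(lam, r / 2), (z - w)⁻¹ • resolventOf G w := by
    intro z hz
    have hinv : ContinuousOn (fun w : ℂ => (w - z)⁻¹) (Metric.closedBall lam (r / 2)) :=
      (continuousOn_id.sub continuousOn_const).inv₀ (hne z hz)
    have hinv' : CircleIntegrable (fun w : ℂ => (w - z)⁻¹) lam (r / 2) :=
      (hinv.mono Metric.sphere_subset_closedBall).circleIntegrable hs.le
    have hz0 : (∮ w in C(lam, r / 2), (w - z)⁻¹) = 0 := by
      refine Complex.circleIntegral_eq_zero_of_differentiable_on_off_countable hs.le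
        countable_empty hinv fun w hw => ?_
      exact (differentiableAt_id.sub_const z).inv
        (hne z hz w (Metric.ball_subset_closedBall hw.1))
    have h1 := circleIntegral_clm_comm
      (ContinuousLinearMap.mul ℂ (X →L[ℂ] X) (resolventOf G z)) hi1
    rw [ContinuousLinearMap.mul_apply'] at h1
    rw [h1]
    have h2 : ∀ w ∈ Metric.sphere lam (r / 2),
        ContinuousLinearMap.mul ℂ (X →L[ℂ] X) (resolventOf G z) (resolventOf G w) =
          (w - z)⁻¹ • resolventOf G z + (z - w)⁻¹ • resolventOf G w := by
      intro w hw
      have hwz := hne z hz w (Metric.sphere_subset_closedBall hw)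
      have h3 := (isResolvent_resolventOf (hout z hz)).sub_eq (isResolvent_resolventOf (hin w hw))
      rw [ContinuousLinearMap.mul_apply', ← inv_smul_smul₀ hwz (resolventOf G z * resolventOf G w),
        ← h3, smul_sub, sub_eq_add_neg, ← neg_smul, ← inv_neg, neg_sub]
    rw [circleIntegral.integral_congr hs.le h2, circleIntegral.integral_add,
      circleIntegral.integral_smul_const, hz0, zero_smul, zero_add]
    · exact (ContinuousOn.smul (hinv.mono Metric.sphere_subset_closedBall)
        continuousOn_const).circleIntegrable hs.le
    · have hinv2 : ContinuousOn (fun w : ℂ => (z - w)⁻¹) (Metric.sphere lam (r / 2)) := by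
        refine ContinuousOn.inv₀ (by fun_prop) fun w hw h0 => ?_
        exact hne z hz w (Metric.sphere_subset_closedBall hw) (by rw [← neg_sub, h0, neg_zero])
      exact (hinv2.smul hcs).circleIntegrable hs.le
  have hswap : (∮ z in C(lam, r), ∮ w in C(lam, r / 2), (z - w)⁻¹ • resolventOf G w) =
      ∮ w in C(lam, r / 2), ∮ z in C(lam, r), (z - w)⁻¹ • resolventOf G w := by
    refine circleIntegral_swap hr.le hs.le ?_
    refine ContinuousOn.smul (f := fun p : ℂ × ℂ => (p.1 - p.2)⁻¹)
      (g := fun p : ℂ × ℂ => resolventOf G p.2) (ContinuousOn.inv₀ (by fun_prop) ?_)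
      (hcs.comp continuousOn_snd fun p hp => hp.2)
    intro p hp h0
    exact hne p.1 hp.1 p.2 (Metric.sphere_subset_closedBall hp.2) (by rw [← neg_sub, h0, neg_zero])
  have houter : ∀ w ∈ Metric.sphere lam (r / 2),
      (∮ z in C(lam, r), (z - w)⁻¹ • resolventOf G w) =
        (2 * (Real.pi : ℂ) * Complex.I) • resolventOf G w := by
    intro w hw
    rw [circleIntegral.integral_smul_const, circleIntegral.integral_sub_inv_of_mem_ball]
    rw [Metric.mem_ball, Metric.mem_sphere.mp hw]
    exact hsr
  have hprod : (∮ z in C(lam, r), resolventOf G z) * (∮ w in C(lam, r / 2), resolventOf G w) =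
      (2 * (Real.pi : ℂ) * Complex.I) • ∮ w in C(lam, r / 2), resolventOf G w := by
    have h1 := circleIntegral_clm_comm ((ContinuousLinearMap.mul ℂ (X →L[ℂ] X)).flip
      (∮ w in C(lam, r / 2), resolventOf G w)) hi2
    simp only [ContinuousLinearMap.flip_apply, ContinuousLinearMap.mul_apply'] at h1
    rw [h1, circleIntegral.integral_congr hr.le hinner, hswap,
      circleIntegral.integral_congr hs.le houter, circleIntegral.integral_smul]
  have hk : (2 * (Real.pi : ℂ) * Complex.I) ≠ 0 := Complex.two_pi_I_ne_zero
  have he := eigenprojection_eq_of_le hs hsr.le h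
  have h1 : eigenprojection G lam r * eigenprojection G lam (r / 2) =
      eigenprojection G lam (r / 2) := by
    unfold eigenprojection
    rw [smul_mul_smul_comm, hprod, smul_smul, mul_assoc, inv_mul_cancel₀ hk, mul_one]
  rwa [← he] at h1

/-- On the range of the eigenprojection `P` the operator acts as a bounded operator `B`, which
commutes with `P`: take `B = (2πi)⁻¹ ∮ z (z - A)⁻¹ dz`. -/
lemma exists_bounded_on_eigenspace (hr : 0 < r)
    (h : ∀ z ∈ Metric.closedBall lam r, z ∈ spectrumOf G → z = lam) :
    ∃ B : X →L[ℂ] X, B * eigenprojection G lam r = eigenprojection G lam r * B ∧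
      ∀ v, G (eigenprojection G lam r v) (B v) := by
  have hout : ∀ z ∈ Metric.sphere lam r, z ∉ spectrumOf G := fun z hz hzs =>
    Metric.ne_of_mem_sphere hz hr.ne' (h z (Metric.sphere_subset_closedBall hz) hzs)
  have hcr := continuousOn_resolventOf hout
  have hi : CircleIntegrable (resolventOf G) lam r := hcr.circleIntegrable hr.le
  have hiz : CircleIntegrable (fun z => z • resolventOf G z) lam r :=
    (continuousOn_id.smul hcr).circleIntegrable hr.le
  have hk : (2 * (Real.pi : ℂ) * Complex.I) ≠ 0 := Complex.two_pi_I_ne_zero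
  set k : ℂ := (2 * (Real.pi : ℂ) * Complex.I)⁻¹ with hkdef
  set P := eigenprojection G lam r with hP
  have hPdef : P = k • ∮ z in C(lam, r), resolventOf G z := rfl
  have hcommR : ∀ w ∈ Metric.sphere lam r, P * resolventOf G w = resolventOf G w * P := by
    intro w hw
    have h1 := circleIntegral_clm_comm ((ContinuousLinearMap.mul ℂ (X →L[ℂ] X)).flip
      (resolventOf G w)) hi
    have h2 := circleIntegral_clm_comm (ContinuousLinearMap.mul ℂ (X →L[ℂ] X)
      (resolventOf G w)) hi
    simp only [ContinuousLinearMap.flip_apply, ContinuousLinearMap.mul_apply'] at h1 h2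
    rw [hPdef, smul_mul_assoc, mul_smul_comm, h1, h2]
    congr 1
    exact circleIntegral.integral_congr hr.le fun z hz =>
      (isResolvent_resolventOf (hout z hz)).commute (isResolvent_resolventOf (hout w hw))
  refine ⟨k • ∮ z in C(lam, r), z • resolventOf G z, ?_, fun v => ?_⟩
  · have h1 := circleIntegral_clm_comm ((ContinuousLinearMap.mul ℂ (X →L[ℂ] X)).flip P) hiz
    have h2 := circleIntegral_clm_comm (ContinuousLinearMap.mul ℂ (X →L[ℂ] X) P) hiz
    simp only [ContinuousLinearMap.flip_apply, ContinuousLinearMap.mul_apply'] at h1 h2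
    rw [smul_mul_assoc, mul_smul_comm, h1, h2]
    congr 1
    refine circleIntegral.integral_congr hr.le fun z hz => ?_
    simp only [smul_mul_assoc, mul_smul_comm, hcommR z hz]
  · obtain ⟨z₀, hz₀⟩ : (Metric.sphere lam r).Nonempty := NormedSpace.sphere_nonempty.mpr hr.le
    have hR0 := isResolvent_resolventOf (hout z₀ hz₀)
    rw [hR0.graph_iff]
    have hop : resolventOf G z₀ * (z₀ • P - k • ∮ z in C(lam, r), z • resolventOf G z) = P := by
      have h1 : z₀ • P - k • (∮ z in C(lam, r), z • resolventOf G z) =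
          k • ∮ z in C(lam, r), (z₀ - z) • resolventOf G z := by
        rw [hPdef, smul_comm, ← smul_sub, ← circleIntegral.integral_smul,
          ← circleIntegral.integral_sub (f := fun z => z₀ • resolventOf G z)
            (hcr.const_smul z₀ |>.circleIntegrable hr.le) hiz]
        simp_rw [sub_smul]
      have hi' : CircleIntegrable (fun z => (z₀ - z) • resolventOf G z) lam r :=
        ((continuousOn_const.sub continuousOn_id).smul hcr).circleIntegrable hr.le
      have h2 := circleIntegral_clm_comm (ContinuousLinearMap.mul ℂ (X →L[ℂ] X)
        (resolventOf G z₀)) hi'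
      simp only [ContinuousLinearMap.mul_apply'] at h2
      have h3 : ∀ z ∈ Metric.sphere lam r,
          resolventOf G z₀ * ((z₀ - z) • resolventOf G z) =
            resolventOf G z - resolventOf G z₀ := by
        intro z hz
        rw [mul_smul_comm, ← neg_sub z z₀, neg_smul,
          ← hR0.sub_eq (isResolvent_resolventOf (hout z hz)), neg_sub]
      have h4 : (∮ _z in C(lam, r), resolventOf G z₀) = 0 :=
        Complex.circleIntegral_eq_zero_of_differentiable_on_off_countable hr.le
          countable_empty continuousOn_const fun z _ => differentiableAt_const _
      rw [h1, mul_smul_comm, h2, circleIntegral.integral_congr hr.le h3,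
        circleIntegral.integral_sub hi (circleIntegrable_const _ _ _), h4, sub_zero, hPdef]
    have := congrArg (fun T : X →L[ℂ] X => T v) hop
    simpa using this

end Eigenprojection

/-! ### Weak derivatives and multiplication operators -/

section WeakDeriv

variable {d : ℕ} {Ω : Set (E d)}

lemma exists_mulOperator {β : Type} [MeasurableSpace β] {μ : Measure β} (m : β → ℝ)
    (hm : AEStronglyMeasurable m μ) (C : ℝ) (hC : ∀ᵐ x ∂μ, |m x| ≤ C) :
    ∃ T : Lp ℂ 2 μ →L[ℂ] Lp ℂ 2 μ, ∀ v : Lp ℂ 2 μ, T v =ᵐ[μ] fun x => (m x : ℂ) * v x := by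
  have hmc : AEStronglyMeasurable (fun x => (m x : ℂ)) μ :=
    Complex.continuous_ofReal.comp_aestronglyMeasurable hm
  have hbd : ∀ v : Lp ℂ 2 μ, ∀ᵐ x ∂μ, ‖(m x : ℂ) * v x‖ ≤ C * ‖v x‖ := fun v => by
    filter_upwards [hC] with x hx
    rw [norm_mul, Complex.norm_real, Real.norm_eq_abs]
    exact mul_le_mul_of_nonneg_right hx (norm_nonneg _)
  have hL : ∀ v : Lp ℂ 2 μ, MemLp (fun x => (m x : ℂ) * v x) 2 μ := fun v =>
    MemLp.of_le_mul (Lp.memLp v) (hmc.mul (Lp.aestronglyMeasurable v)) (hbd v)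
  let T : Lp ℂ 2 μ →ₗ[ℂ] Lp ℂ 2 μ :=
    { toFun := fun v => (hL v).toLp _
      map_add' := fun v w => by
        apply Lp.ext
        filter_upwards [(hL (v + w)).coeFn_toLp, (hL v).coeFn_toLp, (hL w).coeFn_toLp,
          Lp.coeFn_add ((hL v).toLp _) ((hL w).toLp _), Lp.coeFn_add v w] with x h1 h2 h3 h4 h5
        rw [h1, h4, Pi.add_apply, h2, h3, h5, Pi.add_apply, mul_add]
      map_smul' := fun k v => by
        apply Lp.ext
        filter_upwards [(hL (k • v)).coeFn_toLp, (hL v).coeFn_toLp,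
          Lp.coeFn_smul k ((hL v).toLp _), Lp.coeFn_smul k v] with x h1 h2 h3 h4
        rw [h1, RingHom.id_apply, h3, Pi.smul_apply, h2, h4, Pi.smul_apply, smul_eq_mul,
          smul_eq_mul, mul_left_comm] }
  refine ⟨T.mkContinuous C fun v => ?_, fun v => (hL v).coeFn_toLp⟩
  refine Lp.norm_le_mul_norm_of_ae_le_mul ?_
  filter_upwards [(hL v).coeFn_toLp, hbd v] with x h1 h2
  change ‖(hL v).toLp _ x‖ ≤ _
  rw [h1]
  exact h2

lemma isFiniteMeasure_restrict (hb : Bornology.IsBounded Ω) :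
    IsFiniteMeasure ((volume : Measure (E d)).restrict Ω) :=
  ⟨by rw [Measure.restrict_apply_univ]; exact hb.measure_lt_top⟩

lemma integrable_L2 (hb : Bornology.IsBounded Ω) (v : L2 Ω) :
    Integrable v (volume.restrict Ω) := by
  have := isFiniteMeasure_restrict hb
  exact (Lp.memLp v).integrable one_le_two

lemma IsTestFunction.partialDeriv {F : Type} [NormedAddCommGroup F] [NormedSpace ℝ F]
    {φ : E d → F} (hφ : IsTestFunction Ω φ) (j : Fin d) :
    IsTestFunction Ω (partialDeriv j φ) := by
  have hs : tsupport (FracDiff.partialDeriv j φ) ⊆ tsupport φ :=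
    (closure_mono fun x hx => by
      contrapose! hx
      simp only [Function.mem_support, not_not] at hx ⊢
      rw [FracDiff.partialDeriv, hx]
      rfl).trans (tsupport_fderiv_subset ℝ (f := φ))
  refine ⟨?_, ?_, hs.trans hφ.support_subset⟩
  · exact (hφ.smooth.fderiv_right (m := ∞) (by simp)).clm_apply contDiff_const
  · exact hφ.compactSupport.of_isClosed_subset (isClosed_tsupport _) hs

lemma IsTestFunction.clm_comp {F F' : Type} [NormedAddCommGroup F] [NormedSpace ℝ F]
    [NormedAddCommGroup F'] [NormedSpace ℝ F']
    {φ : E d → F} (hφ : IsTestFunction Ω φ) (L : F →L[ℝ] F') :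
    IsTestFunction Ω (fun x => L (φ x)) := by
  refine ⟨L.contDiff.comp hφ.smooth, hφ.compactSupport.comp_left (map_zero L), ?_⟩
  exact (tsupport_comp_subset (map_zero L) φ).trans hφ.support_subset

lemma IsTestFunction.partialDeriv_clm_comp {F F' : Type} [NormedAddCommGroup F] [NormedSpace ℝ F]
    [NormedAddCommGroup F'] [NormedSpace ℝ F']
    {φ : E d → F} (hφ : IsTestFunction Ω φ) (L : F →L[ℝ] F') (j : Fin d) (x : E d) :
    FracDiff.partialDeriv j (fun x => L (φ x)) x = L (FracDiff.partialDeriv j φ x) := by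
  have h := (L.hasFDerivAt (x := φ x)).comp x
    (hφ.smooth.differentiable (by simp) x).hasFDerivAt
  have h' : fderiv ℝ (fun x => L (φ x)) x = L.comp (fderiv ℝ φ x) := h.fderiv
  rw [FracDiff.partialDeriv, h']
  rfl

lemma IsTestFunction.memLp {φ : E d → ℂ} (hφ : IsTestFunction Ω φ) :
    MemLp φ 2 (volume.restrict Ω) :=
  (hφ.smooth.continuous.memLp_of_hasCompactSupport hφ.compactSupport).restrict Ω

lemma IsTestFunction.integrable_smul {F : Type} [NormedAddCommGroup F] [NormedSpace ℝ F]
    {φ : E d → ℝ} (hφ : IsTestFunction Ω φ) {g : E d → F}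
    (hg : Integrable g (volume.restrict Ω)) :
    Integrable (fun x => φ x • g x) (volume.restrict Ω) := by
  obtain ⟨C, hC⟩ := hφ.smooth.continuous.bounded_above_of_compact_support hφ.compactSupport
  exact hg.bdd_smul C hφ.smooth.continuous.aestronglyMeasurable (Eventually.of_forall hC)

lemma IsTestFunction.eq_zero_of_notMem {F : Type} [NormedAddCommGroup F] [NormedSpace ℝ F]
    {φ : E d → F} (hφ : IsTestFunction Ω φ) {x : E d} (hx : x ∉ Ω) : φ x = 0 :=
  image_eq_zero_of_notMem_tsupport fun h => hx (hφ.support_subset h)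

/-- The fundamental lemma of the calculus of variations in an open subset of `Ω`. -/
lemma ae_eq_zero_of_forall_test {U : Set (E d)} (hU : IsOpen U) {g : E d → ℂ}
    (hg : IntegrableOn g U) (h : ∀ φ : E d → ℝ, IsTestFunction U φ → ∫ x in U, φ x • g x = 0) :
    g =ᵐ[volume.restrict U] 0 := by
  rw [EventuallyEq, ae_restrict_iff' hU.measurableSet]
  refine hU.ae_eq_zero_of_integral_contDiff_smul_eq_zero hg.locallyIntegrableOn
    fun φ h1 h2 h3 => ?_
  have hφ : IsTestFunction U φ := ⟨h1, h2, h3⟩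
  rw [← h φ hφ]
  refine (setIntegral_eq_integral_of_forall_compl_eq_zero fun x hx => ?_).symm
  rw [hφ.eq_zero_of_notMem hx, zero_smul]

lemma IsWeakDeriv.unique (hΩ : IsOpen Ω) (hb : Bornology.IsBounded Ω) {j : Fin d}
    {v : E d → ℂ} {g g' : L2 Ω} (h : IsWeakDeriv Ω j v g) (h' : IsWeakDeriv Ω j v g') :
    g = g' := by
  have h0 : (fun x => g x - g' x) =ᵐ[volume.restrict Ω] 0 := by
    refine ae_eq_zero_of_forall_test hΩ ((integrable_L2 hb g).sub (integrable_L2 hb g'))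
      fun φ hφ => ?_
    simp_rw [smul_sub]
    rw [integral_sub (hφ.integrable_smul (integrable_L2 hb g))
      (hφ.integrable_smul (integrable_L2 hb g')), sub_eq_zero]
    exact neg_injective ((h φ hφ).symm.trans (h' φ hφ))
  apply Lp.ext
  filter_upwards [h0] with x hx
  exact sub_eq_zero.mp hx

lemma IsWeakDeriv.congr {j : Fin d} {v w g k : E d → ℂ} (h : IsWeakDeriv Ω j v g)
    (hvw : v =ᵐ[volume.restrict Ω] w) (hgk : g =ᵐ[volume.restrict Ω] k) :
    IsWeakDeriv Ω j w k := by
  intro φ hφ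
  have h1 : ∫ x in Ω, FracDiff.partialDeriv j φ x • v x =
      ∫ x in Ω, FracDiff.partialDeriv j φ x • w x :=
    integral_congr_ae (hvw.mono fun x hx => by simp only [hx])
  have h2 : ∫ x in Ω, φ x • g x = ∫ x in Ω, φ x • k x :=
    integral_congr_ae (hgk.mono fun x hx => by simp only [hx])
  rw [← h1, ← h2]
  exact h φ hφ

lemma IsWeakDeriv.add {j : Fin d} {v w g k : E d → ℂ} (h : IsWeakDeriv Ω j v g)
    (h' : IsWeakDeriv Ω j w k) (hv : Integrable v (volume.restrict Ω))
    (hw : Integrable w (volume.restrict Ω)) (hg : Integrable g (volume.restrict Ω))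
    (hk : Integrable k (volume.restrict Ω)) :
    IsWeakDeriv Ω j (fun x => v x + w x) (fun x => g x + k x) := by
  intro φ hφ
  have hφ' := hφ.partialDeriv j
  simp_rw [smul_add]
  rw [integral_add (hφ'.integrable_smul hv) (hφ'.integrable_smul hw),
    integral_add (hφ.integrable_smul hg) (hφ.integrable_smul hk), h φ hφ, h' φ hφ, neg_add]

lemma IsWeakDeriv.const_mul {j : Fin d} {v g : E d → ℂ} (h : IsWeakDeriv Ω j v g) (k : ℂ) :
    IsWeakDeriv Ω j (fun x => k * v x) (fun x => k * g x) := by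
  intro φ hφ
  have e1 : ∀ x, FracDiff.partialDeriv j φ x • (k * v x) =
      k * (FracDiff.partialDeriv j φ x • v x) := fun x => by
    rw [mul_smul_comm]
  have e2 : ∀ x, φ x • (k * g x) = k * (φ x • g x) := fun x => by rw [mul_smul_comm]
  simp_rw [e1, e2]
  rw [integral_const_mul, integral_const_mul, h φ hφ, mul_neg]

/-- A weak derivative may be tested with complex functions; written with the inner product of
`L²(Ω)`. -/
lemma IsWeakDeriv.inner_eq (hb : Bornology.IsBounded Ω) {j : Fin d} {v g : L2 Ω}
    (h : IsWeakDeriv Ω j v g) {φ : E d → ℂ} (hφ : IsTestFunction Ω φ) {Φ DΦ : L2 Ω}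
    (hΦ : Φ =ᵐ[volume.restrict Ω] φ) (hDΦ : DΦ =ᵐ[volume.restrict Ω] FracDiff.partialDeriv j φ) :
    inner ℂ Φ g = -inner ℂ DΦ v := by
  have hre := hφ.clm_comp Complex.reCLM
  have him := hφ.clm_comp Complex.imCLM
  have key : ∀ (ψ : E d → ℂ) (Ψ w : L2 Ω), IsTestFunction Ω ψ → Ψ =ᵐ[volume.restrict Ω] ψ →
      inner ℂ Ψ w = (∫ x in Ω, Complex.reCLM (ψ x) • w x) -
        Complex.I * ∫ x in Ω, Complex.imCLM (ψ x) • w x := by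
    intro ψ Ψ w hψ hΨ
    have i1 := (hψ.clm_comp Complex.reCLM).integrable_smul (integrable_L2 hb w)
    have i2 := (hψ.clm_comp Complex.imCLM).integrable_smul (integrable_L2 hb w)
    rw [L2.inner_def, ← integral_const_mul, ← integral_sub i1 (i2.const_mul _)]
    refine integral_congr_ae (hΨ.mono fun x hx => ?_)
    simp only [hx, RCLike.inner_apply, Complex.reCLM_apply, Complex.imCLM_apply,
      Complex.real_smul]
    have : (starRingEnd ℂ) (ψ x) = (ψ x).re - Complex.I * (ψ x).im := by
      apply Complex.ext <;> simp
    rw [this]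
    ring
  rw [key φ Φ g hφ hΦ, key _ DΦ v (hφ.partialDeriv j) hDΦ]
  have e1 := h _ hre
  have e2 := h _ him
  simp_rw [hφ.partialDeriv_clm_comp] at e1 e2
  rw [e1, e2]
  ring

/-- An element of `H¹₀(Ω)` is the limit in `H¹(Ω)` of a sequence of test functions. -/
lemma MemH10.exists_seq (hΩ : IsOpen Ω) (hb : Bornology.IsBounded Ω) {v : L2 Ω} (hv : MemH10 Ω v)
    {g : Fin d → L2 Ω} (hg : ∀ j, IsWeakDeriv Ω j v (g j)) :
    ∃ (φ : ℕ → E d → ℂ) (Φ : ℕ → L2 Ω) (DΦ : ℕ → Fin d → L2 Ω),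
      (∀ n, IsTestFunction Ω (φ n)) ∧ (∀ n, Φ n =ᵐ[volume.restrict Ω] φ n) ∧
      (∀ n j, DΦ n j =ᵐ[volume.restrict Ω] FracDiff.partialDeriv j (φ n)) ∧
      Tendsto Φ atTop (𝓝 v) ∧ ∀ j, Tendsto (fun n => DΦ n j) atTop (𝓝 (g j)) := by
  obtain ⟨g', hg', happ⟩ := hv
  have hgg : g' = g := funext fun j => (hg' j).unique hΩ hb (hg j)
  subst hgg
  choose φ hφ h1 h2 using fun n : ℕ => happ (1 / ((n : ℝ) + 1)) Nat.one_div_pos_of_nat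
  have key : ∀ (ψ : ℕ → E d → ℂ) (hψ : ∀ n, IsTestFunction Ω (ψ n)) (w : L2 Ω),
      (∀ n : ℕ, eLpNorm (fun x => ψ n x - w x) 2 (volume.restrict Ω) <
        ENNReal.ofReal (1 / ((n : ℝ) + 1))) →
      Tendsto (fun n => (hψ n).memLp.toLp (ψ n)) atTop (𝓝 w) := by
    intro ψ hψ w hlt
    rw [tendsto_iff_norm_sub_tendsto_zero]
    refine squeeze_zero (fun n => norm_nonneg _) (fun n => ?_)
      tendsto_one_div_add_atTop_nhds_zero_nat
    rw [Lp.norm_def]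
    refine ENNReal.toReal_le_of_le_ofReal Nat.one_div_pos_of_nat.le ?_
    refine le_of_eq_of_le (eLpNorm_congr_ae ?_) (hlt n).le
    filter_upwards [Lp.coeFn_sub ((hψ n).memLp.toLp (ψ n)) w, (hψ n).memLp.coeFn_toLp]
      with x hx1 hx2
    rw [hx1, Pi.sub_apply, hx2]
  exact ⟨φ, fun n => (hφ n).memLp.toLp _, fun n j => ((hφ n).partialDeriv j).memLp.toLp _, hφ,
    fun n => (hφ n).memLp.coeFn_toLp, fun n j => ((hφ n).partialDeriv j).memLp.coeFn_toLp,
    key φ hφ v h1, fun j => key _ (fun n => (hφ n).partialDeriv j) (g' j) fun n => h2 n j⟩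

end WeakDeriv

/-! ### Coercivity of the elliptic operator -/

section Coercive

variable {d : ℕ} {Ω : Set (E d)}

lemma coeFn_sum_Lp {β ι : Type} [MeasurableSpace β] {μ : Measure β} (s : Finset ι)
    (f : ι → Lp ℂ 2 μ) : ⇑(∑ i ∈ s, f i) =ᵐ[μ] fun x => ∑ i ∈ s, f i x := by
  classical
  induction s using Finset.induction_on with
  | empty => simp only [Finset.sum_empty]; exact Lp.coeFn_zero ℂ 2 μ
  | insert i s hi ih =>
    rw [Finset.sum_insert hi]
    filter_upwards [Lp.coeFn_add (f i) (∑ i ∈ s, f i), ih] with x h1 h2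
    rw [h1, Pi.add_apply, h2, Finset.sum_insert hi]

lemma re_inner_eq_integral {β : Type} [MeasurableSpace β] {μ : Measure β} (f g : Lp ℂ 2 μ) :
    Integrable (fun x => (f x).re * (g x).re + (f x).im * (g x).im) μ ∧
      (inner ℂ f g).re = ∫ x, ((f x).re * (g x).re + (f x).im * (g x).im) ∂μ := by
  have h := L2.integrable_inner (𝕜 := ℂ) f g
  have e : ∀ x, Complex.reCLM (inner ℂ (f x) (g x)) =
      (f x).re * (g x).re + (f x).im * (g x).im := fun x => by
    simp [RCLike.inner_apply]
    ring
  have h' := Complex.reCLM.integrable_comp h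
  simp_rw [e] at h'
  refine ⟨h', ?_⟩
  rw [L2.inner_def, ← Complex.reCLM_apply, ← Complex.reCLM.integral_comp_comm h]
  simp_rw [e]

lemma norm_sq_eq_integral {β : Type} [MeasurableSpace β] {μ : Measure β} (f : Lp ℂ 2 μ) :
    Integrable (fun x => ‖f x‖ ^ 2) μ ∧ ‖f‖ ^ 2 = ∫ x, ‖f x‖ ^ 2 ∂μ := by
  have h := re_inner_eq_integral f f
  have e : ∀ x, (f x).re * (f x).re + (f x).im * (f x).im = ‖f x‖ ^ 2 := fun x => by
    rw [← Complex.normSq_eq_norm_sq, Complex.normSq_apply]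
  simp_rw [e] at h
  refine ⟨h.1, ?_⟩
  rw [← h.2, ← inner_self_eq_norm_sq (𝕜 := ℂ)]
  rfl

/-- The ellipticity condition, applied to the real and imaginary parts of a gradient. -/
lemma sum_re_inner_ge {β : Type} [MeasurableSpace β] {μ : Measure β} {a : Fin d → Fin d → β → ℝ}
    {σ : ℝ} (h_ell : ∀ᵐ x ∂μ, ∀ ζ : Fin d → ℝ,
      σ * ∑ i, ζ i ^ 2 ≤ ∑ i, ∑ j, a i j x * ζ i * ζ j)
    {T : Fin d → Fin d → Lp ℂ 2 μ →L[ℂ] Lp ℂ 2 μ}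
    (hT : ∀ i j v, T i j v =ᵐ[μ] fun x => (a i j x : ℂ) * v x) (g : Fin d → Lp ℂ 2 μ) :
    σ * ∑ i, ‖g i‖ ^ 2 ≤ ∑ i, ∑ j, (inner ℂ (g i) (T i j (g j))).re := by
  have e1 : σ * ∑ i, ‖g i‖ ^ 2 = ∫ x, σ * ∑ i, ‖g i x‖ ^ 2 ∂μ := by
    rw [integral_const_mul, integral_finsetSum _ fun i _ => (norm_sq_eq_integral (g i)).1]
    simp_rw [(norm_sq_eq_integral (g _)).2]
  have e2 : ∑ i, ∑ j, (inner ℂ (g i) (T i j (g j))).re = ∫ x, ∑ i, ∑ j,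
      ((g i x).re * (T i j (g j) x).re + (g i x).im * (T i j (g j) x).im) ∂μ := by
    rw [integral_finsetSum _ fun i _ => integrable_finsetSum _ fun j _ =>
      (re_inner_eq_integral (g i) (T i j (g j))).1]
    refine Finset.sum_congr rfl fun i _ => ?_
    rw [integral_finsetSum _ fun j _ => (re_inner_eq_integral (g i) (T i j (g j))).1]
    exact Finset.sum_congr rfl fun j _ => (re_inner_eq_integral (g i) (T i j (g j))).2
  rw [e1, e2]
  refine integral_mono_ae ?_ ?_ ?_
  · exact (integrable_finsetSum _ fun i _ => (norm_sq_eq_integral (g i)).1).const_mul σ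
  · exact integrable_finsetSum _ fun i _ => integrable_finsetSum _ fun j _ =>
      (re_inner_eq_integral (g i) (T i j (g j))).1
  · have hT' : ∀ᵐ x ∂μ, ∀ i j, T i j (g j) x = (a i j x : ℂ) * g j x :=
      ae_all_iff.mpr fun i => ae_all_iff.mpr fun j => hT i j (g j)
    filter_upwards [h_ell, hT'] with x hx hTx
    have h1 := hx fun i => (g i x).re
    have h2 := hx fun i => (g i x).im
    calc σ * ∑ i, ‖g i x‖ ^ 2 = σ * ∑ i, (g i x).re ^ 2 + σ * ∑ i, (g i x).im ^ 2 := by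
          rw [← mul_add, ← Finset.sum_add_distrib]
          congr 1
          refine Finset.sum_congr rfl fun i _ => ?_
          rw [← Complex.normSq_eq_norm_sq, Complex.normSq_apply]
          ring
      _ ≤ _ := add_le_add h1 h2
      _ = _ := by
          rw [← Finset.sum_add_distrib]
          refine Finset.sum_congr rfl fun i _ => ?_
          rw [← Finset.sum_add_distrib]
          refine Finset.sum_congr rfl fun j _ => ?_
          rw [hTx i j, Complex.re_ofReal_mul, Complex.im_ofReal_mul]
          ring

lemma IsTestFunction.integrable_continuousOn_mul {k : E d → ℝ}
    (hk : IsTestFunction Ω k) {F : E d → ℝ} (hF : ContinuousOn F Ω) :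
    Integrable (fun x => F x * k x) := by
  have hsub : Function.support (fun x => F x * k x) ⊆ tsupport k := fun x hx =>
    subset_tsupport _ (Function.mem_support.mpr (right_ne_zero_of_mul hx))
  rw [← integrableOn_iff_integrable_of_support_subset hsub]
  exact ((hF.mono hk.support_subset).mul hk.smooth.continuous.continuousOn).integrableOn_compact
    hk.compactSupport

lemma integral_mul_partialDeriv (hΩ : IsOpen Ω) {k : E d → ℝ}
    (hk : IsTestFunction Ω k) {b : E d → ℝ} (hb : ContDiffOn ℝ 1 b Ω) (j : Fin d) :
    ∫ x in Ω, b x * partialDeriv j k x = -∫ x in Ω, partialDeriv j b x * k x := by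
  have hcont : ContinuousOn (partialDeriv j b) Ω :=
    (hb.continuousOn_fderiv_of_isOpen hΩ le_rfl).clm_apply continuousOn_const
  have h := integral_mul_fderiv_eq_neg_fderiv_mul_of_integrable (μ := (volume : Measure (E d)))
    (f := k) (g := b) (v := EuclideanSpace.single j (1 : ℝ)) ?_ ?_ ?_
    (fun x _ => hk.smooth.differentiable (by simp) x)
    (fun x hx => (hb.contDiffAt (hΩ.mem_nhds (hk.support_subset hx))).differentiableAt
      (by simp))
  · rw [setIntegral_eq_integral_of_forall_compl_eq_zero,
      setIntegral_eq_integral_of_forall_compl_eq_zero]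
    · change ∫ x, k x * partialDeriv j b x = -∫ x, partialDeriv j k x * b x at h
      simp_rw [mul_comm (k _), mul_comm _ (b _)] at h
      rw [h, neg_neg]
    · intro x hx
      rw [hk.eq_zero_of_notMem hx, mul_zero]
    · intro x hx
      rw [(hk.partialDeriv j).eq_zero_of_notMem hx, mul_zero]
  · have := (hk.partialDeriv j).integrable_continuousOn_mul hb.continuousOn
    simp_rw [mul_comm (b _)] at this
    exact this
  · have := hk.integrable_continuousOn_mul hcont
    simp_rw [mul_comm _ (k _)] at this
    exact this
  · have := hk.integrable_continuousOn_mul hb.continuousOn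
    simp_rw [mul_comm (b _)] at this
    exact this

lemma IsTestFunction.norm_sq {φ : E d → ℂ} (hφ : IsTestFunction Ω φ) :
    IsTestFunction Ω (fun x => ‖φ x‖ ^ 2) := by
  refine ⟨hφ.smooth.norm_sq ℝ, ?_, ?_⟩
  · exact hφ.compactSupport.comp_left (g := fun z : ℂ => ‖z‖ ^ 2) (by simp)
  · exact (tsupport_comp_subset (g := fun z : ℂ => ‖z‖ ^ 2) (by simp) φ).trans hφ.support_subset

lemma IsTestFunction.partialDeriv_norm_sq {φ : E d → ℂ} (hφ : IsTestFunction Ω φ) (j : Fin d)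
    (x : E d) : FracDiff.partialDeriv j (fun x => ‖φ x‖ ^ 2) x =
      2 * ((φ x).re * (FracDiff.partialDeriv j φ x).re +
        (φ x).im * (FracDiff.partialDeriv j φ x).im) := by
  have h := (hφ.smooth.differentiable (by simp) x).hasFDerivAt.norm_sq
  have h' : fderiv ℝ (fun x => ‖φ x‖ ^ 2) x = _ := h.fderiv
  rw [FracDiff.partialDeriv, h']
  simp [FracDiff.partialDeriv, Complex.inner]
  ring

/-- The lower order terms on a test function: the first order part is integrated by parts, which
brings in `-½ div b`. -/
lemma re_inner_lower_order_le (hΩ : IsOpen Ω)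
    {b : Fin d → E d → ℝ} {c : E d → ℝ} (hb : ∀ j, ContDiffOn ℝ 1 (b j) Ω)
    (hc : ContinuousOn c Ω) {κ : ℝ}
    (hκ : ∀ x ∈ Ω, -κ ≤ 1 / 2 * ∑ j, partialDeriv j (b j) x - c x)
    {Tb : Fin d → L2 Ω →L[ℂ] L2 Ω} {Tc : L2 Ω →L[ℂ] L2 Ω}
    (hTb : ∀ j v, Tb j v =ᵐ[volume.restrict Ω] fun x => (b j x : ℂ) * v x)
    (hTc : ∀ v, Tc v =ᵐ[volume.restrict Ω] fun x => (c x : ℂ) * v x)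
    {φ : E d → ℂ} (hφ : IsTestFunction Ω φ) {Φ : L2 Ω} {DΦ : Fin d → L2 Ω}
    (hΦ : Φ =ᵐ[volume.restrict Ω] φ)
    (hDΦ : ∀ j, DΦ j =ᵐ[volume.restrict Ω] partialDeriv j φ) :
    (inner ℂ Φ (∑ j, Tb j (DΦ j) + Tc Φ)).re ≤ κ * ‖Φ‖ ^ 2 := by
  have hq := hφ.norm_sq
  have hbj : ∀ j, (inner ℂ Φ (Tb j (DΦ j))).re =
      -∫ x in Ω, 1 / 2 * (partialDeriv j (b j) x * ‖φ x‖ ^ 2) := by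
    intro j
    rw [integral_const_mul, ← mul_neg, ← integral_mul_partialDeriv hΩ hq (hb j) j,
      ← integral_const_mul, (re_inner_eq_integral _ _).2]
    refine integral_congr_ae ?_
    filter_upwards [hΦ, hDΦ j, hTb j (DΦ j)] with x h1 h2 h3
    rw [h3, h1, h2, hφ.partialDeriv_norm_sq, Complex.re_ofReal_mul, Complex.im_ofReal_mul]
    ring
  have hcc : (inner ℂ Φ (Tc Φ)).re = ∫ x in Ω, c x * ‖φ x‖ ^ 2 := by
    rw [(re_inner_eq_integral _ _).2]
    refine integral_congr_ae ?_
    filter_upwards [hΦ, hTc Φ] with x h1 h3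
    rw [h3, h1, Complex.re_ofReal_mul, Complex.im_ofReal_mul, ← Complex.normSq_eq_norm_sq,
      Complex.normSq_apply]
    ring
  have hnorm : κ * ‖Φ‖ ^ 2 = ∫ x in Ω, κ * ‖φ x‖ ^ 2 := by
    rw [(norm_sq_eq_integral Φ).2, ← integral_const_mul]
    refine integral_congr_ae (hΦ.mono fun x hx => ?_)
    simp only [hx]
  have hint : ∀ j, IntegrableOn (fun x => 1 / 2 * (partialDeriv j (b j) x * ‖φ x‖ ^ 2)) Ω :=
    fun j => ((hq.integrable_continuousOn_mul
      (((hb j).continuousOn_fderiv_of_isOpen hΩ le_rfl).clm_apply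
        continuousOn_const)).const_mul _).integrableOn
  have hintc : IntegrableOn (fun x => c x * ‖φ x‖ ^ 2) Ω :=
    (hq.integrable_continuousOn_mul hc).integrableOn
  rw [inner_add_right, inner_sum, Complex.add_re, Complex.re_sum, Finset.sum_congr rfl
    fun j _ => hbj j, hcc, hnorm, Finset.sum_neg_distrib, ← integral_finsetSum _
    fun j _ => hint j, neg_add_eq_sub, ← integral_sub hintc (integrable_finsetSum _
    fun j _ => hint j)]
  refine setIntegral_mono_on (hintc.sub (integrable_finsetSum _ fun j _ => hint j))
    (hq.integrable_continuousOn_mul continuousOn_const).integrableOn hΩ.measurableSet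
    fun x hx => ?_
  rw [← Finset.mul_sum, ← Finset.sum_mul, ← mul_assoc, ← sub_mul]
  exact mul_le_mul_of_nonneg_right (by linarith [hκ x hx]) (by positivity)

/-- The elliptic operator is coercive on its domain: `δ ‖v‖² ≤ Re ⟨v, A v⟩`. -/
theorem IsImage.re_inner_ge (hΩ : IsOpen Ω) (hbd : Bornology.IsBounded Ω)
    {a : Fin d → Fin d → E d → ℝ} {b : Fin d → E d → ℝ} {c : E d → ℝ}
    (ha : ∀ i j, ContinuousOn (a i j) (closure Ω)) (hb : ∀ j, ContDiffOn ℝ 1 (b j) Ω)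
    (hb_bdd : ∃ M : ℝ, ∀ j, ∀ x ∈ Ω, |b j x| ≤ M) (hc : ContinuousOn c (closure Ω))
    {σ : ℝ} (hσ : 0 < σ) (h_ell : ∀ x ∈ closure Ω, ∀ ζ : Fin d → ℝ,
      σ * ∑ i, ζ i ^ 2 ≤ ∑ i, ∑ j, a i j x * ζ i * ζ j)
    {CΩ : ℝ} (h_poincare : IsPoincareConstant Ω CΩ) {δ : ℝ}
    (h_pos : ∀ x ∈ Ω, δ ≤ (1 / 2 * ∑ j, partialDeriv j (b j) x - c x) + CΩ * σ)
    {v f : L2 Ω} (h : IsImage Ω a b c v f) :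
    δ * ‖v‖ ^ 2 ≤ (inner ℂ v f).re := by
  obtain ⟨-, hv0, g, h, hg, hh, hf⟩ := h
  have hcpt : IsCompact (closure Ω) := hbd.isCompact_closure
  have hmeas : ∀ m : E d → ℝ, ContinuousOn m Ω →
      AEStronglyMeasurable m (volume.restrict Ω) := fun m hm =>
    hm.aestronglyMeasurable hΩ.measurableSet
  have hmul : ∀ m : E d → ℝ, ContinuousOn m (closure Ω) → ∃ T : L2 Ω →L[ℂ] L2 Ω, ∀ v : L2 Ω,
      T v =ᵐ[volume.restrict Ω] fun x => (m x : ℂ) * v x := by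
    intro m hm
    obtain ⟨C, hC⟩ := hcpt.exists_bound_of_continuousOn hm
    exact exists_mulOperator m (hmeas m (hm.mono subset_closure)) C
      (ae_restrict_of_forall_mem hΩ.measurableSet fun x hx => hC x (subset_closure hx))
  choose Ta hTa using fun i j => hmul (a i j) (ha i j)
  obtain ⟨Tc, hTc⟩ := hmul c hc
  obtain ⟨M, hM⟩ := hb_bdd
  choose Tb hTb using fun j => exists_mulOperator (b j) (hmeas _ (hb j).continuousOn) M
    (ae_restrict_of_forall_mem hΩ.measurableSet fun x hx => hM j x hx)
  obtain ⟨φ, Φ, DΦ, hφ, hΦ, hDΦ, hlim, hDlim⟩ := hv0.exists_seq hΩ hbd hg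
  have hF : ∀ i, IsWeakDeriv Ω i (∑ j, Ta i j (g j) : L2 Ω) (h i) := fun i => by
    refine (hh i).congr ?_ EventuallyEq.rfl
    have hT' : ∀ᵐ x ∂(volume.restrict Ω), ∀ j, Ta i j (g j) x = (a i j x : ℂ) * g j x :=
      ae_all_iff.mpr fun j => hTa i j (g j)
    filter_upwards [coeFn_sum_Lp Finset.univ fun j => Ta i j (g j), hT'] with x h1 h2
    rw [h1]
    exact Finset.sum_congr rfl fun j _ => (h2 j).symm
  have hf' : f = -(∑ i, h i + (∑ j, Tb j (g j) + Tc v)) := by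
    apply Lp.ext
    have hT' : ∀ᵐ x ∂(volume.restrict Ω), ∀ j, Tb j (g j) x = (b j x : ℂ) * g j x :=
      ae_all_iff.mpr fun j => hTb j (g j)
    filter_upwards [hf, coeFn_sum_Lp Finset.univ fun j => Tb j (g j),
      coeFn_sum_Lp Finset.univ h, hT', hTc v,
      Lp.coeFn_neg (∑ i, h i + (∑ j, Tb j (g j) + Tc v)),
      Lp.coeFn_add (∑ i, h i) (∑ j, Tb j (g j) + Tc v),
      Lp.coeFn_add (∑ j, Tb j (g j)) (Tc v)] with x h1 h2 h3 h4 h5 h6 h7 h8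
    rw [h1, h6, Pi.neg_apply, h7, Pi.add_apply, h8, Pi.add_apply, h2, h3, h5,
      Finset.sum_congr rfl fun j _ => h4 j, add_assoc]
  -- the weak form of the equation, tested with `v` itself
  have hweak : ∀ i, inner ℂ v (h i) = -inner ℂ (g i) (∑ j, Ta i j (g j)) := fun i => by
    refine tendsto_nhds_unique (hlim.inner tendsto_const_nhds) ?_
    have := ((hDlim i).inner (tendsto_const_nhds (x := ∑ j, Ta i j (g j)))).neg (G := ℂ)
    refine this.congr fun n => ?_
    exact ((hF i).inner_eq hbd (hφ n) (hΦ n) (hDΦ n i)).symm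
  have hlow : (inner ℂ v (∑ j, Tb j (g j) + Tc v)).re ≤ (CΩ * σ - δ) * ‖v‖ ^ 2 := by
    have hl : Tendsto (fun n => ∑ j, Tb j (DΦ n j) + Tc (Φ n)) atTop
        (𝓝 (∑ j, Tb j (g j) + Tc v)) :=
      (tendsto_finsetSum _ fun j _ => ((Tb j).continuous.tendsto _).comp (hDlim j)).add
        ((Tc.continuous.tendsto _).comp hlim)
    have h1 := (Complex.continuous_re.tendsto _).comp (hlim.inner (𝕜 := ℂ) hl)
    have h2 := (hlim.norm.pow 2).const_mul (CΩ * σ - δ)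
    refine le_of_tendsto_of_tendsto' h1 h2 fun n => ?_
    exact re_inner_lower_order_le hΩ hb (hc.mono subset_closure)
      (fun x hx => by linarith [h_pos x hx]) hTb hTc (hφ n) (hΦ n) (hDΦ n)
  have hell := sum_re_inner_ge (ae_restrict_of_forall_mem hΩ.measurableSet
    fun x hx => h_ell x (subset_closure hx)) hTa g
  have hp := mul_le_mul_of_nonneg_left (h_poincare v g hv0 hg) hσ.le
  have e : (inner ℂ v f).re = ∑ i, ∑ j, (inner ℂ (g i) (Ta i j (g j))).re -
      (inner ℂ v (∑ j, Tb j (g j) + Tc v)).re := by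
    rw [hf', inner_neg_right, inner_add_right, inner_sum, Finset.sum_congr rfl fun i _ => hweak i,
      Finset.sum_neg_distrib, neg_add, neg_neg, Complex.add_re, Complex.neg_re, Complex.re_sum,
      sub_eq_add_neg]
    simp_rw [inner_sum, Complex.re_sum]
  rw [e]
  linarith

/-! ### Linearity of the elliptic operator -/

lemma IsWeakDeriv.add_Lp (hbd : Bornology.IsBounded Ω) {j : Fin d} {v w g k : L2 Ω}
    (h : IsWeakDeriv Ω j v g) (h' : IsWeakDeriv Ω j w k) :
    IsWeakDeriv Ω j (v + w : L2 Ω) (g + k : L2 Ω) :=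
  (h.add h' (integrable_L2 hbd v) (integrable_L2 hbd w) (integrable_L2 hbd g)
    (integrable_L2 hbd k)).congr (Lp.coeFn_add v w).symm (Lp.coeFn_add g k).symm

lemma IsWeakDeriv.smul_Lp {j : Fin d} {v g : L2 Ω} (h : IsWeakDeriv Ω j v g) (k : ℂ) :
    IsWeakDeriv Ω j (k • v : L2 Ω) (k • g : L2 Ω) :=
  (h.const_mul k).congr (Lp.coeFn_smul k v).symm (Lp.coeFn_smul k g).symm

lemma MemH2.add (hbd : Bornology.IsBounded Ω) {v w : L2 Ω} (hv : MemH2 Ω v) (hw : MemH2 Ω w) :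
    MemH2 Ω (v + w) := by
  obtain ⟨g, h, hg, hh⟩ := hv
  obtain ⟨g', h', hg', hh'⟩ := hw
  exact ⟨fun j => g j + g' j, fun i j => h i j + h' i j, fun j => (hg j).add_Lp hbd (hg' j),
    fun i j => (hh i j).add_Lp hbd (hh' i j)⟩

lemma MemH2.smul {v : L2 Ω} (hv : MemH2 Ω v) (k : ℂ) : MemH2 Ω (k • v) := by
  obtain ⟨g, h, hg, hh⟩ := hv
  exact ⟨fun j => k • g j, fun i j => k • h i j, fun j => (hg j).smul_Lp k,
    fun i j => (hh i j).smul_Lp k⟩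

lemma eLpNorm_sub_add_lt {ε : ℝ} (hε : 0 < ε) {φ ψ : E d → ℂ} (hφ : IsTestFunction Ω φ)
    (hψ : IsTestFunction Ω ψ) {v w : L2 Ω}
    (h1 : eLpNorm (fun x => φ x - v x) 2 (volume.restrict Ω) < ENNReal.ofReal (ε / 2))
    (h2 : eLpNorm (fun x => ψ x - w x) 2 (volume.restrict Ω) < ENNReal.ofReal (ε / 2)) :
    eLpNorm (fun x => (φ x + ψ x) - (v + w : L2 Ω) x) 2 (volume.restrict Ω) <
      ENNReal.ofReal ε := by
  have hm1 : AEStronglyMeasurable (fun x => φ x - v x) (volume.restrict Ω) :=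
    hφ.smooth.continuous.aestronglyMeasurable.sub (Lp.aestronglyMeasurable v)
  have hm2 : AEStronglyMeasurable (fun x => ψ x - w x) (volume.restrict Ω) :=
    hψ.smooth.continuous.aestronglyMeasurable.sub (Lp.aestronglyMeasurable w)
  have e : (fun x => (φ x + ψ x) - (v + w : L2 Ω) x) =ᵐ[volume.restrict Ω]
      (fun x => φ x - v x) + fun x => ψ x - w x := by
    filter_upwards [Lp.coeFn_add v w] with x hx
    rw [hx, Pi.add_apply, Pi.add_apply]
    ring
  rw [eLpNorm_congr_ae e]
  refine (eLpNorm_add_le hm1 hm2 one_le_two).trans_lt ?_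
  rw [← add_halves ε, ENNReal.ofReal_add (half_pos hε).le (half_pos hε).le]
  exact ENNReal.add_lt_add h1 h2

lemma MemH10.add (hbd : Bornology.IsBounded Ω) {v w : L2 Ω} (hv : MemH10 Ω v)
    (hw : MemH10 Ω w) : MemH10 Ω (v + w) := by
  obtain ⟨g, hg, happ⟩ := hv
  obtain ⟨g', hg', happ'⟩ := hw
  refine ⟨fun j => g j + g' j, fun j => (hg j).add_Lp hbd (hg' j), fun ε hε => ?_⟩
  obtain ⟨φ, hφ, h1, h2⟩ := happ (ε / 2) (half_pos hε)
  obtain ⟨ψ, hψ, h1', h2'⟩ := happ' (ε / 2) (half_pos hε)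
  refine ⟨fun x => φ x + ψ x, ⟨hφ.smooth.add hψ.smooth,
    hφ.compactSupport.add hψ.compactSupport, ?_⟩, eLpNorm_sub_add_lt hε hφ hψ h1 h1',
    fun j => ?_⟩
  · exact (tsupport_add φ ψ).trans (union_subset hφ.support_subset hψ.support_subset)
  · have e : ∀ x, partialDeriv j (fun x => φ x + ψ x) x =
        partialDeriv j φ x + partialDeriv j ψ x := fun x => by
      rw [partialDeriv, fderiv_fun_add (hφ.smooth.differentiable (by simp) x)
        (hψ.smooth.differentiable (by simp) x)]
      rfl
    simp_rw [e]
    exact eLpNorm_sub_add_lt hε (hφ.partialDeriv j) (hψ.partialDeriv j) (h2 j) (h2' j)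

lemma eLpNorm_sub_smul_lt {ε : ℝ} (hε : 0 < ε) (k : ℂ) {φ : E d → ℂ} {v : L2 Ω}
    (h1 : eLpNorm (fun x => φ x - v x) 2 (volume.restrict Ω) <
      ENNReal.ofReal (ε / (‖k‖ + 1))) :
    eLpNorm (fun x => k * φ x - (k • v : L2 Ω) x) 2 (volume.restrict Ω) <
      ENNReal.ofReal ε := by
  have hk : 0 < ‖k‖ + 1 := by positivity
  have e : (fun x => k * φ x - (k • v : L2 Ω) x) =ᵐ[volume.restrict Ω]
      k • fun x => φ x - v x := by
    filter_upwards [Lp.coeFn_smul k v] with x hx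
    rw [hx, Pi.smul_apply, Pi.smul_apply, smul_eq_mul, smul_eq_mul]
    ring
  rw [eLpNorm_congr_ae e, eLpNorm_const_smul]
  have h2 : ‖k‖ₑ * eLpNorm (fun x => φ x - v x) 2 (volume.restrict Ω) ≤
      ENNReal.ofReal ‖k‖ * ENNReal.ofReal (ε / (‖k‖ + 1)) := by
    rw [ofReal_norm]
    gcongr
  refine h2.trans_lt ?_
  rw [← ENNReal.ofReal_mul (norm_nonneg k), ENNReal.ofReal_lt_ofReal_iff hε, mul_div_assoc',
    div_lt_iff₀ hk]
  nlinarith [norm_nonneg k]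

lemma MemH10.smul {v : L2 Ω} (hv : MemH10 Ω v) (k : ℂ) : MemH10 Ω (k • v) := by
  obtain ⟨g, hg, happ⟩ := hv
  refine ⟨fun j => k • g j, fun j => (hg j).smul_Lp k, fun ε hε => ?_⟩
  have hk : 0 < ‖k‖ + 1 := by positivity
  obtain ⟨φ, hφ, h1, h2⟩ := happ (ε / (‖k‖ + 1)) (div_pos hε hk)
  let L : ℂ →L[ℝ] ℂ := ContinuousLinearMap.mul ℝ ℂ k
  refine ⟨fun x => k * φ x, hφ.clm_comp L, eLpNorm_sub_smul_lt hε k h1, fun j => ?_⟩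
  have e : ∀ x, partialDeriv j (fun x => k * φ x) x = k * partialDeriv j φ x :=
    hφ.partialDeriv_clm_comp L j
  simp_rw [e]
  exact eLpNorm_sub_smul_lt hε k (h2 j)

variable {a : Fin d → Fin d → E d → ℝ} {b : Fin d → E d → ℝ} {c : E d → ℝ}

/-- Only the continuity of the coefficients `aᵢⱼ` is needed, to make `aᵢⱼ ∂ⱼ v` integrable. -/
lemma IsImage.add (hΩ : IsOpen Ω) (hbd : Bornology.IsBounded Ω)
    (ha : ∀ i j, ContinuousOn (a i j) (closure Ω)) {v w f k : L2 Ω}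
    (h : IsImage Ω a b c v f) (h' : IsImage Ω a b c w k) : IsImage Ω a b c (v + w) (f + k) := by
  obtain ⟨hv2, hv0, g, h, hg, hh, hf⟩ := h
  obtain ⟨hv2', hv0', g', h', hg', hh', hf'⟩ := h'
  have hint : ∀ i (g : Fin d → L2 Ω),
      Integrable (fun x => ∑ j, (a i j x : ℂ) * g j x) (volume.restrict Ω) := by
    intro i g
    refine integrable_finsetSum _ fun j _ => ?_
    obtain ⟨C, hC⟩ := hbd.isCompact_closure.exists_bound_of_continuousOn (ha i j)
    refine (integrable_L2 hbd (g j)).bdd_mul (c := C) ?_ ?_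
    · exact Complex.continuous_ofReal.comp_aestronglyMeasurable
        (((ha i j).mono subset_closure).aestronglyMeasurable hΩ.measurableSet)
    · refine ae_restrict_of_forall_mem hΩ.measurableSet fun x hx => ?_
      rw [Complex.norm_real]
      exact hC x (subset_closure hx)
  have hadd : ∀ᵐ x ∂(volume.restrict Ω), ∀ j, (g j + g' j : L2 Ω) x = g j x + g' j x :=
    ae_all_iff.mpr fun j => Lp.coeFn_add (g j) (g' j)
  have hadd' : ∀ᵐ x ∂(volume.restrict Ω), ∀ j, (h j + h' j : L2 Ω) x = h j x + h' j x :=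
    ae_all_iff.mpr fun j => Lp.coeFn_add (h j) (h' j)
  refine ⟨hv2.add hbd hv2', hv0.add hbd hv0', fun j => g j + g' j, fun i => h i + h' i,
    fun j => (hg j).add_Lp hbd (hg' j), fun i => ?_, ?_⟩
  · refine ((hh i).add (hh' i) (hint i g) (hint i g') (integrable_L2 hbd (h i))
      (integrable_L2 hbd (h' i))).congr ?_ (Lp.coeFn_add (h i) (h' i)).symm
    filter_upwards [hadd] with x hx
    rw [← Finset.sum_add_distrib]
    exact Finset.sum_congr rfl fun j _ => by rw [hx j, mul_add]
  · filter_upwards [hf, hf', hadd, hadd', Lp.coeFn_add f k, Lp.coeFn_add v w]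
      with x h1 h2 h3 h4 h5 h6
    rw [h5, Pi.add_apply, h1, h2, h6, Pi.add_apply]
    simp only [h3, h4, mul_add, Finset.sum_add_distrib]
    ring

lemma IsImage.smul {v f : L2 Ω} (h : IsImage Ω a b c v f) (k : ℂ) :
    IsImage Ω a b c (k • v) (k • f) := by
  obtain ⟨hv2, hv0, g, h, hg, hh, hf⟩ := h
  have hsm : ∀ᵐ x ∂(volume.restrict Ω), ∀ j, (k • g j : L2 Ω) x = k * g j x :=
    ae_all_iff.mpr fun j => Lp.coeFn_smul k (g j)
  have hsm' : ∀ᵐ x ∂(volume.restrict Ω), ∀ j, (k • h j : L2 Ω) x = k * h j x :=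
    ae_all_iff.mpr fun j => Lp.coeFn_smul k (h j)
  refine ⟨hv2.smul k, hv0.smul k, fun j => k • g j, fun i => k • h i,
    fun j => (hg j).smul_Lp k, fun i => ?_, ?_⟩
  · refine ((hh i).const_mul k).congr ?_ (Lp.coeFn_smul k (h i)).symm
    filter_upwards [hsm] with x hx
    rw [Finset.mul_sum]
    exact Finset.sum_congr rfl fun j _ => by rw [hx j, mul_left_comm]
  · filter_upwards [hf, hsm, hsm', Lp.coeFn_smul k f, Lp.coeFn_smul k v]
      with x h1 h3 h4 h5 h6
    rw [h5, Pi.smul_apply, h1, h6, Pi.smul_apply]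
    simp only [h3, h4, smul_eq_mul, mul_left_comm _ k, ← Finset.mul_sum]
    ring

lemma IsImage.sub (hΩ : IsOpen Ω) (hbd : Bornology.IsBounded Ω)
    (ha : ∀ i j, ContinuousOn (a i j) (closure Ω)) {v w f k : L2 Ω}
    (h : IsImage Ω a b c v f) (h' : IsImage Ω a b c w k) : IsImage Ω a b c (v - w) (f - k) := by
  have := h.add hΩ hbd ha (h'.smul (-1))
  rwa [neg_one_smul, neg_one_smul, ← sub_eq_add_neg, ← sub_eq_add_neg] at this

end Coercive

/-! ### Functions in `H²` of a smooth domain of dimension at most three are continuous up to the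
boundary -/

section Cone

variable {d : ℕ} {Ω : Set (E d)}

/-- The uniform interior cone property, locally: near a point of the closure, moving from a point of
`Ω` along a direction in a fixed ball does not leave `Ω`. -/
lemma exists_cone (hΩ : IsSmoothBoundedDomain Ω) {x₀ : E d} (hx₀ : x₀ ∈ closure Ω) :
    ∃ U : Set (E d), IsOpen U ∧ x₀ ∈ U ∧ ∃ e₀ : E d, ∃ ρ : ℝ, 0 < ρ ∧
      ∀ x ∈ U ∩ Ω, ∀ η ∈ Metric.closedBall e₀ ρ, ∀ s ∈ Icc (0 : ℝ) 1, x + s • η ∈ Ω := by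
  by_cases hin : x₀ ∈ Ω
  · obtain ⟨r, hr, hrΩ⟩ := Metric.isOpen_iff.mp hΩ.isOpen x₀ hin
    refine ⟨Metric.ball x₀ (r / 2), Metric.isOpen_ball, Metric.mem_ball_self (half_pos hr), 0,
      r / 2, half_pos hr, fun x hx η hη s hs => hrΩ ?_⟩
    rw [mem_ball_iff_norm]
    have h1 := mem_ball_iff_norm.mp hx.1
    have h2 := mem_closedBall_zero_iff.mp hη
    calc ‖x + s • η - x₀‖ = ‖(x - x₀) + s • η‖ := by congr 1; abel
      _ ≤ ‖x - x₀‖ + ‖s • η‖ := norm_add_le _ _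
      _ ≤ ‖x - x₀‖ + 1 * ‖η‖ := by
        rw [norm_smul, Real.norm_of_nonneg hs.1]
        gcongr
        exact hs.2
      _ < r := by linarith
  · have hfr : x₀ ∈ frontier Ω := ⟨hx₀, by rwa [hΩ.isOpen.interior_eq]⟩
    obtain ⟨φ, hφ, hne, hiff⟩ := hΩ.smoothBoundary x₀ hfr
    obtain ⟨e, he⟩ : ∃ e, fderiv ℝ φ x₀ e < 0 := by
      obtain ⟨e, he⟩ := ContinuousLinearMap.exists_ne_zero hne
      rcases lt_or_gt_of_ne he with h | h
      · exact ⟨e, h⟩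
      · exact ⟨-e, by rw [map_neg]; linarith⟩
    have hcont : Continuous fun p : E d × E d => fderiv ℝ φ p.1 p.2 :=
      ((hφ.continuous_fderiv (by simp)).comp continuous_fst).clm_apply continuous_snd
    have hev : ∀ᶠ p : E d × E d in 𝓝 (x₀, e), fderiv ℝ φ p.1 p.2 < 0 :=
      hcont.continuousAt.eventually_lt continuousAt_const he
    obtain ⟨r₁, hr₁, h1⟩ := Metric.eventually_nhds_iff_ball.mp hev
    obtain ⟨r₂, hr₂, h2⟩ := Metric.eventually_nhds_iff_ball.mp hiff
    set r := min r₁ r₂ with hr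
    have hr0 : 0 < r := lt_min hr₁ hr₂
    have hK : 0 < ‖e‖ + r := by positivity
    -- directions are scaled down so that a unit step moves by less than `r / 2`
    set τ : ℝ := r / (4 * (‖e‖ + r)) with hτ
    have hτ0 : 0 < τ := by positivity
    have hτK : τ * (‖e‖ + r) < r / 2 := by
      rw [hτ, div_mul_eq_mul_div, div_lt_iff₀ (by positivity)]
      nlinarith
    refine ⟨Metric.ball x₀ (r / 2), Metric.isOpen_ball, Metric.mem_ball_self (half_pos hr0),
      τ • e, τ * (r / 2), by positivity, fun x hx η hη s hs => ?_⟩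
    obtain ⟨η', rfl⟩ : ∃ η', η = τ • η' := ⟨τ⁻¹ • η, by rw [smul_inv_smul₀ hτ0.ne']⟩
    have hη' : ‖η' - e‖ < r := by
      rw [mem_closedBall_iff_norm, ← smul_sub, norm_smul, Real.norm_of_nonneg hτ0.le] at hη
      have := le_of_mul_le_mul_left hη hτ0
      linarith
    have hηn : ‖τ • η'‖ < r / 2 := by
      rw [norm_smul, Real.norm_of_nonneg hτ0.le]
      refine lt_of_le_of_lt (mul_le_mul_of_nonneg_left ?_ hτ0.le) hτK
      calc ‖η'‖ = ‖e + (η' - e)‖ := by congr 1; abel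
        _ ≤ ‖e‖ + ‖η' - e‖ := norm_add_le _ _
        _ ≤ _ := by linarith
    have hball : ∀ q ∈ Icc (0 : ℝ) 1, x + q • τ • η' ∈ Metric.ball x₀ r := by
      intro q hq
      rw [mem_ball_iff_norm]
      have h3 := mem_ball_iff_norm.mp hx.1
      calc ‖x + q • τ • η' - x₀‖ = ‖(x - x₀) + q • τ • η'‖ := by congr 1; abel
        _ ≤ ‖x - x₀‖ + ‖q • τ • η'‖ := norm_add_le _ _
        _ ≤ ‖x - x₀‖ + 1 * ‖τ • η'‖ := by
          rw [norm_smul q, Real.norm_of_nonneg hq.1]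
          gcongr
          exact hq.2
        _ < r := by linarith
    have hder : ∀ q : ℝ, HasDerivAt (fun q : ℝ => φ (x + q • τ • η'))
        (fderiv ℝ φ (x + q • τ • η') (τ • η')) q := by
      intro q
      have hl : HasDerivAt (fun q : ℝ => x + q • τ • η') (τ • η') q := by
        simpa using ((hasDerivAt_id q).smul_const (τ • η')).const_add x
      exact ((hφ.differentiable (by simp) _).hasFDerivAt).comp_hasDerivAt q hl
    have hanti : AntitoneOn (fun q : ℝ => φ (x + q • τ • η')) (Icc 0 1) := by
      refine antitoneOn_of_deriv_nonpos (convex_Icc 0 1)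
        (fun q _ => (hder q).continuousAt.continuousWithinAt)
        (fun q _ => (hder q).differentiableAt.differentiableWithinAt) fun q hq => ?_
      rw [interior_Icc] at hq
      rw [(hder q).deriv, map_smul, smul_eq_mul]
      refine (mul_neg_of_pos_of_neg hτ0 (h1 (x + q • τ • η', η') ?_)).le
      rw [Metric.mem_ball, Prod.dist_eq]
      refine max_lt ?_ ?_
      · exact (Metric.mem_ball.mp (hball q (Ioo_subset_Icc_self hq))).trans_le (min_le_left _ _)
      · rw [dist_eq_norm]
        exact hη'.trans_le (min_le_left _ _)
    have hφx : φ x < 0 := by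
      refine (h2 x ?_).mp hx.2
      refine Metric.ball_subset_ball ?_ hx.1
      exact (half_le_self hr0.le).trans (min_le_right _ _)
    rw [h2 _ (Metric.ball_subset_ball (min_le_right _ _) (hball s hs))]
    have := hanti (left_mem_Icc.mpr zero_le_one) hs hs.1
    simp only [zero_smul, add_zero] at this
    linarith

end Cone

section Average

variable {d : ℕ}

/-- The average `∫₀¹ k(s) ∫ m(η) H(x + s η) dη ds` of `H` over a truncated cone with vertex `x`. -/
noncomputable def coneAverage (k : ℝ → ℝ) (m : E d → ℝ) (H : E d → ℂ) (x : E d) : ℂ :=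
  ∫ s in Ioc (0 : ℝ) 1, k s • ∫ η, m η • H (x + s • η)

variable {k : ℝ → ℝ} {m : E d → ℝ} {H : E d → ℂ}

lemma integral_comp_add_smul {F : Type} [NormedAddCommGroup F] [NormedSpace ℝ F] (f : E d → F)
    (x : E d) {s : ℝ} (hs : 0 < s) :
    ∫ η, f (x + s • η) = (s ^ d)⁻¹ • ∫ y, f y := by
  rw [Measure.integral_comp_smul volume (fun y => f (x + y)) s,
    integral_add_left_eq_self (fun y => f y) x, finrank_euclideanSpace_fin,
    abs_of_pos (by positivity)]

lemma integrable_comp_add_smul {F : Type} [NormedAddCommGroup F] [NormedSpace ℝ F] {f : E d → F}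
    (hf : Integrable f) (x : E d) {s : ℝ} (hs : 0 < s) :
    Integrable fun η => f (x + s • η) :=
  (hf.comp_add_left x).comp_smul hs.ne'

/-- In dimension at most three the inner average is bounded by `C s^{-3/2}`, by the weighted
inequality `2 |m| |H| ≤ s^{-3/2} |m|² + s^{3/2} |H|²`. -/
lemma norm_inner_average_le (hd : d ≤ 3) (hm : Continuous m) (hmc : HasCompactSupport m)
    (hH2 : Integrable fun x => ‖H x‖ ^ 2) (x : E d) {s : ℝ} (hs : s ∈ Ioc (0 : ℝ) 1) :
    ‖∫ η, m η • H (x + s • η)‖ ≤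
      ((∫ η, m η ^ 2) + ∫ y, ‖H y‖ ^ 2) * s ^ (-(3 / 2) : ℝ) := by
  have hs0 := hs.1
  have hw : 0 < s ^ (3 / 2 : ℝ) := Real.rpow_pos_of_pos hs0 _
  have hwi : s ^ (-(3 / 2) : ℝ) = (s ^ (3 / 2 : ℝ))⁻¹ := Real.rpow_neg hs0.le _
  have hm2c : HasCompactSupport fun η => m η * m η := hmc.mul_right
  have hm2 : Integrable fun η => m η ^ 2 := by
    simp_rw [pow_two]
    exact (hm.mul hm).integrable_of_hasCompactSupport hm2c
  have hH2' := integrable_comp_add_smul hH2 x hs0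
  have hint : Integrable fun η => s ^ (-(3 / 2) : ℝ) * m η ^ 2 +
      s ^ (3 / 2 : ℝ) * ‖H (x + s • η)‖ ^ 2 := (hm2.const_mul _).add (hH2'.const_mul _)
  have hI : 0 ≤ ∫ η, m η ^ 2 := integral_nonneg fun η => sq_nonneg _
  have hJ : 0 ≤ ∫ y, ‖H y‖ ^ 2 := integral_nonneg fun η => sq_nonneg _
  have hpow : s ^ (3 / 2 : ℝ) * (s ^ d)⁻¹ ≤ s ^ (-(3 / 2) : ℝ) := by
    have h3 : (s ^ d)⁻¹ ≤ (s ^ 3)⁻¹ :=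
      inv_anti₀ (by positivity) (pow_le_pow_of_le_one hs0.le hs.2 hd)
    refine (mul_le_mul_of_nonneg_left h3 hw.le).trans_eq ?_
    rw [← Real.rpow_natCast s 3, ← Real.rpow_neg hs0.le, ← Real.rpow_add hs0]
    norm_num
  calc ‖∫ η, m η • H (x + s • η)‖ ≤ ∫ η, (s ^ (-(3 / 2) : ℝ) * m η ^ 2 +
      s ^ (3 / 2 : ℝ) * ‖H (x + s • η)‖ ^ 2) := by
        refine norm_integral_le_of_norm_le hint (Eventually.of_forall fun η => ?_)
        rw [norm_smul, Real.norm_eq_abs, hwi, ← sq_abs (m η)]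
        have h1 : 0 ≤ (s ^ (3 / 2 : ℝ))⁻¹ *
            (|m η| - s ^ (3 / 2 : ℝ) * ‖H (x + s • η)‖) ^ 2 := by positivity
        have h2 : (s ^ (3 / 2 : ℝ))⁻¹ * (|m η| - s ^ (3 / 2 : ℝ) * ‖H (x + s • η)‖) ^ 2 =
            (s ^ (3 / 2 : ℝ))⁻¹ * |m η| ^ 2 + s ^ (3 / 2 : ℝ) * ‖H (x + s • η)‖ ^ 2 -
              2 * (|m η| * ‖H (x + s • η)‖) := by
          field_simp
          ring
        have h3 : 0 ≤ |m η| * ‖H (x + s • η)‖ := by positivity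
        linarith
    _ = s ^ (-(3 / 2) : ℝ) * (∫ η, m η ^ 2) +
        (s ^ (3 / 2 : ℝ) * (s ^ d)⁻¹) * ∫ y, ‖H y‖ ^ 2 := by
        rw [integral_add (hm2.const_mul _) (hH2'.const_mul _), integral_const_mul,
          integral_const_mul, integral_comp_add_smul (fun y => ‖H y‖ ^ 2) x hs0, smul_eq_mul,
          mul_assoc]
    _ ≤ s ^ (-(3 / 2) : ℝ) * (∫ η, m η ^ 2) + s ^ (-(3 / 2) : ℝ) * ∫ y, ‖H y‖ ^ 2 := by
        gcongr
    _ = _ := by ring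

lemma continuous_inner_average (hm : Continuous m) (hmc : HasCompactSupport m)
    (hH : Integrable H) {s : ℝ} (hs : 0 < s) :
    Continuous fun x => ∫ η, m η • H (x + s • η) := by
  obtain ⟨C, hC⟩ := hm.bounded_above_of_compact_support hmc
  have e : (fun x => ∫ η, m η • H (x + s • η)) =
      fun x => (s ^ d)⁻¹ • ∫ y, m (s⁻¹ • (y - x)) • H y := by
    funext x
    rw [← integral_comp_add_smul (fun y => m (s⁻¹ • (y - x)) • H y) x hs]
    refine integral_congr_ae (Eventually.of_forall fun η => ?_)
    simp only
    rw [add_sub_cancel_left, inv_smul_smul₀ hs.ne']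
  rw [e]
  suffices h : Continuous fun x => ∫ y, m (s⁻¹ • (y - x)) • H y from
    (continuous_const_smul _).comp h
  refine continuous_of_dominated (bound := fun y => C * ‖H y‖) (fun x => ?_) (fun x => ?_)
    (hH.norm.const_mul C) (Eventually.of_forall fun y => by fun_prop)
  · exact AEStronglyMeasurable.smul (f := fun y => m (s⁻¹ • (y - x)))
      (Continuous.aestronglyMeasurable (by fun_prop)) hH.aestronglyMeasurable
  · refine Eventually.of_forall fun y => ?_
    rw [norm_smul]
    exact mul_le_mul_of_nonneg_right (hC _) (norm_nonneg _)

lemma continuous_coneAverage (hd : d ≤ 3) (hk : Continuous k) {C : ℝ}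
    (hkC : ∀ s ∈ Ioc (0 : ℝ) 1, |k s| ≤ C * s) (hm : Continuous m) (hmc : HasCompactSupport m)
    (hHm : StronglyMeasurable H) (hH : Integrable H) (hH2 : Integrable fun x => ‖H x‖ ^ 2) :
    Continuous (coneAverage k m H) := by
  set M := (∫ η, m η ^ 2) + ∫ y, ‖H y‖ ^ 2
  refine continuous_of_dominated (bound := fun s => C * M * s ^ (-(1 / 2) : ℝ))
    (fun x => ?_) (fun x => ?_) ?_ ?_
  · refine hk.aestronglyMeasurable.smul ?_
    have h1 : StronglyMeasurable fun p : ℝ × E d => m p.2 • H (x + p.1 • p.2) := by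
      refine StronglyMeasurable.smul (f := fun p : ℝ × E d => m p.2)
        (g := fun p : ℝ × E d => H (x + p.1 • p.2)) ?_ ?_
      · exact (hm.comp continuous_snd).stronglyMeasurable
      · exact hHm.comp_measurable (by fun_prop)
    exact h1.integral_prod_right.aestronglyMeasurable
  · refine ae_restrict_of_forall_mem measurableSet_Ioc fun s hs => ?_
    rw [norm_smul, Real.norm_eq_abs]
    have h1 := norm_inner_average_le hd hm hmc hH2 x hs
    calc |k s| * ‖∫ η, m η • H (x + s • η)‖ ≤ (C * s) * (M * s ^ (-(3 / 2) : ℝ)) :=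
          mul_le_mul (hkC s hs) h1 (norm_nonneg _) ((abs_nonneg _).trans (hkC s hs))
      _ = C * M * (s ^ (1 : ℝ) * s ^ (-(3 / 2) : ℝ)) := by rw [Real.rpow_one]; ring
      _ = _ := by
        rw [← Real.rpow_add hs.1]
        norm_num
  · refine Integrable.const_mul ?_ _
    have := intervalIntegral.intervalIntegrable_rpow' (a := 0) (b := 1)
      (show (-1 : ℝ) < -(1 / 2) by norm_num)
    rwa [intervalIntegrable_iff_integrableOn_Ioc_of_le zero_le_one] at this
  · exact ae_restrict_of_forall_mem measurableSet_Ioc fun s hs =>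
      (continuous_inner_average hm hmc hH hs.1).const_smul (k s)

/-- Testing a cone average: the integrations may be interchanged. -/
lemma integral_smul_coneAverage (hk : Continuous k) (hm : Continuous m)
    (hmc : HasCompactSupport m) (hHm : StronglyMeasurable H) (hH : Integrable H)
    {ψ : E d → ℝ} (hψ : Continuous ψ) (hψc : HasCompactSupport ψ) :
    Integrable (fun η => m η • ∫ s in Ioc (0 : ℝ) 1, k s • ∫ x, ψ x • H (x + s • η)) ∧
    ∫ x, ψ x • coneAverage k m H x =
      ∫ η, m η • ∫ s in Ioc (0 : ℝ) 1, k s • ∫ x, ψ x • H (x + s • η) := by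
  obtain ⟨C, hC⟩ := hψ.bounded_above_of_compact_support hψc
  set ν := (volume : Measure ℝ).restrict (Ioc 0 1)
  let Q : E d × (ℝ × E d) → ℂ := fun p => ψ p.1 • k p.2.1 • m p.2.2 • H (p.1 + p.2.1 • p.2.2)
  have hQm : StronglyMeasurable Q := by
    refine StronglyMeasurable.smul (hψ.comp continuous_fst).stronglyMeasurable ?_
    refine StronglyMeasurable.smul (f := fun p : E d × (ℝ × E d) => k p.2.1)
      (Continuous.stronglyMeasurable (by fun_prop)) ?_
    refine StronglyMeasurable.smul (f := fun p : E d × (ℝ × E d) => m p.2.2)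
      (Continuous.stronglyMeasurable (by fun_prop)) ?_
    exact hHm.comp_measurable (by fun_prop)
  have hkint : Integrable k ν :=
    (hk.continuousOn.integrableOn_compact isCompact_Icc).mono_set Ioc_subset_Icc_self
  have hmint : Integrable m := hm.integrable_of_hasCompactSupport hmc
  have hkm : Integrable (fun q : ℝ × E d => C * ‖k q.1 * m q.2‖ * ∫ y, ‖H y‖)
      (ν.prod volume) := ((hkint.mul_prod hmint).norm.const_mul C).mul_const _
  have hsec : ∀ q : ℝ × E d, ∀ x, ‖Q (x, q)‖ ≤ C * ‖k q.1 * m q.2‖ * ‖H (x + q.1 • q.2)‖ := by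
    intro q x
    simp only [Q, norm_smul, norm_mul, ← mul_assoc]
    gcongr
    exact hC x
  have hQ : Integrable Q ((volume : Measure (E d)).prod (ν.prod volume)) := by
    rw [integrable_prod_iff' hQm.aestronglyMeasurable]
    refine ⟨Eventually.of_forall fun q => ?_, ?_⟩
    · refine Integrable.mono' ((hH.comp_add_right (q.1 • q.2)).norm.const_mul
        (C * ‖k q.1 * m q.2‖)) ?_ (Eventually.of_forall (hsec q))
      exact (hQm.comp_measurable (by fun_prop)).aestronglyMeasurable
    · refine hkm.mono' ?_ (Eventually.of_forall fun q => ?_)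
      · exact hQm.norm.integral_prod_left.aestronglyMeasurable
      · rw [Real.norm_of_nonneg (integral_nonneg fun x => norm_nonneg _)]
        calc ∫ x, ‖Q (x, q)‖ ≤ ∫ x, C * ‖k q.1 * m q.2‖ * ‖H (x + q.1 • q.2)‖ :=
              integral_mono_of_nonneg (Eventually.of_forall fun x => norm_nonneg _)
                ((hH.comp_add_right (q.1 • q.2)).norm.const_mul _)
                (Eventually.of_forall (hsec q))
          _ = _ := by
              rw [integral_const_mul, integral_add_right_eq_self (fun y => ‖H y‖)]
  have e1 : ∫ x, ψ x • coneAverage k m H x = ∫ x, ∫ q, Q (x, q) ∂(ν.prod volume) := by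
    refine integral_congr_ae ?_
    filter_upwards [hQ.prod_right_ae] with x hx
    rw [integral_prod _ hx, coneAverage, ← integral_smul]
    refine integral_congr_ae (Eventually.of_forall fun s => ?_)
    simp only [Q]
    rw [integral_smul, integral_smul]
  have hQ' : Integrable (fun q => ∫ x, Q (x, q)) (ν.prod volume) := hQ.integral_prod_right
  have e2 : ∀ η, ∫ s, (∫ x, Q (x, (s, η))) ∂ν =
      m η • ∫ s in Ioc (0 : ℝ) 1, k s • ∫ x, ψ x • H (x + s • η) := by
    intro η
    rw [← integral_smul]
    refine integral_congr_ae (Eventually.of_forall fun s => ?_)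
    simp only [Q]
    rw [smul_smul, ← integral_smul]
    refine integral_congr_ae (Eventually.of_forall fun x => ?_)
    simp only [smul_smul]
    congr 1
    ring
  refine ⟨?_, ?_⟩
  · have := hQ'.integral_prod_right
    simp_rw [e2] at this
    exact this
  · rw [e1, integral_integral_swap hQ, integral_prod_symm _ hQ']
    exact integral_congr_ae (Eventually.of_forall e2)

end Average

section Representation

variable {d : ℕ} {Ω : Set (E d)}

/-- Extension by zero from `Ω` to the whole space. -/
noncomputable def zeroExt (v : L2 Ω) : E d → ℂ := Ω.indicator v

lemma stronglyMeasurable_zeroExt (hΩ : IsOpen Ω) (v : L2 Ω) : StronglyMeasurable (zeroExt v) :=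
  (Lp.stronglyMeasurable v).indicator hΩ.measurableSet

lemma integrable_zeroExt (hΩ : IsOpen Ω) (hbd : Bornology.IsBounded Ω) (v : L2 Ω) :
    Integrable (zeroExt v) :=
  (integrable_indicator_iff hΩ.measurableSet).mpr (integrable_L2 hbd v)

lemma integrable_norm_sq_zeroExt (hΩ : IsOpen Ω) (v : L2 Ω) :
    Integrable fun x => ‖zeroExt v x‖ ^ 2 := by
  have e : (fun x => ‖zeroExt v x‖ ^ 2) = Ω.indicator fun x => ‖v x‖ ^ 2 := by
    funext x
    by_cases hx : x ∈ Ω <;> simp [zeroExt, hx]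
  rw [e]
  exact (integrable_indicator_iff hΩ.measurableSet).mpr (norm_sq_eq_integral v).1

lemma integral_smul_zeroExt (hΩ : IsOpen Ω) (v : L2 Ω) (ψ : E d → ℝ) :
    ∫ x, ψ x • zeroExt v x = ∫ x in Ω, ψ x • v x := by
  rw [← integral_indicator hΩ.measurableSet]
  refine integral_congr_ae (Eventually.of_forall fun x => ?_)
  by_cases hx : x ∈ Ω <;> simp [zeroExt, hx]

lemma fderiv_eq_sum_partialDeriv {F : Type} [NormedAddCommGroup F] [NormedSpace ℝ F]
    (ψ : E d → F) (x η : E d) : fderiv ℝ ψ x η = ∑ j, η j • partialDeriv j ψ x := by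
  conv_lhs => rw [← (EuclideanSpace.basisFun (Fin d) ℝ).sum_repr η]
  simp [map_sum, partialDeriv]

lemma IsTestFunction.comp_sub {ψ : E d → ℝ} {V : Set (E d)} (hψ : IsTestFunction V ψ) {η : E d}
    (h : ∀ x ∈ V, x + η ∈ Ω) : IsTestFunction Ω fun x => ψ (x - η) := by
  have hts : tsupport (fun x => ψ (x - η)) = (fun x => x - η) ⁻¹' tsupport ψ :=
    (tsupport_comp_eq_preimage ψ (Homeomorph.subRight η))
  refine ⟨hψ.smooth.comp (by fun_prop), ?_, ?_⟩
  · exact hψ.compactSupport.comp_homeomorph (Homeomorph.subRight η)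
  · intro x hx
    rw [hts] at hx
    simpa using h _ (hψ.support_subset hx)

lemma partialDeriv_comp_sub (ψ : E d → ℝ) (η : E d) (j : Fin d) (x : E d) :
    partialDeriv j (fun x => ψ (x - η)) x = partialDeriv j ψ (x - η) := by
  rw [partialDeriv, fderiv_comp_sub]
  rfl

/-- Differentiating `∫ ψ(y - s η) H(y) dy` in `s`. -/
lemma hasDerivAt_integral_translate {V : Set (E d)} {ψ : E d → ℝ} (hψ : IsTestFunction V ψ)
    {H : E d → ℂ} (hH : Integrable H) (η : E d) (s : ℝ) :
    HasDerivAt (fun s : ℝ => ∫ y, ψ (y - s • η) • H y)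
      (∫ y, -(fderiv ℝ ψ (y - s • η) η) • H y) s := by
  obtain ⟨C, hC⟩ := hψ.smooth.continuous.bounded_above_of_compact_support hψ.compactSupport
  obtain ⟨C', hC'⟩ := (hψ.smooth.continuous_fderiv (by simp)).bounded_above_of_compact_support
    (hψ.compactSupport.fderiv ℝ)
  have hder : ∀ (y : E d) (s : ℝ), HasDerivAt (fun s : ℝ => ψ (y - s • η) • H y)
      (-(fderiv ℝ ψ (y - s • η) η) • H y) s := by
    intro y s
    have hl : HasDerivAt (fun s : ℝ => y - s • η) (-η) s := by
      simpa using ((hasDerivAt_id s).smul_const η).const_sub y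
    have := ((hψ.smooth.differentiable (by simp) _).hasFDerivAt.comp_hasDerivAt s hl).smul_const
      (H y)
    rwa [map_neg] at this
  have hmeas : ∀ s : ℝ, AEStronglyMeasurable (fun y => ψ (y - s • η) • H y) volume := fun s =>
    AEStronglyMeasurable.smul (f := fun y => ψ (y - s • η))
      (hψ.smooth.continuous.comp (by fun_prop)).aestronglyMeasurable hH.aestronglyMeasurable
  refine (hasDerivAt_integral_of_dominated_loc_of_deriv_le (F := fun s y => ψ (y - s • η) • H y)
    (F' := fun s y => -(fderiv ℝ ψ (y - s • η) η) • H y)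
    (bound := fun y => C' * ‖η‖ * ‖H y‖) univ_mem (Eventually.of_forall hmeas) ?_ ?_ ?_
    (hH.norm.const_mul _) (Eventually.of_forall fun y s _ => hder y s)).2
  · refine (hH.norm.const_mul C).mono' (hmeas s) (Eventually.of_forall fun y => ?_)
    rw [norm_smul]
    exact mul_le_mul_of_nonneg_right (hC _) (norm_nonneg _)
  · refine AEStronglyMeasurable.smul (f := fun y => -(fderiv ℝ ψ (y - s • η) η))
      (Continuous.aestronglyMeasurable ?_) hH.aestronglyMeasurable
    exact (((hψ.smooth.continuous_fderiv (by simp)).comp (by fun_prop)).clm_apply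
      continuous_const).neg
  · refine Eventually.of_forall fun y s _ => ?_
    rw [norm_smul, norm_neg]
    refine mul_le_mul_of_nonneg_right ?_ (norm_nonneg _)
    exact ((fderiv ℝ ψ (y - s • η)).le_opNorm η).trans
      (mul_le_mul_of_nonneg_right (hC' _) (norm_nonneg _))

lemma integral_smul_comp_add {ψ : E d → ℝ} {H : E d → ℂ} (η : E d) :
    ∫ x, ψ x • H (x + η) = ∫ y, ψ (y - η) • H y := by
  rw [← integral_add_right_eq_self (fun y => ψ (y - η) • H y) η]
  simp

lemma continuous_integral_translate {V : Set (E d)} {ψ : E d → ℝ} (hψ : IsTestFunction V ψ)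
    {H : E d → ℂ} (hH : Integrable H) (η : E d) :
    Continuous fun s : ℝ => ∫ x, ψ x • H (x + s • η) := by
  simp_rw [integral_smul_comp_add]
  exact continuous_iff_continuousAt.mpr fun s =>
    (hasDerivAt_integral_translate hψ hH η s).continuousAt

/-- If the translates of the test function `ψ` stay in `Ω`, the derivative of
`∫ ψ(x) v(x + s η) dx` is given by the weak derivatives of `v`. -/
lemma hasDerivAt_integral_weak (hΩ : IsOpen Ω) (hbd : Bornology.IsBounded Ω) {V : Set (E d)}
    {ψ : E d → ℝ} (hψ : IsTestFunction V ψ) {v : L2 Ω} {g : Fin d → L2 Ω}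
    (hg : ∀ j, IsWeakDeriv Ω j v (g j)) (η : E d) {s : ℝ} (hs : ∀ x ∈ V, x + s • η ∈ Ω) :
    HasDerivAt (fun s : ℝ => ∫ x, ψ x • zeroExt v (x + s • η))
      (∑ j, η j • ∫ x, ψ x • zeroExt (g j) (x + s • η)) s := by
  simp_rw [integral_smul_comp_add]
  convert hasDerivAt_integral_translate hψ (integrable_zeroExt hΩ hbd v) η s using 1
  have hint : ∀ j, Integrable fun y =>
      -(η j • (partialDeriv j ψ (y - s • η) • zeroExt v y)) := by
    intro j
    obtain ⟨C, hC⟩ := (hψ.partialDeriv j).smooth.continuous.bounded_above_of_compact_support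
      (hψ.partialDeriv j).compactSupport
    refine (Integrable.smul (η j) ?_).neg
    refine (integrable_zeroExt hΩ hbd v).bdd_smul C ?_ (Eventually.of_forall fun y => hC _)
    exact ((hψ.partialDeriv j).smooth.continuous.comp (by fun_prop)).aestronglyMeasurable
  have e : ∀ y, -(fderiv ℝ ψ (y - s • η) η) • zeroExt v y =
      ∑ j, -(η j • (partialDeriv j ψ (y - s • η) • zeroExt v y)) := by
    intro y
    rw [fderiv_eq_sum_partialDeriv, neg_smul, Finset.sum_smul, Finset.sum_neg_distrib]
    simp_rw [smul_eq_mul, mul_smul]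
  simp_rw [e]
  rw [integral_finsetSum _ fun j _ => hint j]
  refine Finset.sum_congr rfl fun j _ => ?_
  rw [integral_neg, integral_smul]
  have h1 := hg j _ (hψ.comp_sub hs)
  simp_rw [partialDeriv_comp_sub] at h1
  rw [integral_smul_zeroExt hΩ v fun y => partialDeriv j ψ (y - s • η), h1,
    integral_smul_zeroExt hΩ (g j) fun y => ψ (y - s • η), smul_neg, neg_neg]

/-- Taylor's formula on a segment, in the form
`f(0) = ∫₀¹ s ((1 - s)² f(s))'' ds`, for `f(s) = ∫ ψ(x) v(x + s η) dx`. -/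
lemma integral_eq_segment (hΩ : IsOpen Ω) (hbd : Bornology.IsBounded Ω) {V : Set (E d)}
    {ψ : E d → ℝ} (hψ : IsTestFunction V ψ) {v : L2 Ω} {g : Fin d → L2 Ω}
    {h : Fin d → Fin d → L2 Ω} (hg : ∀ j, IsWeakDeriv Ω j v (g j))
    (hh : ∀ i j, IsWeakDeriv Ω i (g j) (h i j)) (η : E d)
    (hV : ∀ s ∈ Icc (0 : ℝ) 1, ∀ x ∈ V, x + s • η ∈ Ω) :
    ∫ x, ψ x • zeroExt v x =
      (∫ s in Ioc (0 : ℝ) 1, (2 * s) • ∫ x, ψ x • zeroExt v (x + s • η)) +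
      (∑ j, η j • ∫ s in Ioc (0 : ℝ) 1, (-4 * s * (1 - s)) •
        ∫ x, ψ x • zeroExt (g j) (x + s • η)) +
      ∑ j, ∑ i, (η j * η i) • ∫ s in Ioc (0 : ℝ) 1, (s * (1 - s) ^ 2) •
        ∫ x, ψ x • zeroExt (h i j) (x + s • η) := by
  set f : ℝ → ℂ := fun s => ∫ x, ψ x • zeroExt v (x + s • η) with hf
  set f₁ : Fin d → ℝ → ℂ := fun j s => ∫ x, ψ x • zeroExt (g j) (x + s • η) with hf₁
  set f₂ : Fin d → Fin d → ℝ → ℂ := fun i j s => ∫ x, ψ x • zeroExt (h i j) (x + s • η) with hf₂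
  have hc : Continuous f := continuous_integral_translate hψ (integrable_zeroExt hΩ hbd v) η
  have hc₁ : ∀ j, Continuous (f₁ j) := fun j =>
    continuous_integral_translate hψ (integrable_zeroExt hΩ hbd (g j)) η
  have hc₂ : ∀ i j, Continuous (f₂ i j) := fun i j =>
    continuous_integral_translate hψ (integrable_zeroExt hΩ hbd (h i j)) η
  have hd : ∀ s ∈ Icc (0 : ℝ) 1, HasDerivAt f (∑ j, η j • f₁ j s) s := fun s hs =>
    hasDerivAt_integral_weak hΩ hbd hψ hg η (hV s hs)
  have hd₁ : ∀ j, ∀ s ∈ Icc (0 : ℝ) 1, HasDerivAt (f₁ j) (∑ i, η i • f₂ i j s) s := fun j s hs =>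
    hasDerivAt_integral_weak hΩ hbd hψ (fun i => hh i j) η (hV s hs)
  have hd₂ : ∀ s ∈ Icc (0 : ℝ) 1, HasDerivAt (fun s => ∑ j, η j • f₁ j s)
      (∑ j, η j • ∑ i, η i • f₂ i j s) s := fun s hs =>
    HasDerivAt.fun_sum fun j _ => (hd₁ j s hs).const_smul (η j)
  -- an antiderivative of `s ((1 - s)² f(s))''`
  let F : ℝ → ℂ := fun s => (-2 * s * (1 - s) - (1 - s) ^ 2) • f s +
    (s * (1 - s) ^ 2) • ∑ j, η j • f₁ j s
  let F' : ℝ → ℂ := fun s => (2 * s) • f s + (-4 * s * (1 - s)) • (∑ j, η j • f₁ j s) +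
    (s * (1 - s) ^ 2) • ∑ j, η j • ∑ i, η i • f₂ i j s
  have hF : ∀ s ∈ uIcc (0 : ℝ) 1, HasDerivAt F (F' s) s := by
    intro s hs
    rw [uIcc_of_le zero_le_one] at hs
    have p1 : HasDerivAt (fun s : ℝ => -2 * s * (1 - s) - (1 - s) ^ 2) (2 * s) s := by
      have h1 : HasDerivAt (fun s : ℝ => 1 - s) (-1) s := (hasDerivAt_id s).const_sub 1
      refine (((hasDerivAt_id' s).const_mul (-2 : ℝ)).fun_mul h1 |>.fun_sub
        (h1.fun_pow 2)).congr_deriv ?_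
      push_cast
      ring
    have p2 : HasDerivAt (fun s : ℝ => s * (1 - s) ^ 2)
        ((1 - s) ^ 2 - 2 * s * (1 - s)) s := by
      have h1 : HasDerivAt (fun s : ℝ => 1 - s) (-1) s := (hasDerivAt_id s).const_sub 1
      refine ((hasDerivAt_id' s).fun_mul (h1.fun_pow 2)).congr_deriv ?_
      push_cast
      ring
    refine ((p1.fun_smul (hd s hs)).fun_add (p2.fun_smul (hd₂ s hs))).congr_deriv ?_
    simp only [F']
    module
  have hcF' : Continuous F' := by
    simp only [F']
    fun_prop
  have hFTC := intervalIntegral.integral_eq_sub_of_hasDerivAt hF (hcF'.intervalIntegrable 0 1)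
  have h0 : F 1 - F 0 = ∫ x, ψ x • zeroExt v x := by
    simp [F, hf]
  have hi : ∀ {k : ℝ → ℂ}, Continuous k → IntegrableOn k (Ioc (0 : ℝ) 1) := fun hk =>
    (hk.continuousOn.integrableOn_compact isCompact_Icc).mono_set Ioc_subset_Icc_self
  have e : ∀ s, F' s = (2 * s) • f s + (∑ j, η j • ((-4 * s * (1 - s)) • f₁ j s)) +
      ∑ j, ∑ i, (η j * η i) • ((s * (1 - s) ^ 2) • f₂ i j s) := by
    intro s
    simp only [F', Finset.smul_sum, smul_smul]
    congr 1
    · congr 1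
      exact Finset.sum_congr rfl fun j _ => by rw [mul_comm]
    · exact Finset.sum_congr rfl fun j _ => Finset.sum_congr rfl fun i _ => by
        congr 1
        ring
  rw [← h0, ← hFTC, intervalIntegral.integral_of_le zero_le_one]
  simp_rw [e]
  rw [integral_add (hi (by fun_prop)) (hi (by fun_prop)),
    integral_add (hi (by fun_prop)) (hi (by fun_prop)),
    integral_finsetSum _ fun j _ => hi (by fun_prop),
    integral_finsetSum _ fun j _ => hi (by fun_prop)]
  congr 1
  · congr 1
    exact Finset.sum_congr rfl fun j _ => integral_smul _ _
  · refine Finset.sum_congr rfl fun j _ => ?_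
    rw [integral_finsetSum _ fun i _ => hi (by fun_prop)]
    exact Finset.sum_congr rfl fun i _ => integral_smul _ _

end Representation

section Sobolev

variable {d : ℕ} {Ω : Set (E d)}

/-- Near each point of the closure, a function in `H²(Ω)` agrees with a continuous function: the
average of the Taylor formula over the directions of the cone. -/
lemma MemH2.exists_local_rep (hd3 : d ≤ 3) (hΩ : IsSmoothBoundedDomain Ω) {v : L2 Ω}
    (hv : MemH2 Ω v) {x₀ : E d} (hx₀ : x₀ ∈ closure Ω) :
    ∃ U : Set (E d), IsOpen U ∧ x₀ ∈ U ∧ ∃ w : E d → ℂ, Continuous w ∧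
      v =ᵐ[volume.restrict (U ∩ Ω)] w := by
  obtain ⟨U, hU, hxU, e₀, ρ, hρ, hcone⟩ := exists_cone hΩ hx₀
  obtain ⟨g, h, hg, hh⟩ := hv
  have hΩo := hΩ.isOpen
  have hbd := hΩ.isBounded
  let B : ContDiffBump e₀ := ⟨ρ / 2, ρ, half_pos hρ, half_lt_self hρ⟩
  let χ : E d → ℝ := B.normed volume
  have hχ : Continuous χ := B.continuous_normed
  have hχc : HasCompactSupport χ := B.hasCompactSupport_normed
  have hχ1 : ∫ η, χ η = 1 := B.integral_normed
  have hχ0 : ∀ η, η ∉ Metric.closedBall e₀ ρ → χ η = 0 := fun η hη => by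
    refine image_eq_zero_of_notMem_tsupport fun h => hη ?_
    rwa [B.tsupport_normed_eq] at h
  have hχj : ∀ j, Continuous fun η : E d => χ η * η j := fun j => by fun_prop
  have hχij : ∀ i j, Continuous fun η : E d => χ η * (η j * η i) := fun i j => by fun_prop
  have hχjc : ∀ j, HasCompactSupport fun η : E d => χ η * η j := fun j => hχc.mul_right
  have hχijc : ∀ i j, HasCompactSupport fun η : E d => χ η * (η j * η i) := fun i j =>
    hχc.mul_right
  have hk0 : Continuous fun s : ℝ => 2 * s := by fun_prop
  have hk1 : Continuous fun s : ℝ => -4 * s * (1 - s) := by fun_prop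
  have hk2 : Continuous fun s : ℝ => s * (1 - s) ^ 2 := by fun_prop
  have hHm := fun u : L2 Ω => stronglyMeasurable_zeroExt hΩo u
  have hH := fun u : L2 Ω => integrable_zeroExt hΩo hbd u
  have hH2 := fun u : L2 Ω => integrable_norm_sq_zeroExt hΩo u
  let w₀ := coneAverage (fun s => 2 * s) χ (zeroExt v)
  let w₁ := fun j => coneAverage (fun s => -4 * s * (1 - s)) (fun η => χ η * η j) (zeroExt (g j))
  let w₂ := fun i j => coneAverage (fun s => s * (1 - s) ^ 2) (fun η => χ η * (η j * η i))
    (zeroExt (h i j))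
  have hw₀ : Continuous w₀ := continuous_coneAverage hd3 hk0 (C := 2)
    (fun s hs => by rw [abs_of_nonneg (by linarith [hs.1])]) hχ hχc (hHm v) (hH v) (hH2 v)
  have hw₁ : ∀ j, Continuous (w₁ j) := fun j => continuous_coneAverage hd3 hk1 (C := 4)
    (fun s hs => by
      have h1 := hs.1
      have h2 := hs.2
      rw [abs_le]
      constructor <;> nlinarith [mul_nonneg h1.le (sub_nonneg.mpr h2)])
    (hχj j) (hχjc j) (hHm _) (hH _) (hH2 _)
  have hw₂ : ∀ i j, Continuous (w₂ i j) := fun i j => continuous_coneAverage hd3 hk2 (C := 1)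
    (fun s hs => by
      have h1 := hs.1
      have h2 := hs.2
      rw [abs_of_nonneg (by positivity), one_mul]
      refine mul_le_of_le_one_right h1.le ?_
      nlinarith)
    (hχij i j) (hχijc i j) (hHm _) (hH _) (hH2 _)
  let w : E d → ℂ := fun x => w₀ x + ∑ j, w₁ j x + ∑ j, ∑ i, w₂ i j x
  have hw : Continuous w := by
    simp only [w]
    fun_prop
  refine ⟨U, hU, hxU, w, hw, ?_⟩
  have hVo : IsOpen (U ∩ Ω) := hU.inter hΩo
  have hVbd : Bornology.IsBounded (U ∩ Ω) := hbd.subset inter_subset_right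
  have hvi : IntegrableOn v (U ∩ Ω) := by
    have : IntegrableOn v Ω := integrable_L2 hbd v
    exact this.mono_set inter_subset_right
  have hwi : IntegrableOn w (U ∩ Ω) :=
    (hw.continuousOn.integrableOn_compact hVbd.isCompact_closure).mono_set subset_closure
  have hzero : (fun x => v x - w x) =ᵐ[volume.restrict (U ∩ Ω)] 0 := by
    refine ae_eq_zero_of_forall_test hVo (hvi.sub hwi) fun ψ hψ => ?_
    have hψc := hψ.smooth.continuous
    have hψs := hψ.compactSupport
    have hsm : ∀ {f : E d → ℂ}, Continuous f → Integrable fun x => ψ x • f x := fun hf =>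
      (hψc.smul hf).integrable_of_hasCompactSupport hψs.smul_right
    have e1 : ∫ x in U ∩ Ω, ψ x • (v x - w x) =
        (∫ x, ψ x • zeroExt v x) - ∫ x, ψ x • w x := by
      have hz : Integrable fun x => ψ x • zeroExt v x := by
        obtain ⟨C, hC⟩ := hψc.bounded_above_of_compact_support hψs
        exact (hH v).bdd_smul C hψc.aestronglyMeasurable (Eventually.of_forall hC)
      have e0 : ∫ x in U ∩ Ω, ψ x • (v x - w x) =
          ∫ x in U ∩ Ω, (ψ x • zeroExt v x - ψ x • w x) :=
        setIntegral_congr_fun hVo.measurableSet fun x hx => by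
          simp only [zeroExt, indicator_of_mem hx.2, smul_sub]
      rw [← integral_sub hz (hsm hw), e0]
      refine setIntegral_eq_integral_of_forall_compl_eq_zero fun x hx => ?_
      rw [hψ.eq_zero_of_notMem hx, zero_smul, zero_smul, sub_zero]
    have t₀ := integral_smul_coneAverage hk0 hχ hχc (hHm v) (hH v) hψc hψs
    have t₁ := fun j => integral_smul_coneAverage hk1 (hχj j) (hχjc j) (hHm (g j)) (hH (g j))
      hψc hψs
    have t₂ := fun i j => integral_smul_coneAverage hk2 (hχij i j) (hχijc i j) (hHm (h i j))
      (hH (h i j)) hψc hψs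
    have e2 : ∫ x, ψ x • w x = ∫ x, ψ x • zeroExt v x := by
      have e3 : ∫ x, ψ x • w x = (∫ x, ψ x • w₀ x) + (∑ j, ∫ x, ψ x • w₁ j x) +
          ∑ j, ∑ i, ∫ x, ψ x • w₂ i j x := by
        simp only [w, smul_add, Finset.smul_sum]
        rw [integral_add, integral_add, integral_finsetSum, integral_finsetSum]
        · congr 1
          refine Finset.sum_congr rfl fun j _ => ?_
          rw [integral_finsetSum]
          exact fun i _ => hsm (hw₂ i j)
        · exact fun j _ => integrable_finsetSum _ fun i _ => hsm (hw₂ i j)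
        · exact fun j _ => hsm (hw₁ j)
        · exact hsm hw₀
        · exact integrable_finsetSum _ fun j _ => hsm (hw₁ j)
        · exact (hsm hw₀).add (integrable_finsetSum _ fun j _ => hsm (hw₁ j))
        · exact integrable_finsetSum _ fun j _ => integrable_finsetSum _ fun i _ => hsm (hw₂ i j)
      rw [e3]
      simp only [w₀, w₁, w₂]
      rw [t₀.2, Finset.sum_congr rfl fun j _ => (t₁ j).2,
        Finset.sum_congr rfl fun j _ => Finset.sum_congr rfl fun i _ => (t₂ i j).2,
        ← integral_finsetSum _ fun j _ => (t₁ j).1,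
        ← integral_add t₀.1 (integrable_finsetSum _ fun j _ => (t₁ j).1),
        Finset.sum_congr rfl fun j _ => (integral_finsetSum _ fun i _ => (t₂ i j).1).symm,
        ← integral_finsetSum _ fun j _ => integrable_finsetSum _ fun i _ => (t₂ i j).1,
        ← integral_add (t₀.1.fun_add (integrable_finsetSum _ fun j _ => (t₁ j).1))
          (integrable_finsetSum _ fun j _ => integrable_finsetSum _ fun i _ => (t₂ i j).1)]
      have e4 : ∫ η, χ η • ∫ x, ψ x • zeroExt v x = ∫ x, ψ x • zeroExt v x := by
        rw [integral_smul_const, hχ1, one_smul]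
      rw [← e4]
      refine integral_congr_ae (Eventually.of_forall fun η => ?_)
      simp only
      by_cases hη : η ∈ Metric.closedBall e₀ ρ
      · rw [integral_eq_segment hΩo hbd hψ hg hh η fun s hs x hx => hcone x hx η hη s hs]
        simp only [smul_add, Finset.smul_sum, smul_smul, mul_assoc]
      · simp [hχ0 η hη]
    rw [e1, e2, sub_self]
  filter_upwards [hzero] with x hx
  exact sub_eq_zero.mp hx

/-- Two continuous functions that represent `v` near a point agree there up to the boundary. -/
lemma eqOn_of_local_rep (hΩ : IsOpen Ω) {v : L2 Ω} {U₁ U₂ : Set (E d)} (hU₁ : IsOpen U₁)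
    (hU₂ : IsOpen U₂) {w₁ w₂ : E d → ℂ} (hw₁ : Continuous w₁) (hw₂ : Continuous w₂)
    (h₁ : v =ᵐ[volume.restrict (U₁ ∩ Ω)] w₁) (h₂ : v =ᵐ[volume.restrict (U₂ ∩ Ω)] w₂) :
    EqOn w₁ w₂ (U₁ ∩ U₂ ∩ closure Ω) := by
  have hs₁ : U₁ ∩ U₂ ∩ Ω ⊆ U₁ ∩ Ω := fun x hx => ⟨hx.1.1, hx.2⟩
  have hs₂ : U₁ ∩ U₂ ∩ Ω ⊆ U₂ ∩ Ω := fun x hx => ⟨hx.1.2, hx.2⟩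
  have hae : w₁ =ᵐ[volume.restrict (U₁ ∩ U₂ ∩ Ω)] w₂ :=
    (h₁.filter_mono (ae_mono (Measure.restrict_mono hs₁ le_rfl))).symm.trans
      (h₂.filter_mono (ae_mono (Measure.restrict_mono hs₂ le_rfl)))
  have := (Measure.eqOn_open_of_ae_eq hae ((hU₁.inter hU₂).inter hΩ) hw₁.continuousOn
    hw₂.continuousOn).closure hw₁ hw₂
  exact this.mono (hU₁.inter hU₂).inter_closure

/-- **Sobolev embedding** `H²(Ω) ⊂ C(Ω̄)` in dimension at most three. -/
theorem MemH2.exists_contRep (hd3 : d ≤ 3) (hΩ : IsSmoothBoundedDomain Ω) {v : L2 Ω}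
    (hv : MemH2 Ω v) : ∃ w : E d → ℂ, IsContRep Ω v w := by
  classical
  have hloc := fun x : closure Ω => hv.exists_local_rep hd3 hΩ x.2
  choose U hU hxU g hg hae using hloc
  -- the local representatives agree on overlaps, so each may be used at its own centre
  let w : E d → ℂ := fun x => if hx : x ∈ closure Ω then g ⟨x, hx⟩ x else 0
  have hwU : ∀ x : closure Ω, EqOn w (g x) (U x ∩ closure Ω) := by
    intro x y hy
    simp only [w, dif_pos hy.2]
    exact eqOn_of_local_rep hΩ.isOpen (hU _) (hU x) (hg _) (hg x) (hae _) (hae x)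
      ⟨⟨hxU ⟨y, hy.2⟩, hy.1⟩, hy.2⟩
  refine ⟨w, ?_, ?_⟩
  · intro x hx
    have h1 : ContinuousWithinAt (g ⟨x, hx⟩) (closure Ω) x := (hg _).continuousWithinAt
    refine h1.congr_of_eventuallyEq ?_ (hwU ⟨x, hx⟩ ⟨hxU ⟨x, hx⟩, hx⟩)
    filter_upwards [mem_nhdsWithin_of_mem_nhds ((hU ⟨x, hx⟩).mem_nhds (hxU ⟨x, hx⟩)),
      self_mem_nhdsWithin] with y h2 h3
    exact hwU ⟨x, hx⟩ ⟨h2, h3⟩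
  · rw [ae_restrict_iff' hΩ.isOpen.measurableSet, ae_iff]
    refine measure_null_of_locally_null _ fun x hx => ?_
    have hxΩ : x ∈ Ω := by
      simp only [mem_ofPred_eq, Classical.not_imp] at hx
      exact hx.1
    set x' : closure Ω := ⟨x, subset_closure hxΩ⟩
    refine ⟨_, inter_mem_nhdsWithin _ ((hU x').mem_nhds (hxU x')), ?_⟩
    have h1 := hae x'
    rw [EventuallyEq, ae_restrict_iff' ((hU x').inter hΩ.isOpen).measurableSet, ae_iff] at h1
    refine measure_mono_null ?_ h1
    rintro y ⟨hy, hyU⟩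
    simp only [mem_ofPred_eq, Classical.not_imp] at hy ⊢
    refine ⟨⟨hyU, hy.1⟩, ?_⟩
    rw [← hwU x' ⟨hyU, subset_closure hy.1⟩]
    exact hy.2

end Sobolev

/-! ### The Mittag-Leffler series of a bounded operator -/

section PowerSeries

variable {X : Type} [NormedAddCommGroup X] [NormedSpace ℝ X] [CompleteSpace X]

lemma continuous_tsum_pow_smul {a : ℕ → X}
    (ha : ∀ R : ℝ, 0 ≤ R → Summable fun k => R ^ k * ‖a k‖) :
    Continuous fun x : ℝ => ∑' k, x ^ k • a k := by
  rw [continuous_iff_continuousAt]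
  intro x
  have hmem : Metric.ball (0 : ℝ) (|x| + 1) ∈ 𝓝 x :=
    Metric.isOpen_ball.mem_nhds (by rw [mem_ball_zero_iff, Real.norm_eq_abs]; linarith)
  refine ContinuousOn.continuousAt ?_ hmem
  refine continuousOn_tsum (fun k => by fun_prop) (ha (|x| + 1) (by positivity))
    fun k y hy => ?_
  rw [mem_ball_zero_iff] at hy
  rw [norm_smul, norm_pow]
  gcongr

lemma hasDerivAt_tsum_pow_smul {a : ℕ → X}
    (ha : ∀ R : ℝ, 0 ≤ R → Summable fun k : ℕ => ((k : ℝ) + 1) * R ^ k * ‖a k‖) (x : ℝ) :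
    HasDerivAt (fun x : ℝ => ∑' k : ℕ, x ^ k • a k)
      (∑' k : ℕ, x ^ k • (((k : ℝ) + 1) • a (k + 1))) x := by
  set R := |x| + 1 with hR
  have hR1 : 1 ≤ R := by linarith [abs_nonneg x]
  have hx : x ∈ Metric.ball (0 : ℝ) R := by
    rw [mem_ball_zero_iff, Real.norm_eq_abs]
    linarith
  have hbound : ∀ (k : ℕ) (y : ℝ), y ∈ Metric.ball (0 : ℝ) R →
      ‖((k : ℝ) * y ^ (k - 1)) • a k‖ ≤ ((k : ℝ) + 1) * R ^ k * ‖a k‖ := by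
    intro k y hy
    rw [mem_ball_zero_iff] at hy
    rw [norm_smul, norm_mul, norm_pow, Real.norm_natCast]
    have h1 : ‖y‖ ^ (k - 1) ≤ R ^ k :=
      (pow_le_pow_left₀ (norm_nonneg y) hy.le _).trans
        (pow_le_pow_right₀ hR1 (Nat.sub_le k 1))
    gcongr
    linarith
  have hder := hasDerivAt_tsum_of_isPreconnected (ha R (by positivity)) Metric.isOpen_ball
    (convex_ball (0 : ℝ) R).isPreconnected (g := fun k y => y ^ k • a k)
    (fun k y _ => (hasDerivAt_pow k y).smul_const (a k)) hbound (y₀ := 0)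
    (Metric.mem_ball_self (by positivity))
    (summable_of_ne_finset_zero (s := {0}) fun k hk => by
      rw [zero_pow (by simpa using hk), zero_smul]) hx
  have hsum : Summable fun k : ℕ => ((k : ℝ) * x ^ (k - 1)) • a k :=
    Summable.of_norm_bounded (ha R (by positivity)) fun k => hbound k x hx
  rw [hsum.tsum_eq_zero_add] at hder
  refine hder.congr_deriv ?_
  rw [Nat.cast_zero, zero_mul, zero_smul, zero_add]
  refine tsum_congr fun k => ?_
  rw [smul_smul, Nat.add_sub_cancel, mul_comm, Nat.cast_add, Nat.cast_one]

end PowerSeries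

section Gamma

/-- A lower bound for the Gamma function from the part of its integral over `(c, c + 1]`. -/
lemma rpow_le_exp_mul_Gamma {c y : ℝ} (hc : 0 < c) (hy : 0 ≤ y) :
    c ^ y ≤ Real.exp (c + 1) * Real.Gamma (y + 1) := by
  have hint : IntegrableOn (fun x : ℝ => Real.exp (-x) * x ^ (y + 1 - 1)) (Ioi 0) :=
    Real.GammaIntegral_convergent (by linarith)
  have h1 : Real.exp (-(c + 1)) * c ^ y ≤ Real.Gamma (y + 1) := by
    rw [Real.Gamma_eq_integral (by linarith)]
    have h2 : ∫ _x in Ioc c (c + 1), Real.exp (-(c + 1)) * c ^ y =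
        Real.exp (-(c + 1)) * c ^ y := by simp
    rw [← h2]
    have hsub : Ioc c (c + 1) ⊆ Ioi 0 := fun x hx => hc.trans hx.1
    refine (setIntegral_mono_on (integrableOn_const (by simp)) (hint.mono_set hsub)
      measurableSet_Ioc fun x hx => ?_).trans (setIntegral_mono_set hint ?_ hsub.eventuallyLE)
    · rw [add_sub_cancel_right]
      have h3 : c ^ y ≤ x ^ y := Real.rpow_le_rpow hc.le hx.1.le hy
      have h4 : Real.exp (-(c + 1)) ≤ Real.exp (-x) := Real.exp_le_exp.mpr (by linarith [hx.2])
      gcongr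
    · refine ae_restrict_of_forall_mem measurableSet_Ioi fun x hx => ?_
      have : (0 : ℝ) < x := hx
      positivity
  calc c ^ y = Real.exp (c + 1) * (Real.exp (-(c + 1)) * c ^ y) := by
        rw [← mul_assoc, ← Real.exp_add, add_neg_cancel, Real.exp_zero, one_mul]
    _ ≤ _ := mul_le_mul_of_nonneg_left h1 (Real.exp_pos _).le

lemma summable_mittagLeffler {α : ℝ} (hα : 0 < α) {x : ℝ} (hx : 0 ≤ x) :
    Summable fun k : ℕ => ((k : ℝ) + 1) * x ^ k / Real.Gamma (α * k + 1) := by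
  set c : ℝ := (4 * (x + 1)) ^ (1 / α) with hc
  have hc0 : 0 < c := by positivity
  have hck : ∀ k : ℕ, c ^ (α * k) = (4 * (x + 1)) ^ k := fun k => by
    rw [hc, ← Real.rpow_mul (by positivity), ← mul_assoc, one_div_mul_cancel hα.ne', one_mul,
      Real.rpow_natCast]
  refine Summable.of_nonneg_of_le (fun k => ?_) (fun k => ?_)
    ((summable_geometric_of_lt_one (r := 1 / 2) (by norm_num) (by norm_num)).mul_left
      (Real.exp (c + 1)))
  · have : 0 < Real.Gamma (α * k + 1) := Real.Gamma_pos_of_pos (by positivity)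
    positivity
  · have hG : 0 < Real.Gamma (α * k + 1) := Real.Gamma_pos_of_pos (by positivity)
    have h1 := rpow_le_exp_mul_Gamma hc0 (show 0 ≤ α * k by positivity)
    rw [hck] at h1
    have h2 : (k : ℝ) + 1 ≤ 2 ^ k := by exact_mod_cast Nat.lt_two_pow_self
    rw [div_le_iff₀ hG]
    calc ((k : ℝ) + 1) * x ^ k ≤ 2 ^ k * (x + 1) ^ k := by gcongr; linarith
      _ = (1 / 2) ^ k * (4 * (x + 1)) ^ k := by
        rw [← mul_pow, ← mul_pow]
        congr 1
        ring
      _ ≤ (1 / 2) ^ k * (Real.exp (c + 1) * Real.Gamma (α * k + 1)) := by gcongr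
      _ = _ := by ring

lemma integral_sub_rpow_mul_rpow {α p t : ℝ} (hα1 : α < 1) (hp : 0 < p) (ht : 0 < t) :
    ∫ s in (0 : ℝ)..t, (t - s) ^ (-α) * s ^ (p - 1) =
      t ^ (p - α) * (Real.Gamma (1 - α) * Real.Gamma p / Real.Gamma (p + (1 - α))) := by
  have hG : Real.Gamma (p + (1 - α)) ≠ 0 := (Real.Gamma_pos_of_pos (by linarith)).ne'
  have hb := Complex.Gamma_mul_Gamma_eq_betaIntegral (s := (p : ℂ)) (t := ((1 - α : ℝ) : ℂ))
    (by simpa using hp) (by rw [Complex.ofReal_re]; linarith)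
  have hs := Complex.betaIntegral_scaled (p : ℂ) ((1 - α : ℝ) : ℂ) ht
  have he : ∫ s in (0 : ℝ)..t, (s : ℂ) ^ ((p : ℂ) - 1) *
      ((t : ℂ) - s) ^ (((1 - α : ℝ) : ℂ) - 1) =
      ((∫ s in (0 : ℝ)..t, (t - s) ^ (-α) * s ^ (p - 1) : ℝ) : ℂ) := by
    rw [← intervalIntegral.integral_ofReal]
    refine intervalIntegral.integral_congr fun s hs => ?_
    rw [uIcc_of_le ht.le] at hs
    rw [Complex.ofReal_mul, Complex.ofReal_cpow (sub_nonneg.mpr hs.2), Complex.ofReal_cpow hs.1,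
      mul_comm]
    push_cast
    congr 2
    ring
  rw [he] at hs
  have hG' : (Real.Gamma (p + (1 - α)) : ℂ) ≠ 0 := by exact_mod_cast hG
  rw [← Complex.ofReal_add, Complex.Gamma_ofReal, Complex.Gamma_ofReal, Complex.Gamma_ofReal]
    at hb
  have hbeta : Complex.betaIntegral (p : ℂ) ((1 - α : ℝ) : ℂ) =
      ((Real.Gamma p * Real.Gamma (1 - α) / Real.Gamma (p + (1 - α)) : ℝ) : ℂ) := by
    push_cast at hb hG' ⊢
    rw [hb, mul_div_cancel_left₀ _ hG']
  rw [hbeta, ← Complex.ofReal_add, show (((p + (1 - α) : ℝ) : ℂ) - 1) = ((p - α : ℝ) : ℂ) by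
    push_cast; ring, ← Complex.ofReal_cpow ht.le, ← Complex.ofReal_mul] at hs
  rw [Complex.ofReal_injective hs]
  ring

lemma intervalIntegrable_sub_rpow_mul_rpow {α p t : ℝ} (hα1 : α < 1) (hp : 0 < p) (ht : 0 < t) :
    IntervalIntegrable (fun s => (t - s) ^ (-α) * s ^ (p - 1)) volume 0 t := by
  apply intervalIntegral.intervalIntegrable_of_integral_ne_zero
  rw [integral_sub_rpow_mul_rpow hα1 hp ht]
  have h1 := Real.Gamma_pos_of_pos (show 0 < 1 - α by linarith)
  have h2 := Real.Gamma_pos_of_pos hp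
  have h3 := Real.Gamma_pos_of_pos (show 0 < p + (1 - α) by linarith)
  positivity

end Gamma

section Series

variable {X : Type} [NormedAddCommGroup X] [NormedSpace ℝ X]

/-- The function `t ↦ E_α(-t^α B) u₀`, with `E_α` the Mittag-Leffler function. -/
noncomputable def mittagLeffler (α : ℝ) (B : X →L[ℝ] X) (u₀ : X) (t : ℝ) : X :=
  ∑' k : ℕ, (t ^ α) ^ k • ((Real.Gamma (α * k + 1))⁻¹ • ((-B) ^ k) u₀)

variable {α : ℝ} (B : X →L[ℝ] X) (u₀ : X)

lemma norm_pow_apply_le (k : ℕ) : ‖((-B) ^ k) u₀‖ ≤ ‖B‖ ^ k * ‖u₀‖ := by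
  induction k with
  | zero => simp
  | succ k ih =>
    rw [pow_succ', pow_succ']
    change ‖(-B) (((-B) ^ k) u₀)‖ ≤ _
    refine ((-B).le_opNorm _).trans ?_
    rw [norm_neg, mul_assoc]
    gcongr

lemma summable_mittagLeffler_coeff (hα : 0 < α) (R : ℝ) (hR : 0 ≤ R) :
    Summable fun k : ℕ => ((k : ℝ) + 1) * R ^ k *
      ‖(Real.Gamma (α * k + 1))⁻¹ • ((-B) ^ k) u₀‖ := by
  refine Summable.of_nonneg_of_le (fun k => by positivity) (fun k => ?_)
    ((summable_mittagLeffler hα (x := R * ‖B‖) (by positivity)).mul_right ‖u₀‖)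
  have hG : 0 < Real.Gamma (α * k + 1) := Real.Gamma_pos_of_pos (by positivity)
  rw [norm_smul, Real.norm_of_nonneg (inv_nonneg.mpr hG.le), mul_pow, div_eq_mul_inv]
  calc ((k : ℝ) + 1) * R ^ k * ((Real.Gamma (α * k + 1))⁻¹ * ‖((-B) ^ k) u₀‖) ≤
      ((k : ℝ) + 1) * R ^ k * ((Real.Gamma (α * k + 1))⁻¹ * (‖B‖ ^ k * ‖u₀‖)) := by
        gcongr
        exact norm_pow_apply_le B u₀ k
    _ = _ := by ring

lemma summable_mittagLeffler_coeff' (hα : 0 < α) (R : ℝ) (hR : 0 ≤ R) :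
    Summable fun k : ℕ => R ^ k * ‖(Real.Gamma (α * k + 1))⁻¹ • ((-B) ^ k) u₀‖ := by
  refine Summable.of_nonneg_of_le (fun k => by positivity) (fun k => ?_)
    (summable_mittagLeffler_coeff B u₀ hα R hR)
  rw [mul_assoc]
  refine le_mul_of_one_le_left (by positivity) ?_
  linarith [(Nat.cast_nonneg k : (0 : ℝ) ≤ k)]

lemma mittagLeffler_zero (hα : 0 < α) : mittagLeffler α B u₀ 0 = u₀ := by
  rw [mittagLeffler, tsum_eq_single 0 fun k hk => by
    rw [Real.zero_rpow hα.ne', zero_pow hk, zero_smul]]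
  simp

variable [CompleteSpace X]

lemma hasSum_mittagLeffler (hα : 0 < α) {t : ℝ} (ht : 0 ≤ t) :
    HasSum (fun k : ℕ => (t ^ α) ^ k • ((Real.Gamma (α * k + 1))⁻¹ • ((-B) ^ k) u₀))
      (mittagLeffler α B u₀ t) := by
  refine (Summable.of_norm_bounded (summable_mittagLeffler_coeff' B u₀ hα (t ^ α)
    (by positivity)) fun k => ?_).hasSum
  rw [norm_smul, norm_pow, Real.norm_of_nonneg (by positivity : (0 : ℝ) ≤ t ^ α)]

lemma continuous_mittagLeffler (hα : 0 < α) : Continuous (mittagLeffler α B u₀) :=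
  (continuous_tsum_pow_smul (summable_mittagLeffler_coeff' B u₀ hα)).comp
    (Real.continuous_rpow_const hα.le)

/-- The derivative, as a power series in `t^α` multiplied by `α t^{α-1}`. -/
lemma hasDerivAt_mittagLeffler (hα : 0 < α) {t : ℝ} (ht : 0 < t) :
    HasDerivAt (mittagLeffler α B u₀) ((α * t ^ (α - 1)) • ∑' k : ℕ, (t ^ α) ^ k •
      (((k : ℝ) + 1) • ((Real.Gamma (α * (k + 1 : ℕ) + 1))⁻¹ • ((-B) ^ (k + 1)) u₀))) t := by
  have h := (hasDerivAt_tsum_pow_smul (summable_mittagLeffler_coeff B u₀ hα) (t ^ α)).scomp t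
    (Real.hasDerivAt_rpow_const (p := α) (Or.inl ht.ne'))
  exact h

/-- The Mittag-Leffler series solves `∂_t^α u = -B u`, term by term. -/
theorem caputo_mittagLeffler (hα : 0 < α) (hα1 : α < 1) {t : ℝ} (ht : 0 < t) :
    IntervalIntegrable (fun s => (t - s) ^ (-α) • deriv (mittagLeffler α B u₀) s) volume 0 t ∧
      caputo α (mittagLeffler α B u₀) t = -B (mittagLeffler α B u₀ t) := by
  set c : ℕ → X := fun k =>
    ((k : ℝ) + 1) • ((Real.Gamma (α * (k + 1 : ℕ) + 1))⁻¹ • ((-B) ^ (k + 1)) u₀) with hc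
  have hcs : ∀ R : ℝ, 0 ≤ R → Summable fun k => R ^ k * ‖c k‖ := by
    intro R hR
    refine Summable.of_nonneg_of_le (fun k => by positivity) (fun k => ?_)
      ((summable_nat_add_iff 1).mpr (summable_mittagLeffler_coeff B u₀ hα (R + 1)
        (by positivity)))
    rw [hc, norm_smul, Real.norm_of_nonneg (by positivity), ← mul_assoc]
    have h1 : R ^ k ≤ (R + 1) ^ (k + 1) :=
      (pow_le_pow_left₀ hR (by linarith) k).trans
        (pow_le_pow_right₀ (by linarith) (Nat.le_succ k))
    rw [mul_comm (R ^ k)]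
    gcongr
    linarith
  have hderiv : ∀ s ∈ uIoc 0 t, (t - s) ^ (-α) • deriv (mittagLeffler α B u₀) s =
      (α * ((t - s) ^ (-α) * s ^ (α - 1))) • ∑' k, (s ^ α) ^ k • c k := by
    intro s hs
    rw [uIoc_of_le ht.le] at hs
    rw [(hasDerivAt_mittagLeffler B u₀ hα hs.1).deriv, smul_smul]
    congr 1
    ring
  have hbase := intervalIntegrable_sub_rpow_mul_rpow hα1 hα ht
  have hcont : Continuous fun s : ℝ => ∑' k, (s ^ α) ^ k • c k :=
    (continuous_tsum_pow_smul hcs).comp (Real.continuous_rpow_const hα.le)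
  refine ⟨?_, ?_⟩
  · refine IntervalIntegrable.congr (fun s hs => (hderiv s hs).symm) ?_
    exact (hbase.const_mul α).smul_continuousOn hcont.continuousOn
  have hsum := intervalIntegral.hasSum_integral_of_dominated_convergence (a := 0) (b := t)
    (μ := volume) (F := fun k s => (α * ((t - s) ^ (-α) * s ^ (α - 1))) • ((s ^ α) ^ k • c k))
    (f := fun s => (α * ((t - s) ^ (-α) * s ^ (α - 1))) • ∑' k, (s ^ α) ^ k • c k)
    (bound := fun k s => |α * ((t - s) ^ (-α) * s ^ (α - 1))| * ((t ^ α) ^ k * ‖c k‖))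
    (fun k => ?_) (fun k => ?_) ?_ ?_ ?_
  · have hterm : ∀ k : ℕ, ∫ s in (0 : ℝ)..t,
        (α * ((t - s) ^ (-α) * s ^ (α - 1))) • ((s ^ α) ^ k • c k) =
        Real.Gamma (1 - α) • (-B) ((t ^ α) ^ k • ((Real.Gamma (α * k + 1))⁻¹ • ((-B) ^ k) u₀)) := by
      intro k
      have h1 : ∀ s ∈ uIoc 0 t, (α * ((t - s) ^ (-α) * s ^ (α - 1))) • ((s ^ α) ^ k • c k) =
          (α * ((t - s) ^ (-α) * s ^ (α * (k + 1) - 1))) • c k := by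
        intro s hs
        rw [uIoc_of_le ht.le] at hs
        rw [smul_smul]
        congr 1
        rw [← Real.rpow_natCast, ← Real.rpow_mul hs.1.le, mul_assoc, mul_assoc,
          ← Real.rpow_add hs.1]
        congr 3
        ring
      rw [intervalIntegral.integral_congr_ae (Eventually.of_forall h1),
        intervalIntegral.integral_smul_const, intervalIntegral.integral_const_mul,
        integral_sub_rpow_mul_rpow hα1 (by positivity) ht]
      simp only [hc]
      have hpos : (0 : ℝ) < α * (k + 1) := by positivity
      have hG := Real.Gamma_add_one hpos.ne'
      have hGp := Real.Gamma_pos_of_pos hpos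
      have e1 : α * ((k : ℝ) + 1) + (1 - α) = α * k + 1 := by ring
      have e2 : α * ((k : ℝ) + 1) - α = α * k := by ring
      have e3 : ((-B) ^ (k + 1)) u₀ = (-B) (((-B) ^ k) u₀) := by
        rw [pow_succ']
        rfl
      rw [e1, e2, e3, map_smul, map_smul, ← Real.rpow_natCast, ← Real.rpow_mul ht.le,
        Nat.cast_add, Nat.cast_one, hG]
      simp only [smul_smul]
      congr 1
      have hk : ((k : ℝ) + 1) ≠ 0 := by positivity
      field_simp
    simp_rw [hterm] at hsum
    have hS := ((hasSum_mittagLeffler B u₀ hα ht.le).mapL (-B)).const_smul (Real.Gamma (1 - α))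
    have he := hsum.unique hS
    rw [caputo, intervalIntegral.integral_congr_ae (Eventually.of_forall hderiv), he,
      inv_smul_smul₀ (Real.Gamma_pos_of_pos (by linarith)).ne']
    rfl
  · exact AEStronglyMeasurable.smul (f := fun s => α * ((t - s) ^ (-α) * s ^ (α - 1)))
      (by
        rw [uIoc_of_le ht.le]
        exact (hbase.const_mul α).1.aestronglyMeasurable)
      (((((Real.continuous_rpow_const hα.le).pow k).smul continuous_const)).aestronglyMeasurable)
  · refine Eventually.of_forall fun s hs => ?_
    rw [uIoc_of_le ht.le] at hs
    have hs0 := hs.1.le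
    rw [norm_smul, norm_smul, Real.norm_eq_abs, norm_pow,
      Real.norm_of_nonneg (by positivity : (0 : ℝ) ≤ s ^ α)]
    have : s ^ α ≤ t ^ α := Real.rpow_le_rpow hs0 hs.2 hα.le
    gcongr
  · exact Eventually.of_forall fun s _ => (hcs _ (by positivity)).mul_left _
  · simp_rw [tsum_mul_left]
    exact (hbase.const_mul α).abs.mul_const _
  · refine Eventually.of_forall fun s hs => ?_
    rw [uIoc_of_le ht.le] at hs
    have hs0 := hs.1.le
    refine HasSum.const_smul _ (Summable.hasSum ?_)
    refine Summable.of_norm_bounded (hcs (s ^ α) (by positivity)) fun k => ?_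
    rw [norm_smul, norm_pow, Real.norm_of_nonneg (by positivity : (0 : ℝ) ≤ s ^ α)]

end Series

/-! ### Hankel contours -/

section Contour

/-- The majorant `e^{-c e^x + κ x}` of the functions that are integrated along horizontal rays. -/
noncomputable def rayBound (c κ x : ℝ) : ℝ := Real.exp (-c * Real.exp x) * Real.exp (κ * x)

lemma continuous_rayBound (c κ : ℝ) : Continuous (rayBound c κ) := by
  unfold rayBound
  fun_prop

lemma rayBound_nonneg (c κ x : ℝ) : 0 ≤ rayBound c κ x := by
  unfold rayBound
  positivity

lemma tendsto_rayBound {c : ℝ} (hc : 0 < c) (κ : ℝ) :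
    Tendsto (rayBound c κ) atTop (𝓝 0) := by
  refine ((tendsto_rpow_mul_exp_neg_mul_atTop_nhds_zero κ c hc).comp
    Real.tendsto_exp_atTop).congr fun x => ?_
  rw [Function.comp_apply, rayBound, ← Real.exp_mul, mul_comm x κ, mul_comm]

lemma integrableOn_rayBound {c : ℝ} (hc : 0 < c) (κ L : ℝ) :
    IntegrableOn (rayBound c κ) (Ioi L) := by
  refine integrable_of_isBigO_exp_neg one_pos (continuous_rayBound c κ).continuousOn ?_
  refine Asymptotics.IsLittleO.isBigO ?_
  rw [Asymptotics.isLittleO_iff_tendsto fun x hx => absurd hx (Real.exp_pos _).ne']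
  refine (tendsto_rayBound hc (κ + 1)).congr fun x => ?_
  rw [rayBound, rayBound, mul_div_assoc, ← Real.exp_sub]
  congr 2
  ring

variable {F : Type} [NormedAddCommGroup F]

lemma continuous_line (y : ℝ) : Continuous fun x : ℝ => (x : ℂ) + y * Complex.I := by fun_prop

lemma continuous_segment (x : ℝ) : Continuous fun y : ℝ => (x : ℂ) + y * Complex.I := by fun_prop

lemma integrableOn_ray {f : ℂ → F} {L y c κ K : ℝ} (hc : 0 < c)
    (hf : ContinuousOn (fun x : ℝ => f (x + y * Complex.I)) (Ici L))
    (hb : ∀ x : ℝ, L ≤ x → ‖f (x + y * Complex.I)‖ ≤ K * rayBound c κ x) :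
    IntegrableOn (fun x : ℝ => f (x + y * Complex.I)) (Ioi L) := by
  refine Integrable.mono' ((integrableOn_rayBound hc κ L).const_mul K)
    ((hf.mono Ioi_subset_Ici_self).aestronglyMeasurable measurableSet_Ioi) ?_
  exact ae_restrict_of_forall_mem measurableSet_Ioi fun x hx => hb x (le_of_lt hx)

/-- The integrals over the three parts of a Hankel contour converge absolutely. -/
structure HankelIntegrable (f : ℂ → F) (θ L : ℝ) : Prop where
  upper : IntegrableOn (fun x : ℝ => f (x + θ * Complex.I)) (Ioi L)
  lower : IntegrableOn (fun x : ℝ => f (x + (-θ : ℝ) * Complex.I)) (Ioi L)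
  segment : IntervalIntegrable (fun y : ℝ => f (L + y * Complex.I)) volume (-θ) θ

lemma HankelIntegrable.of_le {f : ℂ → F} {θ L c κ K : ℝ} (hc : 0 < c) (hθ : 0 ≤ θ)
    (hf : ∀ z : ℂ, L ≤ z.re → z.im ∈ Icc (-θ) θ → ContinuousAt f z)
    (hb : ∀ x : ℝ, L ≤ x → ∀ y : ℝ, |y| = θ → ‖f (x + y * Complex.I)‖ ≤ K * rayBound c κ x) :
    HankelIntegrable f θ L := by
  have hcont : ∀ y ∈ Icc (-θ) θ, ContinuousOn (fun x : ℝ => f (x + y * Complex.I)) (Ici L) := by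
    intro y hy' x hx
    exact (ContinuousAt.comp (g := f) (f := fun x : ℝ => (x : ℂ) + y * Complex.I)
      (hf (x + y * Complex.I) (by simpa using hx) (by simpa using hy'))
      (continuous_line y).continuousAt).continuousWithinAt
  refine ⟨integrableOn_ray hc (hcont θ ⟨by linarith, le_rfl⟩) fun x hx =>
    hb x hx θ (abs_of_nonneg hθ), integrableOn_ray hc (hcont (-θ) ⟨le_rfl, by linarith⟩)
    fun x hx => hb x hx (-θ) (by rw [abs_neg, abs_of_nonneg hθ]), ?_⟩
  refine ContinuousOn.intervalIntegrable fun y hy => ?_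
  rw [uIcc_of_le (by linarith)] at hy
  exact (ContinuousAt.comp (g := f) (f := fun y : ℝ => (L : ℂ) + y * Complex.I)
    (hf (L + y * Complex.I) (by simp) (by simpa using hy))
    (continuous_segment L).continuousAt).continuousWithinAt

lemma HankelIntegrable.add {f g : ℂ → F} {θ L : ℝ} (hf : HankelIntegrable f θ L)
    (hg : HankelIntegrable g θ L) : HankelIntegrable (fun z => f z + g z) θ L :=
  ⟨hf.upper.add hg.upper, hf.lower.add hg.lower, hf.segment.add hg.segment⟩

variable [NormedSpace ℂ F]

/-- The integral along the horizontal ray from `L + iy` to `+∞ + iy`. -/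
noncomputable def rayIntegral (f : ℂ → F) (L y : ℝ) : F :=
  ∫ x in Ioi L, f (x + y * Complex.I)

/-- The Hankel contour integral, in the logarithmic variable: from `+∞ - iθ` to `L - iθ`, up to
`L + iθ`, and to `+∞ + iθ`. -/
noncomputable def hankel (f : ℂ → F) (θ L : ℝ) : F :=
  rayIntegral f L θ - rayIntegral f L (-θ) +
    Complex.I • ∫ y in (-θ)..θ, f (L + y * Complex.I)

lemma hankel_congr {f g : ℂ → F} {θ L : ℝ} (hθ : 0 ≤ θ)
    (h : ∀ z : ℂ, z.im ∈ Icc (-θ) θ → f z = g z) : hankel f θ L = hankel g θ L := by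
  simp only [hankel, rayIntegral]
  congr 1
  · congr 1
    · exact integral_congr_ae (Eventually.of_forall fun x => h _ (by simp [hθ]))
    · exact integral_congr_ae (Eventually.of_forall fun x => h _ (by simp [hθ]))
  · congr 1
    refine intervalIntegral.integral_congr fun y hy => h _ ?_
    rw [uIcc_of_le (by linarith)] at hy
    simpa using hy

lemma HankelIntegrable.hankel_add {f g : ℂ → F} {θ L : ℝ} (hf : HankelIntegrable f θ L)
    (hg : HankelIntegrable g θ L) :
    hankel (fun z => f z + g z) θ L = hankel f θ L + hankel g θ L := by
  simp only [hankel, rayIntegral]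
  rw [integral_add hf.upper hg.upper, integral_add hf.lower hg.lower,
    intervalIntegral.integral_add hf.segment hg.segment, smul_add]
  abel

lemma HankelIntegrable.smul_const {f : ℂ → ℂ} {θ L : ℝ} (hf : HankelIntegrable f θ L) (v : F) :
    HankelIntegrable (fun z => f z • v) θ L :=
  ⟨Integrable.smul_const hf.upper v, Integrable.smul_const hf.lower v,
    Integrable.smul_const hf.segment.1 v, Integrable.smul_const hf.segment.2 v⟩

lemma hankel_smul_const [CompleteSpace F] (f : ℂ → ℂ) (θ L : ℝ) (v : F) :
    hankel (fun z => f z • v) θ L = hankel f θ L • v := by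
  simp only [hankel, rayIntegral]
  rw [integral_smul_const, integral_smul_const, intervalIntegral.integral_smul_const, add_smul,
    sub_smul, smul_eq_mul, mul_smul]

/-- Cauchy's theorem for the half strip between two horizontal rays. -/
lemma rayIntegral_sub_rayIntegral [CompleteSpace F] {f : ℂ → F} {L y₁ y₂ c κ K : ℝ} (hc : 0 < c)
    (hy : y₁ ≤ y₂)
    (hf : ∀ z : ℂ, L ≤ z.re → z.im ∈ Icc y₁ y₂ → DifferentiableAt ℂ f z)
    (hb : ∀ x : ℝ, L ≤ x → ∀ y ∈ Icc y₁ y₂, ‖f (x + y * Complex.I)‖ ≤ K * rayBound c κ x) :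
    rayIntegral f L y₁ - rayIntegral f L y₂ =
      Complex.I • ∫ y in y₁..y₂, f (L + y * Complex.I) := by
  have hint : ∀ y ∈ Icc y₁ y₂, IntegrableOn (fun x : ℝ => f (x + y * Complex.I)) (Ioi L) := by
    intro y hy'
    refine integrableOn_ray hc (fun x hx => ?_) fun x hx => hb x hx y hy'
    exact (ContinuousAt.comp (g := f) (f := fun x : ℝ => (x : ℂ) + y * Complex.I)
      (hf (x + y * Complex.I) (by simpa using hx) (by simpa using hy')).continuousAt
      (continuous_line y).continuousAt).continuousWithinAt
  have h1 := intervalIntegral_tendsto_integral_Ioi L (hint y₁ (left_mem_Icc.mpr hy)) tendsto_id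
  have h2 := intervalIntegral_tendsto_integral_Ioi L (hint y₂ (right_mem_Icc.mpr hy)) tendsto_id
  have h3 : Tendsto (fun N : ℝ => ∫ y in y₁..y₂, f (N + y * Complex.I)) atTop (𝓝 0) := by
    have h4 : Tendsto (fun N => K * rayBound c κ N * |y₂ - y₁|) atTop (𝓝 0) := by
      simpa using ((tendsto_rayBound hc κ).const_mul K).mul_const |y₂ - y₁|
    refine squeeze_zero_norm' ?_ h4
    filter_upwards [eventually_ge_atTop L] with N hN
    refine intervalIntegral.norm_integral_le_of_norm_le_const fun y hy' => ?_
    rw [uIoc_of_le hy] at hy'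
    exact hb N hN y (Ioc_subset_Icc_self hy')
  have h5 : Tendsto (fun N : ℝ => (∫ x in L..N, f (x + y₁ * Complex.I)) -
      (∫ x in L..N, f (x + y₂ * Complex.I)) +
      Complex.I • ∫ y in y₁..y₂, f (N + y * Complex.I)) atTop
      (𝓝 (Complex.I • ∫ y in y₁..y₂, f (L + y * Complex.I))) := by
    refine tendsto_const_nhds.congr' ?_
    filter_upwards [eventually_ge_atTop L] with N hN
    have h6 := Complex.integral_boundary_rect_eq_zero_of_differentiableOn f
      (L + y₁ * Complex.I) (N + y₂ * Complex.I) fun z hz => by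
        refine (hf z ?_ ?_).differentiableWithinAt
        · have := hz.1
          simp only [mem_preimage, Complex.add_re, Complex.ofReal_re, Complex.mul_re, Complex.I_re,
            mul_zero, Complex.ofReal_im, Complex.I_im, mul_one, sub_self, add_zero] at this
          rw [uIcc_of_le hN] at this
          exact this.1
        · have := hz.2
          simp only [mem_preimage, Complex.add_im, Complex.ofReal_im, Complex.mul_im, Complex.I_im,
            Complex.ofReal_re, Complex.I_re, mul_one, mul_zero, add_zero, zero_add] at this
          rwa [uIcc_of_le hy] at this
    simp only [Complex.add_re, Complex.ofReal_re, Complex.mul_re, Complex.I_re, mul_zero,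
      Complex.ofReal_im, Complex.I_im, mul_one, sub_self, add_zero, Complex.add_im,
      Complex.mul_im, zero_add] at h6
    exact (sub_eq_zero.mp h6).symm
  have h7 := (h1.sub h2).add (h3.const_smul Complex.I)
  rw [smul_zero, add_zero] at h7
  exact tendsto_nhds_unique h7 h5

/-- The Hankel integral does not depend on the abscissa `L` of the vertical segment. -/
lemma hankel_eq_of_le [CompleteSpace F] {f : ℂ → F} {θ L L' c κ K : ℝ} (hc : 0 < c)
    (hθ : 0 ≤ θ) (hL : L ≤ L')
    (hf : ∀ z : ℂ, L ≤ z.re → z.im ∈ Icc (-θ) θ → DifferentiableAt ℂ f z)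
    (hb : ∀ x : ℝ, L ≤ x → ‖f (x + θ * Complex.I)‖ ≤ K * rayBound c κ x ∧
      ‖f (x + (-θ : ℝ) * Complex.I)‖ ≤ K * rayBound c κ x) :
    hankel f θ L = hankel f θ L' := by
  have hcont : ∀ y ∈ Icc (-θ) θ, ContinuousOn (fun x : ℝ => f (x + y * Complex.I)) (Ici L) := by
    intro y hy' x hx
    exact (ContinuousAt.comp (g := f) (f := fun x : ℝ => (x : ℂ) + y * Complex.I)
      (hf (x + y * Complex.I) (by simpa using hx) (by simpa using hy')).continuousAt
      (continuous_line y).continuousAt).continuousWithinAt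
  have hθ1 : θ ∈ Icc (-θ) θ := ⟨by linarith, le_rfl⟩
  have hθ2 : -θ ∈ Icc (-θ) θ := ⟨le_rfl, by linarith⟩
  have hi1 := integrableOn_ray hc (hcont θ hθ1) fun x hx => (hb x hx).1
  have hi2 := integrableOn_ray hc (hcont (-θ) hθ2) fun x hx => (hb x hx).2
  have e1 := intervalIntegral.integral_interval_add_Ioi hi1 (hi1.mono_set (Ioi_subset_Ioi hL))
  have e2 := intervalIntegral.integral_interval_add_Ioi hi2 (hi2.mono_set (Ioi_subset_Ioi hL))
  have h6 := Complex.integral_boundary_rect_eq_zero_of_differentiableOn f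
      (L + (-θ : ℝ) * Complex.I) (L' + θ * Complex.I) fun z hz => by
        refine (hf z ?_ ?_).differentiableWithinAt
        · have := hz.1
          simp only [mem_preimage, Complex.add_re, Complex.ofReal_re, Complex.mul_re, Complex.I_re,
            mul_zero, Complex.ofReal_im, Complex.I_im, mul_one, sub_self, add_zero] at this
          rw [uIcc_of_le hL] at this
          exact this.1
        · have := hz.2
          simp only [mem_preimage, Complex.add_im, Complex.ofReal_im, Complex.mul_im, Complex.I_im,
            Complex.ofReal_re, Complex.I_re, mul_one, mul_zero, add_zero, zero_add] at this
          rwa [uIcc_of_le (by linarith)] at this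
  simp only [Complex.add_re, Complex.ofReal_re, Complex.mul_re, Complex.I_re, mul_zero,
      Complex.ofReal_im, Complex.I_im, mul_one, sub_self, add_zero, Complex.add_im,
      Complex.mul_im, zero_add] at h6
  rw [hankel, hankel, rayIntegral, rayIntegral, rayIntegral, rayIntegral, ← e1, ← e2]
  rw [← sub_eq_zero, ← neg_eq_zero, ← h6]
  abel

/-- The opening of a Hankel contour may be changed. -/
lemma hankel_eq_hankel [CompleteSpace F] {f : ℂ → F} {θ θ' L c κ K : ℝ} (hc : 0 < c)
    (hθ : 0 ≤ θ) (hθ' : θ ≤ θ')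
    (hf : ∀ z : ℂ, DifferentiableAt ℂ f z)
    (hb : ∀ x : ℝ, L ≤ x → ∀ y : ℝ, |y| ∈ Icc θ θ' →
      ‖f (x + y * Complex.I)‖ ≤ K * rayBound c κ x) :
    hankel f θ L = hankel f θ' L := by
  have h1 := rayIntegral_sub_rayIntegral (f := f) (L := L) (K := K) (κ := κ) hc hθ'
    (fun z _ _ => hf z) fun x hx y hy => hb x hx y (by rwa [abs_of_nonneg (hθ.trans hy.1)])
  have h2 := rayIntegral_sub_rayIntegral (f := f) (L := L) (K := K) (κ := κ) hc
    (neg_le_neg hθ') (fun z _ _ => hf z) fun x hx y hy => hb x hx y (by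
      rw [abs_of_nonpos (by linarith [hy.2])]
      exact ⟨by linarith [hy.2], by linarith [hy.1]⟩)
  have hfc : Continuous fun y : ℝ => f (L + y * Complex.I) :=
    (continuous_iff_continuousAt.mpr fun z => (hf z).continuousAt).comp (continuous_segment L)
  have hi : ∀ p q : ℝ, IntervalIntegrable (fun y : ℝ => f (L + y * Complex.I)) volume p q :=
    fun p q => hfc.intervalIntegrable p q
  have h3 := intervalIntegral.integral_add_adjacent_intervals (hi (-θ') (-θ)) (hi (-θ) θ)
  have h4 := intervalIntegral.integral_add_adjacent_intervals (hi (-θ') θ) (hi θ θ')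
  rw [hankel, hankel, ← h4, ← h3, smul_add, smul_add, ← h1, ← h2]
  abel

/-- The derivative of a function that decays along the rays has Hankel integral zero. -/
lemma hankel_deriv [CompleteSpace F] {f f' : ℂ → F} {θ L c κ K : ℝ} (hc : 0 < c)
    (hf : ∀ z : ℂ, HasDerivAt f (f' z) z) (hf' : HankelIntegrable f' θ L)
    (hb : ∀ x : ℝ, L ≤ x → ∀ y : ℝ, |y| = |θ| → ‖f (x + y * Complex.I)‖ ≤ K * rayBound c κ x) :
    hankel f' θ L = 0 := by
  have hray : ∀ y : ℝ, |y| = |θ| →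
      IntegrableOn (fun x : ℝ => f' (x + y * Complex.I)) (Ioi L) →
      rayIntegral f' L y = -f (L + y * Complex.I) := by
    intro y hy hi
    rw [← zero_sub]
    refine integral_Ioi_of_hasDerivAt_of_tendsto' (f := fun x : ℝ => f (x + y * Complex.I))
      (fun x _ => ?_) hi ?_
    · have h1 : HasDerivAt (fun x : ℝ => (x : ℂ) + y * Complex.I) 1 x :=
        (hasDerivAt_id (x : ℂ)).comp_ofReal.add_const (y * Complex.I)
      simpa [Function.comp_def] using (hf (x + y * Complex.I)).scomp x h1
    · have h4 : Tendsto (fun N => K * rayBound c κ N) atTop (𝓝 0) := by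
        simpa using (tendsto_rayBound hc κ).const_mul K
      refine squeeze_zero_norm' ?_ h4
      filter_upwards [eventually_ge_atTop L] with N hN using hb N hN y hy
  have hseg : ∫ y in (-θ)..θ, Complex.I • f' (L + y * Complex.I) =
      f (L + θ * Complex.I) - f (L + (-θ : ℝ) * Complex.I) := by
    refine intervalIntegral.integral_eq_sub_of_hasDerivAt
      (f := fun y : ℝ => f (L + y * Complex.I)) (fun y _ => ?_) (hf'.segment.smul Complex.I)
    have h1 : HasDerivAt (fun y : ℝ => (L : ℂ) + y * Complex.I) Complex.I y := by
      simpa using ((hasDerivAt_id (y : ℂ)).comp_ofReal.mul_const Complex.I).const_add (L : ℂ)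
    exact (hf (L + y * Complex.I)).scomp y h1
  rw [hankel, hray θ rfl hf'.upper, hray (-θ) (abs_neg θ) hf'.lower,
    ← intervalIntegral.integral_smul, hseg]
  abel

lemma norm_hankel_le {f : ℂ → F} {θ L c κ K D : ℝ} (hc : 0 < c) (hθ : 0 ≤ θ)
    (hb : ∀ x : ℝ, L ≤ x → ∀ y : ℝ, |y| = θ → ‖f (x + y * Complex.I)‖ ≤ K * rayBound c κ x)
    (hD : ∀ y ∈ Icc (-θ) θ, ‖f (L + y * Complex.I)‖ ≤ K * D) :
    ‖hankel f θ L‖ ≤ K * (2 * (∫ x in Ioi L, rayBound c κ x) + 2 * θ * D) := by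
  have hray : ∀ y : ℝ, |y| = θ → ‖rayIntegral f L y‖ ≤ K * ∫ x in Ioi L, rayBound c κ x := by
    intro y hy
    rw [← integral_const_mul]
    refine norm_integral_le_of_norm_le ((integrableOn_rayBound hc κ L).const_mul K) ?_
    exact ae_restrict_of_forall_mem measurableSet_Ioi fun x hx => hb x (le_of_lt hx) y hy
  have hseg : ‖Complex.I • ∫ y in (-θ)..θ, f (L + y * Complex.I)‖ ≤ K * D * |θ - -θ| := by
    rw [norm_smul, Complex.norm_I, one_mul]
    refine intervalIntegral.norm_integral_le_of_norm_le_const fun y hy => ?_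
    rw [uIoc_of_le (by linarith)] at hy
    exact hD y (Ioc_subset_Icc_self hy)
  rw [sub_neg_eq_add, abs_of_nonneg (by linarith)] at hseg
  calc ‖hankel f θ L‖ ≤ ‖rayIntegral f L θ‖ + ‖rayIntegral f L (-θ)‖ +
        ‖Complex.I • ∫ y in (-θ)..θ, f (L + y * Complex.I)‖ :=
        (norm_add_le _ _).trans (add_le_add_left (norm_sub_le _ _) _)
    _ ≤ _ := by
        linarith [hray θ (abs_of_nonneg hθ), hray (-θ) (by rw [abs_neg, abs_of_nonneg hθ])]

end Contour

section Gamma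

/-- The integrand `e^{e^ζ + s ζ}` of Hankel's formula for `1 / Γ (1 - s)`. -/
noncomputable def hankelKernel (s : ℝ) (z : ℂ) : ℂ := Complex.exp (Complex.exp z + s * z)

lemma hasDerivAt_hankelKernel (s : ℝ) (z : ℂ) :
    HasDerivAt (hankelKernel s) (hankelKernel (s + 1) z + s * hankelKernel s z) z := by
  have h := ((Complex.hasDerivAt_exp z).add ((hasDerivAt_id z).const_mul (s : ℂ))).cexp
  refine h.congr_deriv ?_
  simp only [hankelKernel, id, Pi.add_apply]
  rw [mul_one, mul_add, mul_comm _ (s : ℂ), ← Complex.exp_add]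
  congr 2
  push_cast
  ring

lemma continuous_hankelKernel (s : ℝ) : Continuous (hankelKernel s) := by
  unfold hankelKernel
  fun_prop

lemma norm_hankelKernel (s x y : ℝ) :
    ‖hankelKernel s (x + y * Complex.I)‖ = rayBound (-Real.cos y) s x := by
  rw [hankelKernel, Complex.norm_exp, rayBound, ← Real.exp_add]
  congr 1
  simp [Complex.exp_re]
  ring

lemma norm_hankelKernel_le {s x y θ : ℝ} (hθ : Real.cos y ≤ Real.cos θ) :
    ‖hankelKernel s (x + y * Complex.I)‖ ≤ rayBound (-Real.cos θ) s x := by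
  rw [norm_hankelKernel, rayBound, rayBound, neg_neg, neg_neg]
  gcongr

lemma hankelKernel_pi (s x : ℝ) (n : ℤ) (hn : n = 1 ∨ n = -1) :
    hankelKernel s (x + (n * Real.pi : ℝ) * Complex.I) =
      (rayBound 1 s x : ℂ) * Complex.exp (s * (n * Real.pi) * Complex.I) := by
  have h1 : Complex.exp (x + (n * Real.pi : ℝ) * Complex.I) = -Complex.exp x := by
    rw [Complex.exp_add]
    rcases hn with rfl | rfl
    · simp [Complex.exp_pi_mul_I]
    · simp [Complex.exp_neg, Complex.exp_pi_mul_I]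
  rw [hankelKernel, h1, rayBound]
  push_cast
  rw [← Complex.exp_add, ← Complex.exp_add]
  congr 1
  ring

lemma hankel_hankelKernel_eq (s : ℝ) {L L' : ℝ} :
    hankel (hankelKernel s) Real.pi L = hankel (hankelKernel s) Real.pi L' := by
  wlog h : L ≤ L' generalizing L L'
  · exact (this (le_of_not_ge h)).symm
  refine hankel_eq_of_le (c := 1) (κ := s) (K := 1) one_pos Real.pi_pos.le h
    (fun z _ _ => (hasDerivAt_hankelKernel s z).differentiableAt) fun x _ => ⟨?_, ?_⟩
  · rw [norm_hankelKernel, Real.cos_pi, neg_neg, one_mul]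
  · rw [norm_hankelKernel, Real.cos_neg, Real.cos_pi, neg_neg, one_mul]

lemma hankel_hankelKernel_zero (L : ℝ) :
    hankel (hankelKernel 0) Real.pi L = 2 * Real.pi * Complex.I := by
  have h1 : rayIntegral (hankelKernel 0) L Real.pi =
      rayIntegral (hankelKernel 0) L (-Real.pi) := by
    unfold rayIntegral
    refine integral_congr_ae (Eventually.of_forall fun x => ?_)
    have e1 := hankelKernel_pi 0 x 1 (Or.inl rfl)
    have e2 := hankelKernel_pi 0 x (-1) (Or.inr rfl)
    simp only [Int.cast_one, Int.cast_neg, one_mul, neg_mul, Complex.ofReal_zero, zero_mul,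
      Complex.ofReal_neg] at e1 e2 ⊢
    rw [e1, e2]
  have h2 := circleIntegral.integral_sub_inv_of_mem_ball
    (c := 0) (w := 0) (R := Real.exp L) (Metric.mem_ball_self (Real.exp_pos L))
  have h3 := Complex.circleIntegral_sub_inv_smul_of_differentiable_on_off_countable
    (R := Real.exp L) (c := 0) (w := 0) (f := Complex.exp) (s := ∅) countable_empty
    (Metric.mem_ball_self (Real.exp_pos L)) Complex.continuous_exp.continuousOn
    fun z _ => Complex.differentiable_exp z
  have h4 : ∫ y in (-Real.pi)..Real.pi, Complex.I * hankelKernel 0 (L + y * Complex.I) =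
      2 * Real.pi * Complex.I := by
    rw [Complex.exp_zero, smul_eq_mul, mul_one] at h3
    rw [← h3, circleIntegral]
    have hper : Function.Periodic
        (fun y : ℝ => Complex.I * hankelKernel 0 (L + y * Complex.I)) (2 * Real.pi) := by
      intro y
      simp only [hankelKernel]
      push_cast
      rw [add_mul, ← add_assoc, Complex.exp_periodic]
      simp
    have h5 := hper.intervalIntegral_add_eq (-Real.pi) 0
    rw [zero_add, show -Real.pi + 2 * Real.pi = Real.pi by ring] at h5
    rw [h5]
    refine intervalIntegral.integral_congr fun y _ => ?_
    have hz : circleMap 0 (Real.exp L) y = Complex.exp (L + y * Complex.I) := by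
      rw [circleMap, zero_add, Complex.exp_add, Complex.ofReal_exp]
    simp only [deriv_circleMap, hz, sub_zero, smul_eq_mul, hankelKernel, Complex.ofReal_zero,
      zero_mul, add_zero]
    rw [← mul_assoc, mul_comm (Complex.exp _ * Complex.I), ← mul_assoc,
      inv_mul_cancel₀ (Complex.exp_ne_zero _), one_mul]
  rw [hankel, h1, sub_self, zero_add, smul_eq_mul, ← intervalIntegral.integral_const_mul, h4]

lemma hankel_hankelKernel_of_mem_Ioo {s : ℝ} (hs0 : 0 < s) (hs1 : s < 1) (L : ℝ) :
    hankel (hankelKernel s) Real.pi L =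
      2 * Real.pi * Complex.I * ((Real.Gamma (1 - s))⁻¹ : ℝ) := by
  have hray : ∀ L : ℝ, hankel (hankelKernel s) Real.pi L =
      (2 * Complex.I * (Real.sin (Real.pi * s) : ℂ)) * (∫ x in Ioi L, rayBound 1 s x : ℝ) +
      Complex.I • ∫ y in (-Real.pi)..Real.pi, hankelKernel s (L + y * Complex.I) := by
    intro L
    rw [hankel]
    congr 1
    have e1 : rayIntegral (hankelKernel s) L Real.pi =
        (∫ x in Ioi L, rayBound 1 s x : ℝ) * Complex.exp (s * Real.pi * Complex.I) := by
      rw [rayIntegral, ← integral_complex_ofReal, ← integral_mul_const]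
      refine integral_congr_ae (Eventually.of_forall fun x => ?_)
      have := hankelKernel_pi s x 1 (Or.inl rfl)
      simpa using this
    have e2 : rayIntegral (hankelKernel s) L (-Real.pi) =
        (∫ x in Ioi L, rayBound 1 s x : ℝ) * Complex.exp (-(s * Real.pi) * Complex.I) := by
      rw [rayIntegral, ← integral_complex_ofReal, ← integral_mul_const]
      refine integral_congr_ae (Eventually.of_forall fun x => ?_)
      have := hankelKernel_pi s x (-1) (Or.inr rfl)
      simpa using this
    rw [e1, e2, Complex.ofReal_sin, Complex.sin]
    push_cast
    rw [show -(Real.pi * s : ℂ) = -(s * Real.pi) by ring,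
      show (Real.pi * s : ℂ) = s * Real.pi by ring]
    linear_combination (-(∫ x in Ioi L, rayBound 1 s x : ℝ) : ℂ) *
      (Complex.exp (-(s * Real.pi) * Complex.I) - Complex.exp (s * Real.pi * Complex.I)) *
      Complex.I_sq
  have hG : Tendsto (fun L : ℝ => ∫ x in Ioi L, rayBound 1 s x) atBot (𝓝 (Real.Gamma s)) := by
    have h1 := (aecover_Ioi_of_Ioi (μ := volume) (A := (0 : ℝ)) (l := atBot) (a := Real.exp)
      Real.tendsto_exp_atBot).integral_tendsto_of_countably_generated
      (Real.GammaIntegral_convergent hs0)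
    rw [← Real.Gamma_eq_integral hs0] at h1
    refine h1.congr fun L => ?_
    rw [Measure.restrict_restrict measurableSet_Ioi,
      inter_eq_left.mpr (Ioi_subset_Ioi (Real.exp_pos L).le)]
    rw [← integral_comp_exp_Ioi]
    refine integral_congr_ae (Eventually.of_forall fun x => ?_)
    simp only [smul_eq_mul, rayBound]
    rw [← Real.exp_mul, neg_one_mul, mul_left_comm, ← Real.exp_add]
    congr 2
    ring
  have hseg : Tendsto (fun L : ℝ => ∫ y in (-Real.pi)..Real.pi, hankelKernel s (L + y * Complex.I))
      atBot (𝓝 0) := by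
    have h1 : Tendsto (fun L : ℝ => Real.exp (Real.exp L) * Real.exp (s * L) *
        |Real.pi - -Real.pi|) atBot (𝓝 0) := by
      have h2 : Tendsto (fun L : ℝ => Real.exp (s * L)) atBot (𝓝 0) :=
        Real.tendsto_exp_atBot.comp (tendsto_id.const_mul_atBot hs0)
      have h3 : Tendsto (fun L : ℝ => Real.exp (Real.exp L)) atBot (𝓝 (Real.exp 0)) :=
        (Real.continuous_exp.tendsto 0).comp Real.tendsto_exp_atBot
      simpa using (h3.mul h2).mul_const |Real.pi - -Real.pi|
    refine squeeze_zero_norm (fun L => ?_) h1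
    refine intervalIntegral.norm_integral_le_of_norm_le_const fun y _ => ?_
    rw [norm_hankelKernel, rayBound, neg_neg]
    have : Real.cos y * Real.exp L ≤ Real.exp L :=
      mul_le_of_le_one_left (Real.exp_pos L).le (Real.cos_le_one y)
    gcongr
  have hlim : Tendsto (fun L' : ℝ => hankel (hankelKernel s) Real.pi L') atBot
      (𝓝 ((2 * Complex.I * (Real.sin (Real.pi * s) : ℂ)) * (Real.Gamma s : ℝ))) := by
    simp_rw [hray]
    simpa using ((Complex.continuous_ofReal.tendsto _).comp hG).const_mul
      (2 * Complex.I * (Real.sin (Real.pi * s) : ℂ)) |>.add (hseg.const_smul Complex.I)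
  have hconst : Tendsto (fun L' : ℝ => hankel (hankelKernel s) Real.pi L') atBot
      (𝓝 (hankel (hankelKernel s) Real.pi L)) :=
    tendsto_const_nhds.congr fun L' => hankel_hankelKernel_eq s
  rw [tendsto_nhds_unique hconst hlim]
  have hsin : Real.sin (Real.pi * s) ≠ 0 :=
    (Real.sin_pos_of_pos_of_lt_pi (by positivity) (by nlinarith [Real.pi_pos])).ne'
  have hrefl := Real.Gamma_mul_Gamma_one_sub s
  have hG1 : Real.Gamma (1 - s) ≠ 0 := (Real.Gamma_pos_of_pos (by linarith)).ne'
  have : Real.sin (Real.pi * s) * Real.Gamma s = Real.pi * (Real.Gamma (1 - s))⁻¹ := by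
    rw [eq_div_iff hsin] at hrefl
    nth_rewrite 2 [← hrefl]
    field_simp
  calc _ = 2 * Complex.I * ((Real.sin (Real.pi * s) * Real.Gamma s : ℝ) : ℂ) := by
        push_cast
        ring
    _ = _ := by
        rw [this]
        push_cast
        ring

lemma hankelIntegrable_hankelKernel (s : ℝ) {θ : ℝ} (hθ : 0 ≤ θ) (hcos : Real.cos θ < 0)
    (L : ℝ) : HankelIntegrable (hankelKernel s) θ L := by
  refine HankelIntegrable.of_le (c := -Real.cos θ) (κ := s) (K := 1) (by linarith) hθ
    (fun z _ _ => (continuous_hankelKernel s).continuousAt) fun x _ y hy => ?_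
  rw [one_mul, ← hy, Real.cos_abs]
  exact norm_hankelKernel_le le_rfl

lemma hankel_hankelKernel_add_one (s L : ℝ) :
    hankel (hankelKernel (s + 1)) Real.pi L = -s * hankel (hankelKernel s) Real.pi L := by
  have hi : ∀ s : ℝ, HankelIntegrable (hankelKernel s) Real.pi L := fun s =>
    hankelIntegrable_hankelKernel s Real.pi_pos.le (by simp) L
  have h1 := (hi (s + 1)).hankel_add ((hi s).smul_const (s : ℂ))
  rw [hankel_smul_const] at h1
  have h2 := hankel_deriv (f := hankelKernel s) (κ := s) (K := 1) one_pos
    (fun z => (hasDerivAt_hankelKernel s z).congr_deriv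
      (show _ = hankelKernel (s + 1) z + hankelKernel s z • (s : ℂ) by rw [smul_eq_mul, mul_comm]))
    ((hi (s + 1)).add ((hi s).smul_const (s : ℂ))) fun x _ y hy => by
      rw [norm_hankelKernel, ← Real.cos_abs, hy, Real.cos_abs, Real.cos_pi, neg_neg, one_mul]
  rw [h2, smul_eq_mul] at h1
  linear_combination -h1

/-- Hankel's formula for `1 / Γ β`, in the logarithmic variable. -/
theorem hankel_hankelKernel {β : ℝ} (hβ : 0 < β) (L : ℝ) :
    hankel (hankelKernel (1 - β)) Real.pi L =
      2 * Real.pi * Complex.I * ((Real.Gamma β)⁻¹ : ℝ) := by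
  have key : ∀ n : ℕ, ∀ β : ℝ, 0 < β → β ≤ n + 1 → hankel (hankelKernel (1 - β)) Real.pi L =
      2 * Real.pi * Complex.I * ((Real.Gamma β)⁻¹ : ℝ) := by
    intro n
    induction n with
    | zero =>
      intro β h0 h1
      rcases h1.lt_or_eq with h1 | rfl
      · rw [hankel_hankelKernel_of_mem_Ioo (by simpa using h1) (by linarith), sub_sub_cancel]
      · simp [hankel_hankelKernel_zero]
    | succ n ih =>
      intro β h0 h1
      by_cases h : β ≤ n + 1
      · exact ih β h0 h
      have hb : 0 < β - 1 := by
        have : (0 : ℝ) ≤ n := Nat.cast_nonneg n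
        linarith [not_le.mp h]
      have h2 := ih (β - 1) hb (by push_cast at h1; linarith)
      rw [show 1 - (β - 1) = (1 - β) + 1 by ring, hankel_hankelKernel_add_one] at h2
      have hG := Real.Gamma_add_one hb.ne'
      rw [sub_add_cancel] at hG
      have hGp := (Real.Gamma_pos_of_pos hb).ne'
      have hbc : ((β : ℂ) - 1) ≠ 0 := by exact_mod_cast hb.ne'
      rw [hG]
      have h3 : ((β : ℂ) - 1) * hankel (hankelKernel (1 - β)) Real.pi L =
          2 * Real.pi * Complex.I * ((Real.Gamma (β - 1))⁻¹ : ℝ) := by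
        rw [← h2]
        push_cast
        ring
      rw [mul_comm] at h3
      rw [eq_div_of_mul_eq hbc h3]
      push_cast
      field_simp
  obtain ⟨n, hn⟩ := exists_nat_ge β
  exact key n β hβ (by linarith)

lemma hankel_hankelKernel_of_cos_neg {β θ : ℝ} (hβ : 0 < β) (hθ : Real.pi / 2 < θ)
    (hθ' : θ < Real.pi) (L : ℝ) : hankel (hankelKernel (1 - β)) θ L =
      2 * Real.pi * Complex.I * ((Real.Gamma β)⁻¹ : ℝ) := by
  have hcos : Real.cos θ < 0 :=
    Real.cos_neg_of_pi_div_two_lt_of_lt hθ (by linarith [Real.pi_pos])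
  have hθ0 : 0 ≤ θ := by linarith [Real.pi_pos]
  rw [← hankel_hankelKernel hβ L]
  refine hankel_eq_hankel (c := -Real.cos θ) (κ := 1 - β) (K := 1) (by linarith) hθ0 hθ'.le
    (fun z => (hasDerivAt_hankelKernel _ z).differentiableAt) fun x _ y hy => ?_
  rw [one_mul]
  refine norm_hankelKernel_le ?_
  rw [← Real.cos_abs y]
  exact Real.cos_le_cos_of_nonneg_of_le_pi hθ0 hy.2 hy.1

end Gamma

/-! ### Asymptotics of the Mittag-Leffler function of a bounded operator -/

section Asymptotics

lemma norm_pow_mul_le {A : Type} [NormedRing A] (b V : A) (n : ℕ) :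
    ‖b ^ n * V‖ ≤ ‖b‖ ^ n * ‖V‖ := by
  induction n with
  | zero => simp
  | succ n ih =>
    rw [pow_succ', pow_succ', mul_assoc, mul_assoc]
    exact (norm_mul_le _ _).trans (by gcongr)

variable {A : Type} [NormedRing A] [NormedAlgebra ℂ A]

/-- The resolvent `(q e^{αζ} + B)⁻¹` in the logarithmic variable `ζ`. -/
noncomputable def logResolvent (α q : ℝ) (B : A) (z : ℂ) : A :=
  Ring.inverse ((q * Complex.exp (α * z)) • (1 : A) + B)

lemma exists_contour_angle {α : ℝ} (hα0 : 0 < α) (hα1 : α < 1) :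
    ∃ θ : ℝ, Real.pi / 2 < θ ∧ θ < Real.pi ∧ α * θ < Real.pi / 2 := by
  have hlt : Real.pi / 2 < min Real.pi (Real.pi / 2 / α) := by
    refine lt_min (by linarith [Real.pi_pos]) ?_
    rw [lt_div_iff₀ hα0]
    nlinarith [Real.pi_pos]
  obtain ⟨θ, h1, h2⟩ := exists_between hlt
  refine ⟨θ, h1, h2.trans_le (min_le_left _ _), ?_⟩
  have := h2.trans_le (min_le_right _ _)
  rw [lt_div_iff₀ hα0] at this
  linarith

lemma re_mul_exp_nonneg {α q θ : ℝ} (hα : 0 < α) (hq : 0 ≤ q) (hθ : α * θ < Real.pi / 2) {z : ℂ}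
    (hz : z.im ∈ Icc (-θ) θ) : 0 ≤ ((q : ℂ) * Complex.exp (α * z)).re := by
  rw [Complex.re_ofReal_mul, Complex.exp_re, Complex.im_ofReal_mul]
  have h1 : 0 ≤ Real.cos (α * z.im) := by
    refine Real.cos_nonneg_of_mem_Icc ⟨?_, ?_⟩
    · nlinarith [hz.1]
    · nlinarith [hz.2]
  positivity

lemma hankelKernel_add (s r : ℝ) (z : ℂ) :
    hankelKernel (s + r) z = hankelKernel s z * Complex.exp (r * z) := by
  rw [hankelKernel, hankelKernel, ← Complex.exp_add]
  congr 1
  push_cast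
  ring

variable {α q θ D : ℝ} {B : A}

lemma logResolvent_mul (hα : 0 < α) (hq : 0 ≤ q) (hθ : α * θ < Real.pi / 2)
    (hB : ∀ w : ℂ, 0 ≤ w.re → IsUnit (w • (1 : A) + B)) {z : ℂ} (hz : z.im ∈ Icc (-θ) θ) :
    (q * Complex.exp (α * z)) • logResolvent α q B z + B * logResolvent α q B z = 1 := by
  have h := Ring.mul_inverse_cancel _ (hB _ (re_mul_exp_nonneg hα hq hθ hz))
  rwa [add_mul, smul_mul_assoc, one_mul] at h

variable [CompleteSpace A]

lemma differentiableAt_logResolvent (hα : 0 < α) (hq : 0 ≤ q) (hθ : α * θ < Real.pi / 2)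
    (hB : ∀ w : ℂ, 0 ≤ w.re → IsUnit (w • (1 : A) + B)) {z : ℂ} (hz : z.im ∈ Icc (-θ) θ) :
    DifferentiableAt ℂ (logResolvent α q B) z := by
  have h := differentiableAt_inverse (𝕜 := ℂ) (hB _ (re_mul_exp_nonneg hα hq hθ hz))
  exact DifferentiableAt.comp (g := Ring.inverse) z h
    (f := fun z : ℂ => ((q : ℂ) * Complex.exp (α * z)) • (1 : A) + B) (by fun_prop)

lemma differentiableAt_kernel_smul (s : ℝ) (V : A) (hα : 0 < α) (hq : 0 ≤ q)
    (hθ : α * θ < Real.pi / 2) (hB : ∀ w : ℂ, 0 ≤ w.re → IsUnit (w • (1 : A) + B)) {z : ℂ}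
    (hz : z.im ∈ Icc (-θ) θ) :
    DifferentiableAt ℂ (fun z => hankelKernel s z • (V * logResolvent α q B z)) z :=
  (hasDerivAt_hankelKernel s z).differentiableAt.smul
    ((differentiableAt_logResolvent hα hq hθ hB hz).const_mul V)

/-- The Neumann series of the resolvent and Hankel's formula represent the Mittag-Leffler function
of `B` as a contour integral. -/
lemma hankel_resolvent_eq {t : ℝ} (ht : 0 < t) (hα : 0 < α) (hθ1 : Real.pi / 2 < θ)
    (hθ2 : θ < Real.pi) (hθ : α * θ < Real.pi / 2)
    (hB : ∀ w : ℂ, 0 ≤ w.re → IsUnit (w • (1 : A) + B) ∧ ‖Ring.inverse (w • (1 : A) + B)‖ ≤ D)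
    {S : A} (hS : HasSum (fun k : ℕ =>
      (((t ^ α) ^ k * (Real.Gamma (α * k + 1))⁻¹ : ℝ) : ℂ) • (-B) ^ k) S)
    {L : ℝ} (hL : t ^ α * ‖B‖ < Real.exp (α * L)) :
    hankel (fun z => hankelKernel α z •
      ((((t ^ α)⁻¹ : ℝ) : ℂ) • (1 : A) * logResolvent α (t ^ α)⁻¹ B z)) θ L =
      (2 * Real.pi * Complex.I) • S := by
  set p : ℝ := t ^ α with hp
  have hp0 : 0 < p := by positivity
  have hq : 0 ≤ p⁻¹ := by positivity
  have hθ0 : 0 ≤ θ := by linarith [Real.pi_pos]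
  have hcos : Real.cos θ < 0 :=
    Real.cos_neg_of_pi_div_two_lt_of_lt hθ1 (by linarith [Real.pi_pos])
  have hD : 0 ≤ D := (norm_nonneg _).trans (hB 0 le_rfl).2
  set J := logResolvent α p⁻¹ B with hJ
  set f : ℕ → ℂ → A := fun n z => hankelKernel (α * (1 - n)) z •
    (((p⁻¹ * p ^ n : ℝ) : ℂ) • (-B) ^ n * J z) with hf
  have hJD : ∀ z : ℂ, z.im ∈ Icc (-θ) θ → ‖J z‖ ≤ D := fun z hz =>
    (hB _ (re_mul_exp_nonneg hα hq hθ hz)).2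
  have hV : ∀ (n : ℕ) (z : ℂ), z.im ∈ Icc (-θ) θ →
      ‖((p⁻¹ * p ^ n : ℝ) : ℂ) • (-B) ^ n * J z‖ ≤ p⁻¹ * D * (p * ‖B‖) ^ n := by
    intro n z hz
    rw [smul_mul_assoc, norm_smul, Complex.norm_real, Real.norm_of_nonneg (by positivity), mul_pow]
    calc p⁻¹ * p ^ n * ‖(-B) ^ n * J z‖ ≤ p⁻¹ * p ^ n * (‖-B‖ ^ n * D) := by
          gcongr
          exact (norm_pow_mul_le _ _ n).trans (by gcongr; exact hJD z hz)
      _ = _ := by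
          rw [norm_neg]
          ring
  have hray : ∀ n : ℕ, ∀ x : ℝ, L ≤ x → ∀ y : ℝ, |y| = θ →
      ‖f n (x + y * Complex.I)‖ ≤ (p⁻¹ * D * (p * ‖B‖ / Real.exp (α * L)) ^ n) *
        rayBound (-Real.cos θ) α x := by
    intro n x hx y hy
    have hyθ : y ∈ Icc (-θ) θ := abs_le.mp hy.le
    have h1 := hV n (x + y * Complex.I) (by simpa using hyθ)
    rw [hf, norm_smul]
    have h2 : ‖hankelKernel (α * (1 - n)) (x + y * Complex.I)‖ ≤
        rayBound (-Real.cos θ) α x / Real.exp (α * L) ^ n := by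
      refine (norm_hankelKernel_le (θ := θ) (by rw [← hy, Real.cos_abs])).trans ?_
      rw [le_div_iff₀ (by positivity), rayBound, rayBound, mul_assoc, ← Real.exp_nat_mul,
        ← Real.exp_add]
      gcongr
      have : 0 ≤ (n : ℝ) * α * (x - L) := by
        have := sub_nonneg.mpr hx
        positivity
      linarith
    calc _ ≤ (rayBound (-Real.cos θ) α x / Real.exp (α * L) ^ n) *
          (p⁻¹ * D * (p * ‖B‖) ^ n) := by
          have := rayBound_nonneg (-Real.cos θ) α x
          gcongr
      _ = _ := by
          rw [div_pow]
          ring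
  have hseg : ∀ n : ℕ, ∀ y ∈ Icc (-θ) θ, ‖f n (L + y * Complex.I)‖ ≤
      (p⁻¹ * D * (p * ‖B‖ / Real.exp (α * L)) ^ n) *
        (Real.exp (Real.exp L) * Real.exp (α * L)) := by
    intro n y hy
    have h1 := hV n (L + y * Complex.I) (by simpa using hy)
    rw [hf, norm_smul]
    have h2 : ‖hankelKernel (α * (1 - n)) (L + y * Complex.I)‖ ≤
        Real.exp (Real.exp L) * Real.exp (α * L) / Real.exp (α * L) ^ n := by
      rw [le_div_iff₀ (by positivity), norm_hankelKernel, rayBound, neg_neg, mul_assoc,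
        ← Real.exp_nat_mul, ← Real.exp_add]
      have : Real.cos y * Real.exp L ≤ Real.exp L :=
        mul_le_of_le_one_left (Real.exp_pos L).le (Real.cos_le_one y)
      gcongr
      exact le_of_eq (by ring)
    calc _ ≤ (Real.exp (Real.exp L) * Real.exp (α * L) / Real.exp (α * L) ^ n) *
          (p⁻¹ * D * (p * ‖B‖) ^ n) := by gcongr
      _ = _ := by
          rw [div_pow]
          ring
  have hfi : ∀ n, HankelIntegrable (f n) θ L := fun n =>
    HankelIntegrable.of_le (c := -Real.cos θ) (by linarith) hθ0 (fun z _ hz =>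
      (differentiableAt_kernel_smul _ _ hα hq hθ (fun w hw => (hB w hw).1) hz).continuousAt)
      (hray n)
  have hstep : ∀ n : ℕ, hankel (f n) θ L = hankel (f (n + 1)) θ L +
      (2 * Real.pi * Complex.I) • (((p ^ n * (Real.Gamma (α * n + 1))⁻¹ : ℝ) : ℂ) • (-B) ^ n) := by
    intro n
    set k : ℂ → A := fun z => hankelKernel (1 - (α * n + 1)) z • (((p ^ n : ℝ) : ℂ) • (-B) ^ n)
    have hki : HankelIntegrable k θ L :=
      (hankelIntegrable_hankelKernel _ hθ0 hcos L).smul_const _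
    have h1 : hankel (f n) θ L = hankel (fun z => f (n + 1) z + k z) θ L := by
      refine hankel_congr hθ0 fun z hz => ?_
      have hres := logResolvent_mul hα hq hθ (fun w hw => (hB w hw).1) hz
      rw [← hJ] at hres
      have e1 : hankelKernel (α * (1 - n)) z =
          hankelKernel (-(α * n)) z * Complex.exp (α * z) := by
        rw [← hankelKernel_add]
        congr 1
        ring
      have e2 : α * (1 - ((n + 1 : ℕ) : ℝ)) = -(α * n) := by
        push_cast
        ring
      have e3 : p⁻¹ * p ^ (n + 1) = p ^ n := by
        rw [pow_succ']
        field_simp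
      have e4 : (-B) ^ n = (-B) ^ n * ((p⁻¹ : ℝ) * Complex.exp (α * z)) • J z +
          (-B) ^ n * (B * J z) := by rw [← mul_add, hres, mul_one]
      have e5 : (-B) ^ (n + 1) * J z = -((-B) ^ n * (B * J z)) := by
        rw [pow_succ, mul_assoc, neg_mul, mul_neg]
      simp only [hf, k]
      rw [e1, e2, e3, show (1 : ℝ) - (α * n + 1) = -(α * n) by ring, smul_mul_assoc,
        smul_mul_assoc, e5]
      nth_rewrite 3 [e4]
      rw [mul_smul_comm]
      push_cast
      module
    rw [h1, (hfi (n + 1)).hankel_add hki, hankel_smul_const,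
      hankel_hankelKernel_of_cos_neg (by positivity) hθ1 hθ2]
    rw [smul_smul, smul_smul]
    congr 2
    push_cast
    ring
  have hpartial : ∀ n : ℕ, hankel (f 0) θ L = hankel (f n) θ L + (2 * Real.pi * Complex.I) •
      ∑ k ∈ Finset.range n, (((p ^ k * (Real.Gamma (α * k + 1))⁻¹ : ℝ) : ℂ) • (-B) ^ k) := by
    intro n
    induction n with
    | zero => simp
    | succ n ih =>
      rw [ih, hstep n, Finset.sum_range_succ, smul_add]
      abel
  have hlim0 : Tendsto (fun n => hankel (f n) θ L) atTop (𝓝 0) := by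
    have hρ : Tendsto (fun n : ℕ => (p⁻¹ * D * (p * ‖B‖ / Real.exp (α * L)) ^ n) *
        (2 * (∫ x in Ioi L, rayBound (-Real.cos θ) α x) +
          2 * θ * (Real.exp (Real.exp L) * Real.exp (α * L)))) atTop (𝓝 0) := by
      have := tendsto_pow_atTop_nhds_zero_of_lt_one
        (r := p * ‖B‖ / Real.exp (α * L)) (by positivity)
        ((div_lt_one (Real.exp_pos _)).mpr hL)
      simpa using (this.const_mul (p⁻¹ * D)).mul_const _
    exact squeeze_zero_norm (fun n => norm_hankel_le (by linarith) hθ0 (hray n) (hseg n)) hρ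
  have hlim := hlim0.add (hS.tendsto_sum_nat.const_smul (2 * Real.pi * Complex.I : ℂ))
  rw [zero_add] at hlim
  have h0 : hankel (f 0) θ L = (2 * Real.pi * Complex.I) • S :=
    tendsto_nhds_unique (tendsto_const_nhds.congr hpartial) hlim
  rw [← h0, hf]
  simp

/-- The first term of the expansion of `E_α(-t^α B)` for large `t` is
`(Γ(1 - α) t^α)⁻¹ B⁻¹`, and the remainder is of order `t^{-2α}`. -/
theorem exists_norm_mittagLeffler_sub_le (hα : 0 < α) (hα1 : α < 1)
    (hB : ∀ w : ℂ, 0 ≤ w.re → IsUnit (w • (1 : A) + B) ∧ ‖Ring.inverse (w • (1 : A) + B)‖ ≤ D) :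
    ∃ C : ℝ, 0 ≤ C ∧ ∀ t : ℝ, 0 < t → ∀ S : A, HasSum (fun k : ℕ =>
      (((t ^ α) ^ k * (Real.Gamma (α * k + 1))⁻¹ : ℝ) : ℂ) • (-B) ^ k) S →
      ‖S - (((Real.Gamma (1 - α) * t ^ α)⁻¹ : ℝ) : ℂ) • Ring.inverse B‖ ≤ C / t ^ (2 * α) := by
  obtain ⟨θ, hθ1, hθ2, hθ⟩ := exists_contour_angle hα hα1
  have hθ0 : 0 ≤ θ := by linarith [Real.pi_pos]
  have hcos : Real.cos θ < 0 :=
    Real.cos_neg_of_pi_div_two_lt_of_lt hθ1 (by linarith [Real.pi_pos])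
  have hD : 0 ≤ D := (norm_nonneg _).trans (hB 0 le_rfl).2
  have hI : 0 ≤ ∫ x in Ioi (0 : ℝ), rayBound (-Real.cos θ) (2 * α) x :=
    integral_nonneg fun x => rayBound_nonneg _ _ x
  set Q : ℝ := 2 * (∫ x in Ioi (0 : ℝ), rayBound (-Real.cos θ) (2 * α) x) +
    2 * θ * Real.exp 1 with hQ
  refine ⟨(2 * Real.pi)⁻¹ * (D * D * Q), by positivity, fun t ht S hS => ?_⟩
  set p : ℝ := t ^ α with hp
  have hp0 : 0 < p := by positivity
  have hq : 0 ≤ p⁻¹ := by positivity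
  obtain ⟨L, hL0, hL⟩ : ∃ L : ℝ, 0 ≤ L ∧ p * ‖B‖ < Real.exp (α * L) := by
    have h := (Real.tendsto_exp_atTop.comp (tendsto_id.const_mul_atTop hα)).eventually_gt_atTop
      (p * ‖B‖)
    obtain ⟨L, h1, h2⟩ := (h.and (eventually_ge_atTop 0)).exists
    exact ⟨L, h2, h1⟩
  have hmain := hankel_resolvent_eq ht hα hθ1 hθ2 hθ hB hS hL
  set J := logResolvent α p⁻¹ B with hJ
  set V : A := -(((p⁻¹ * p⁻¹ : ℝ) : ℂ) • Ring.inverse B) with hV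
  set g : ℂ → A := fun z => hankelKernel (2 * α) z • (V * J z) with hg
  have hB0 := hB 0 le_rfl
  rw [zero_smul, zero_add] at hB0
  have hVn : ‖V‖ ≤ p⁻¹ * p⁻¹ * D := by
    rw [hV, norm_neg, norm_smul, Complex.norm_real, Real.norm_of_nonneg (by positivity)]
    gcongr
    exact hB0.2
  have hVJ : ∀ z : ℂ, z.im ∈ Icc (-θ) θ → ‖V * J z‖ ≤ p⁻¹ * p⁻¹ * D * D := fun z hz =>
    (norm_mul_le _ _).trans (by
      gcongr
      exact (hB _ (re_mul_exp_nonneg hα hq hθ hz)).2)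
  have hgd : ∀ z : ℂ, z.im ∈ Icc (-θ) θ → DifferentiableAt ℂ g z := fun z hz =>
    differentiableAt_kernel_smul _ _ hα hq hθ (fun w hw => (hB w hw).1) hz
  have hray : ∀ x y : ℝ, |y| = θ → ‖g (x + y * Complex.I)‖ ≤ (p⁻¹ * p⁻¹ * D * D) *
      rayBound (-Real.cos θ) (2 * α) x := by
    intro x y hy
    rw [hg, norm_smul, mul_comm]
    gcongr
    · exact hVJ _ (by simpa using abs_le.mp hy.le)
    · exact norm_hankelKernel_le (by rw [← hy, Real.cos_abs])
  have hseg : ∀ y ∈ Icc (-θ) θ, ‖g ((0 : ℝ) + y * Complex.I)‖ ≤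
      (p⁻¹ * p⁻¹ * D * D) * Real.exp 1 := by
    intro y hy
    rw [hg, norm_smul, mul_comm]
    gcongr
    · exact hVJ _ (by simpa using hy)
    · rw [norm_hankelKernel, rayBound, neg_neg, Real.exp_zero, mul_zero, Real.exp_zero, mul_one,
        mul_one]
      exact Real.exp_le_exp.mpr (Real.cos_le_one y)
  have hshift : hankel g θ 0 = hankel g θ L :=
    hankel_eq_of_le (c := -Real.cos θ) (κ := 2 * α) (K := p⁻¹ * p⁻¹ * D * D) (by linarith)
      hθ0 hL0 (fun z _ hz => hgd z hz) fun x _ =>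
        ⟨hray x θ (abs_of_nonneg hθ0), hray x (-θ) (by rw [abs_neg, abs_of_nonneg hθ0])⟩
  have hgi : HankelIntegrable g θ L := HankelIntegrable.of_le (c := -Real.cos θ) (by linarith) hθ0
    (fun z _ hz => (hgd z hz).continuousAt) fun x _ y hy => hray x y hy
  set k : ℂ → A := fun z => hankelKernel (1 - (1 - α)) z • (((p⁻¹ : ℝ) : ℂ) • Ring.inverse B)
  have hki : HankelIntegrable k θ L :=
    (hankelIntegrable_hankelKernel _ hθ0 hcos L).smul_const _
  have hsplit : hankel (fun z => hankelKernel α z •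
      (((p⁻¹ : ℝ) : ℂ) • (1 : A) * J z)) θ L = hankel (fun z => g z + k z) θ L := by
    refine hankel_congr hθ0 fun z hz => ?_
    have hres := logResolvent_mul hα hq hθ (fun w hw => (hB w hw).1) hz
    rw [← hJ] at hres
    have e1 : hankelKernel (2 * α) z = hankelKernel α z * Complex.exp (α * z) := by
      rw [← hankelKernel_add, two_mul]
    -- `J = B⁻¹ - q e^{αζ} B⁻¹ J`
    have e2 : J z = Ring.inverse B - ((p⁻¹ : ℝ) * Complex.exp (α * z)) •
        (Ring.inverse B * J z) := by
      have h := congrArg (Ring.inverse B * ·) hres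
      simp only [mul_add, mul_one, mul_smul_comm] at h
      rw [Ring.inverse_mul_cancel_left _ _ hB0.1] at h
      exact eq_sub_of_add_eq' h
    simp only [hg, k, hV]
    rw [e1, sub_sub_cancel, neg_mul, smul_mul_assoc, smul_mul_assoc, one_mul]
    nth_rewrite 1 [e2]
    push_cast
    module
  have hnorm := norm_hankel_le (L := 0) (by linarith) hθ0 (fun x _ y hy => hray x y hy) hseg
  rw [hsplit, hgi.hankel_add hki, hankel_smul_const,
    hankel_hankelKernel_of_cos_neg (by linarith) hθ1 hθ2, ← hshift] at hmain
  have hpi : (2 * Real.pi * Complex.I : ℂ) ≠ 0 := Complex.two_pi_I_ne_zero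
  have hdiff : S - (((Real.Gamma (1 - α) * p)⁻¹ : ℝ) : ℂ) • Ring.inverse B =
      (2 * Real.pi * Complex.I : ℂ)⁻¹ • hankel g θ 0 := by
    rw [eq_inv_smul_iff₀ hpi, smul_sub, ← hmain, smul_smul, smul_smul, mul_inv]
    push_cast
    rw [mul_assoc]
    abel
  rw [hdiff, norm_smul, norm_inv]
  have hnpi : ‖(2 * Real.pi * Complex.I : ℂ)‖ = 2 * Real.pi := by
    simp [abs_of_pos Real.pi_pos]
  rw [hnpi]
  have ht2 : t ^ (2 * α) = p * p := by
    rw [two_mul, Real.rpow_add ht]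
  rw [ht2]
  calc (2 * Real.pi)⁻¹ * ‖hankel g θ 0‖ ≤ (2 * Real.pi)⁻¹ * (p⁻¹ * p⁻¹ * D * D * Q) := by
        gcongr
    _ = _ := by
        rw [div_eq_mul_inv, mul_inv]
        ring

end Asymptotics

/-! ### Uniqueness for dissipative fractional evolution equations -/

section Uniqueness

/-- Extremum principle for the Caputo derivative: at a point where `φ` attains its maximum over
`[0, T]`, the derivative is at least `T^{-α} (φ T - φ 0)`. -/
lemma rpow_mul_le_integral_deriv {α T : ℝ} (hα0 : 0 < α) (hα1 : α < 1) (hT : 0 < T) {φ : ℝ → ℝ}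
    (hcont : ContinuousOn φ (Icc 0 T)) (hdiff : ∀ s ∈ Ioc 0 T, DifferentiableAt ℝ φ s)
    (hint : IntervalIntegrable (fun s => (T - s) ^ (-α) * deriv φ s) volume 0 T)
    (hmax : ∀ s ∈ Icc 0 T, φ s ≤ φ T) :
    T ^ (-α) * (φ T - φ 0) ≤ ∫ s in (0 : ℝ)..T, (T - s) ^ (-α) * deriv φ s := by
  set k : ℝ → ℝ := fun s => (T - s) ^ (-α) * (φ T - φ s) with hk
  have hkT : k T = 0 := by simp [hk]
  have hkcont : ContinuousOn k (Icc 0 T) := by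
    intro s hs
    rcases hs.2.lt_or_eq with h | rfl
    · have h1 : ContinuousAt (fun s => (T - s) ^ (-α)) s :=
        (continuousAt_const.sub continuousAt_id).rpow_const (Or.inl (sub_pos.mpr h).ne')
      exact h1.continuousWithinAt.mul (continuousWithinAt_const.sub (hcont s hs))
    · -- near the maximum point, `φ s - φ s₀ = O(s - s₀)` outweighs the singular factor
      obtain ⟨M, hM⟩ := ((hdiff s ⟨hT, le_rfl⟩).isBigO_sub).bound
      have hlim : Tendsto (fun r : ℝ => M * (s - r) ^ (1 - α)) (𝓝[Icc 0 s] s) (𝓝 0) := by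
        have h1 : ContinuousAt (fun r : ℝ => M * (s - r) ^ (1 - α)) s :=
          continuousAt_const.mul
            ((continuousAt_const.sub continuousAt_id).rpow_const (Or.inr (by linarith)))
        have h2 : M * (s - s) ^ (1 - α) = 0 := by
          rw [sub_self, Real.zero_rpow (by linarith), mul_zero]
        have h3 := h1.tendsto
        rw [h2] at h3
        exact h3.mono_left nhdsWithin_le_nhds
      rw [ContinuousWithinAt, hkT]
      refine squeeze_zero_norm' ?_ hlim
      filter_upwards [nhdsWithin_le_nhds hM, self_mem_nhdsWithin] with r hr hrI
      rcases hrI.2.lt_or_eq with h | rfl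
      · have h0 : 0 < s - r := sub_pos.mpr h
        rw [Real.norm_eq_abs, Real.norm_eq_abs, abs_sub_comm (φ r), abs_sub_comm r,
          abs_of_pos h0] at hr
        rw [hk, norm_mul, Real.norm_of_nonneg (by positivity), Real.norm_eq_abs]
        calc (s - r) ^ (-α) * |φ s - φ r| ≤ (s - r) ^ (-α) * (M * (s - r)) := by gcongr
          _ = M * (s - r) ^ (1 - α) := by
            rw [show 1 - α = -α + 1 by ring, Real.rpow_add h0, Real.rpow_one]
            ring
      · rw [hkT, sub_self, Real.zero_rpow (by linarith), mul_zero, norm_zero]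
  have hderiv : ∀ s ∈ Ioo 0 T, HasDerivWithinAt k
      (α * (T - s) ^ (-α - 1) * (φ T - φ s) + -((T - s) ^ (-α) * deriv φ s)) (Ioi s) s := by
    intro s hs
    have h0 : 0 < T - s := sub_pos.mpr hs.2
    have h1 : HasDerivAt (fun s => (T - s) ^ (-α)) (α * (T - s) ^ (-α - 1)) s := by
      refine (((hasDerivAt_id s).const_sub T).rpow_const (p := -α) (Or.inl h0.ne')).congr_deriv ?_
      simp
    refine ((h1.mul ((hdiff s (Ioo_subset_Ioc_self hs)).hasDerivAt.const_sub (φ T))).congr_deriv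
      ?_).hasDerivWithinAt
    ring
  have hmain := intervalIntegral.integral_le_sub_of_hasDeriv_right_of_le hT.le hkcont hderiv
    (φ := fun s => -((T - s) ^ (-α) * deriv φ s))
    (by
      rw [integrableOn_Icc_iff_integrableOn_Ioc]
      exact ((intervalIntegrable_iff_integrableOn_Ioc_of_le hT.le).mp hint).neg)
    (fun s hs => by
      have h0 : 0 < T - s := sub_pos.mpr hs.2
      have h1 := sub_nonneg.mpr (hmax s (Ioo_subset_Icc_self hs))
      have : 0 ≤ α * (T - s) ^ (-α - 1) * (φ T - φ s) := by positivity
      linarith)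
  rw [intervalIntegral.integral_neg, hkT] at hmain
  have : k 0 = T ^ (-α) * (φ T - φ 0) := by simp [hk]
  linarith

variable {X : Type} [NormedAddCommGroup X] [InnerProductSpace ℂ X] [NormedSpace ℝ X]
  [IsScalarTower ℝ ℂ X] [CompleteSpace X]

/-- A function that starts at `0` and whose Caputo derivative is dissipative vanishes. -/
theorem eq_zero_of_re_inner_caputo_nonpos {α : ℝ} (hα0 : 0 < α) (hα1 : α < 1) {v : ℝ → X}
    (hcont : ContinuousOn v (Ici 0)) (h0 : v 0 = 0)
    (hdiff : ∀ t : ℝ, 0 < t → DifferentiableAt ℝ v t)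
    (hint : ∀ t : ℝ, 0 < t →
      IntervalIntegrable (fun s => (t - s) ^ (-α) • deriv v s) volume 0 t)
    (hdiss : ∀ t : ℝ, 0 < t → (inner ℂ (v t) (caputo α v t)).re ≤ 0) {t : ℝ} (ht : 0 ≤ t) :
    v t = 0 := by
  obtain ⟨T, hT, hTmax⟩ := isCompact_Icc.exists_isMaxOn (nonempty_Icc.mpr ht)
    ((hcont.mono Icc_subset_Ici_self).norm)
  have hle : ∀ s ∈ Icc 0 t, ‖v s‖ ≤ ‖v T‖ := fun s hs => hTmax hs
  suffices h : v T = 0 by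
    have := hle t ⟨ht, le_rfl⟩
    rwa [h, norm_zero, norm_le_zero_iff] at this
  rcases hT.1.eq_or_lt with h | hT0
  · rw [← h, h0]
  set l : X →L[ℝ] ℝ := Complex.reCLM.comp ((innerSL ℂ (v T)).restrictScalars ℝ) with hl
  have hlx : ∀ x, l x = (inner ℂ (v T) x).re := fun x => rfl
  have hlT : l (v T) = ‖v T‖ ^ 2 := by
    rw [hlx]
    exact inner_self_eq_norm_sq (𝕜 := ℂ) (v T)
  have hder : ∀ s ∈ Ioc 0 T, HasDerivAt (fun s => l (v s)) (l (deriv v s)) s := fun s hs =>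
    l.hasFDerivAt.comp_hasDerivAt s (hdiff s hs.1).hasDerivAt
  have hcongr : ∀ s ∈ uIoc 0 T, l ((T - s) ^ (-α) • deriv v s) =
      (T - s) ^ (-α) * deriv (fun s => l (v s)) s := by
    intro s hs
    rw [uIoc_of_le hT0.le] at hs
    rw [map_smul, smul_eq_mul, (hder s hs).deriv]
  have hTint := hint T hT0
  have hlint : IntervalIntegrable (fun s => l ((T - s) ^ (-α) • deriv v s)) volume 0 T :=
    ⟨l.integrable_comp hTint.1, l.integrable_comp hTint.2⟩
  have h1 := rpow_mul_le_integral_deriv hα0 hα1 hT0 (φ := fun s => l (v s))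
    (l.continuous.comp_continuousOn (hcont.mono Icc_subset_Ici_self))
    (fun s hs => (hder s hs).differentiableAt) (hlint.congr hcongr) (fun s hs => by
      rw [hlT, hlx]
      calc (inner ℂ (v T) (v s)).re ≤ ‖v T‖ * ‖v s‖ := re_inner_le_norm (𝕜 := ℂ) _ _
        _ ≤ ‖v T‖ * ‖v T‖ := by
          gcongr
          exact hle s ⟨hs.1, hs.2.trans hT.2⟩
        _ = _ := by ring)
  rw [← intervalIntegral.integral_congr_ae (Eventually.of_forall hcongr),
    l.intervalIntegral_comp_comm hTint, h0, map_zero, sub_zero, hlT] at h1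
  have hG : 0 < Real.Gamma (1 - α) := Real.Gamma_pos_of_pos (by linarith)
  have h2 := hdiss T hT0
  rw [← hlx, caputo, map_smul, smul_eq_mul] at h2
  have h3 : l (∫ s in (0 : ℝ)..T, (T - s) ^ (-α) • deriv v s) ≤ 0 := by
    by_contra hneg
    rw [not_le] at hneg
    have : 0 < (Real.Gamma (1 - α))⁻¹ * l (∫ s in (0 : ℝ)..T, (T - s) ^ (-α) • deriv v s) := by
      positivity
    linarith
  have h4 : 0 < T ^ (-α) := by positivity
  have h5 : ‖v T‖ ^ 2 ≤ 0 := by nlinarith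
  have := pow_eq_zero_iff (two_ne_zero) |>.mp (le_antisymm h5 (by positivity))
  exact norm_eq_zero.mp this

end Uniqueness

/-! ### Coercive operators on the range of a projection -/

section Coercive

variable {H : Type} [NormedAddCommGroup H] [InnerProductSpace ℂ H] [CompleteSpace H]

/-- The Lax-Milgram bound for the resolvent of a coercive operator on the left half plane. -/
lemma isUnit_smul_one_add_of_coercive {B : H →L[ℂ] H} {δ : ℝ} (hδ : 0 < δ)
    (hB : ∀ v, δ * ‖v‖ ^ 2 ≤ (inner ℂ v (B v)).re) (w : ℂ) (hw : 0 ≤ w.re) :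
    IsUnit (w • (1 : H →L[ℂ] H) + B) ∧ ‖Ring.inverse (w • (1 : H →L[ℂ] H) + B)‖ ≤ δ⁻¹ := by
  set f : H →L[ℂ] H := w • (1 : H →L[ℂ] H) + B with hf
  have hre : ∀ v, δ * ‖v‖ ^ 2 ≤ (inner ℂ v (f v)).re := by
    intro v
    have h1 : f v = w • v + B v := rfl
    have h2 : (inner ℂ v (w • v)).re = w.re * ‖v‖ ^ 2 := by
      rw [inner_smul_right, inner_self_eq_norm_sq_to_K]
      simp only [Complex.coe_algebraMap]
      rw [← Complex.ofReal_pow, Complex.re_mul_ofReal]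
    rw [h1, inner_add_right, Complex.add_re, h2]
    have : 0 ≤ w.re * ‖v‖ ^ 2 := by positivity
    linarith [hB v]
  have hunit : IsUnit f := by
    refine ContinuousLinearMap.isUnit_of_forall_le_norm_inner_map f (c := ⟨δ, hδ.le⟩) hδ
      fun v => ?_
    rw [norm_inner_symm]
    change ‖v‖ ^ 2 * δ ≤ _
    rw [mul_comm]
    exact (hre v).trans (Complex.re_le_norm _)
  refine ⟨hunit, ContinuousLinearMap.opNorm_le_bound _ (by positivity) fun v => ?_⟩
  set x := Ring.inverse f v with hx
  have hfx : f x = v := by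
    have h := congrArg (fun T : H →L[ℂ] H => T v) (Ring.mul_inverse_cancel f hunit)
    exact h
  have h1 : δ * ‖x‖ ^ 2 ≤ ‖x‖ * ‖v‖ := by
    refine (hre x).trans ?_
    rw [hfx]
    exact re_inner_le_norm (𝕜 := ℂ) x v
  rw [inv_mul_eq_div, le_div_iff₀ hδ]
  rcases (norm_nonneg x).eq_or_lt with h0 | h0
  · rw [← h0, zero_mul]
    exact norm_nonneg v
  · nlinarith

lemma summable_mittagLeffler_operator {α : ℝ} (hα : 0 < α) (B : H →L[ℂ] H) {t : ℝ} (ht : 0 < t) :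
    Summable fun k : ℕ =>
      (((t ^ α) ^ k * (Real.Gamma (α * k + 1))⁻¹ : ℝ) : ℂ) • (-B) ^ k := by
  refine Summable.of_norm_bounded ((summable_mittagLeffler hα (x := t ^ α * ‖B‖)
    (by positivity)).mul_right ‖(1 : H →L[ℂ] H)‖) fun k => ?_
  have hG : 0 < Real.Gamma (α * k + 1) := Real.Gamma_pos_of_pos (by positivity)
  have h1 := norm_pow_mul_le (-B) 1 k
  rw [mul_one, norm_neg] at h1
  rw [norm_smul, Complex.norm_real, Real.norm_of_nonneg (by positivity), mul_pow]
  calc (t ^ α) ^ k * (Real.Gamma (α * k + 1))⁻¹ * ‖(-B) ^ k‖ ≤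
      (t ^ α) ^ k * (Real.Gamma (α * k + 1))⁻¹ * (‖B‖ ^ k * ‖(1 : H →L[ℂ] H)‖) := by gcongr
    _ = 1 * ((t ^ α) ^ k * ‖B‖ ^ k) / Real.Gamma (α * k + 1) * ‖(1 : H →L[ℂ] H)‖ := by
      rw [div_eq_mul_inv]
      ring
    _ ≤ _ := by
      gcongr
      linarith [(Nat.cast_nonneg k : (0 : ℝ) ≤ k)]

variable [NormedSpace ℝ H] [IsScalarTower ℝ ℂ H]

/-- On the range of a projection `P` that commutes with `B`, and on which `B` is coercive, the
Mittag-Leffler function of `B` has the expected first order asymptotics. -/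
theorem exists_mittagLeffler_asymptotics {α δ : ℝ} (hα : 0 < α) (hα1 : α < 1) (hδ : 0 < δ)
    {P B : H →L[ℂ] H} (hPB : B * P = P * B)
    (hB : ∀ v, P v = v → δ * ‖v‖ ^ 2 ≤ (inner ℂ v (B v)).re) {u₀ : H} (hu₀ : P u₀ = u₀) :
    ∃ W : H, P W = W ∧ B W = u₀ ∧ ∃ C : ℝ, 0 ≤ C ∧ ∀ t : ℝ, 0 < t →
      P (mittagLeffler α (B.restrictScalars ℝ) u₀ t) =
        mittagLeffler α (B.restrictScalars ℝ) u₀ t ∧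
      ‖mittagLeffler α (B.restrictScalars ℝ) u₀ t -
        (((Real.Gamma (1 - α) * t ^ α)⁻¹ : ℝ) : ℂ) • W‖ ≤ C / t ^ (2 * α) := by
  set M : Submodule ℂ H := LinearMap.ker ((1 - P : H →L[ℂ] H) : H →ₗ[ℂ] H) with hM
  have hmem : ∀ v, v ∈ M ↔ P v = v := fun v => by
    rw [hM, LinearMap.mem_ker]
    change v - P v = 0 ↔ _
    rw [sub_eq_zero, eq_comm]
  have hclosed : IsClosed (M : Set H) := ContinuousLinearMap.isClosed_ker (1 - P)
  have : CompleteSpace M := hclosed.completeSpace_coe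
  set BM : M →L[ℂ] M := (B.comp M.subtypeL).codRestrict M fun v => by
    rw [hmem]
    have h := congrArg (fun T : H →L[ℂ] H => T v) hPB
    change B (P v) = P (B v) at h
    change P (B v) = B v
    rw [← h, (hmem v).mp v.2] with hBM
  have hBMc : ∀ v : M, ((BM v : M) : H) = B v := fun v => rfl
  have hres := isUnit_smul_one_add_of_coercive (B := BM) hδ fun v =>
    hB v ((hmem v).mp v.2)
  have hunit := (hres 0 le_rfl).1
  rw [zero_smul, zero_add] at hunit
  obtain ⟨C, hC, hasymp⟩ := exists_norm_mittagLeffler_sub_le (α := α) (B := BM) hα hα1 hres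
  set v₀ : M := ⟨u₀, (hmem u₀).mpr hu₀⟩ with hv₀
  set WM : M := Ring.inverse BM v₀ with hWM
  have hBW : BM WM = v₀ := by
    have h := congrArg (fun T : M →L[ℂ] M => T v₀) (Ring.mul_inverse_cancel BM hunit)
    exact h
  refine ⟨WM, (hmem _).mp WM.2, by rw [← hBMc, hBW], C * ‖v₀‖, by positivity, fun t ht => ?_⟩
  obtain ⟨S, hS⟩ := summable_mittagLeffler_operator hα BM ht
  have hpow : ∀ k : ℕ, ((((-BM) ^ k) v₀ : M) : H) = ((-(B.restrictScalars ℝ)) ^ k) u₀ := by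
    intro k
    induction k with
    | zero => rfl
    | succ k ih =>
      rw [pow_succ', pow_succ']
      change (((-BM) (((-BM) ^ k) v₀) : M) : H) =
        (-(B.restrictScalars ℝ)) (((-(B.restrictScalars ℝ)) ^ k) u₀)
      rw [← ih]
      rfl
  have hSv : mittagLeffler α (B.restrictScalars ℝ) u₀ t = ((S v₀ : M) : H) := by
    refine (hasSum_mittagLeffler (B.restrictScalars ℝ) u₀ hα ht.le).unique ?_
    have hterm : ∀ k : ℕ, (t ^ α) ^ k • ((Real.Gamma (α * k + 1))⁻¹ •
        ((-(B.restrictScalars ℝ)) ^ k) u₀) = M.subtypeL (ContinuousLinearMap.apply ℂ M v₀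
          ((((t ^ α) ^ k * (Real.Gamma (α * k + 1))⁻¹ : ℝ) : ℂ) • (-BM) ^ k)) := by
      intro k
      rw [map_smul, map_smul, smul_smul, ← hpow k, ← Complex.coe_algebraMap, algebraMap_smul]
      rfl
    simp_rw [hterm]
    exact (hS.mapL (ContinuousLinearMap.apply ℂ M v₀)).mapL M.subtypeL
  refine ⟨by rw [hSv]; exact (hmem _).mp (S v₀).2, ?_⟩
  have h1 := hasymp t ht S hS
  have h2 := (S - (((Real.Gamma (1 - α) * t ^ α)⁻¹ : ℝ) : ℂ) • Ring.inverse BM).le_opNorm v₀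
  rw [hSv]
  calc _ = ‖(S - (((Real.Gamma (1 - α) * t ^ α)⁻¹ : ℝ) : ℂ) • Ring.inverse BM) v₀‖ := rfl
    _ ≤ C / t ^ (2 * α) * ‖v₀‖ := h2.trans (by gcongr)
    _ = _ := by ring

end Coercive

/-! ### Continuous representatives on a closed subspace -/

section ContRep

variable {d : ℕ} {Ω : Set (E d)}

lemma IsContRep.eqOn (hΩ : IsOpen Ω) {v : L2 Ω} {w w' : E d → ℂ} (hw : IsContRep Ω v w)
    (hw' : IsContRep Ω v w') : EqOn w w' (closure Ω) := by
  have hae : w =ᵐ[volume.restrict Ω] w' := by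
    filter_upwards [hw.2, hw'.2] with x h1 h2
    rw [← h1, h2]
  exact (Measure.eqOn_open_of_ae_eq hae hΩ (hw.1.mono subset_closure)
    (hw'.1.mono subset_closure)).of_subset_closure hw.1 hw'.1 subset_closure subset_rfl

lemma IsContRep.add {v v' : L2 Ω} {w w' : E d → ℂ} (hw : IsContRep Ω v w)
    (hw' : IsContRep Ω v' w') : IsContRep Ω (v + v') fun x => w x + w' x := by
  refine ⟨hw.1.add hw'.1, ?_⟩
  filter_upwards [hw.2, hw'.2, Lp.coeFn_add v v'] with x h1 h2 h3
  rw [h3, Pi.add_apply, h1, h2]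

lemma IsContRep.smul (k : ℂ) {v : L2 Ω} {w : E d → ℂ} (hw : IsContRep Ω v w) :
    IsContRep Ω (k • v) fun x => k * w x := by
  refine ⟨continuousOn_const.mul hw.1, ?_⟩
  filter_upwards [hw.2, Lp.coeFn_smul k v] with x h1 h2
  rw [h2, Pi.smul_apply, h1, smul_eq_mul]

/-- By the closed graph theorem, the supremum norm of the continuous representative is bounded by
the norm of `L²(Ω)`, on a closed subspace all of whose elements have such a representative. -/
theorem exists_norm_contRep_le (hΩ : IsOpen Ω) (hbd : Bornology.IsBounded Ω)
    {M : Submodule ℂ (L2 Ω)} (hM : IsClosed (M : Set (L2 Ω)))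
    (hrep : ∀ v ∈ M, ∃ w, IsContRep Ω v w) :
    ∃ K : ℝ, 0 ≤ K ∧ ∀ v ∈ M, ∀ w, IsContRep Ω v w → ∀ x ∈ closure Ω, ‖w x‖ ≤ K * ‖v‖ := by
  have : CompleteSpace M := hM.completeSpace_coe
  have : CompactSpace (closure Ω) := isCompact_iff_compactSpace.mp hbd.isCompact_closure
  choose w hw using fun v : M => hrep v v.2
  let T : M →ₗ[ℂ] C(closure Ω, ℂ) :=
    { toFun := fun v => ⟨(closure Ω).domRestrict (w v), (hw v).1.domRestrict⟩
      map_add' := fun v v' => by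
        ext x
        exact (hw (v + v')).eqOn hΩ ((hw v).add (hw v')) x.2
      map_smul' := fun k v => by
        ext x
        exact (hw (k • v)).eqOn hΩ ((hw v).smul k) x.2 }
  have hT : ∀ (v : M) (x : closure Ω), T v x = w v x := fun v x => rfl
  have hcont : Continuous T := by
    refine T.continuous_of_seq_closed_graph fun s v g hs hg => ?_
    have h1 : Tendsto (fun n => (s n : L2 Ω)) atTop (𝓝 (v : L2 Ω)) :=
      (continuous_subtype_val.tendsto v).comp hs
    obtain ⟨ns, hns, hae⟩ := (tendstoInMeasure_of_tendsto_Lp h1).exists_seq_tendsto_ae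
    have h2 : ∀ x : closure Ω, Tendsto (fun n => w (s n) x) atTop (𝓝 (g x)) := fun x =>
      ((continuous_eval_const x).tendsto g).comp hg
    obtain ⟨g', hg'⟩ : ∃ g' : E d → ℂ, ∀ x : closure Ω, g' x = g x :=
      ⟨Function.extend Subtype.val g 0, fun x => Subtype.val_injective.extend_apply g 0 x⟩
    have hrepg : IsContRep Ω (v : L2 Ω) g' := by
      refine ⟨?_, ?_⟩
      · rw [continuousOn_iff_continuous_domRestrict]
        exact g.continuous.congr fun x => (hg' x).symm
      · have hall : ∀ᵐ x ∂(volume.restrict Ω), ∀ n, (s n : L2 Ω) x = w (s n) x :=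
          ae_all_iff.mpr fun n => (hw (s n)).2
        filter_upwards [hae, hall, ae_restrict_mem hΩ.measurableSet] with x h3 h4 h5
        have h6 := (h2 ⟨x, subset_closure h5⟩).comp hns.tendsto_atTop
        simp only [h4] at h3
        rw [tendsto_nhds_unique h3 h6]
        exact (hg' ⟨x, subset_closure h5⟩).symm
    ext x
    rw [hT, ← hg']
    exact hrepg.eqOn hΩ (hw v) x.2
  set T' : M →L[ℂ] C(closure Ω, ℂ) := ⟨T, hcont⟩ with hT'
  refine ⟨‖T'‖, T'.opNorm_nonneg, fun v hv w' hw' x hx => ?_⟩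
  rw [hw'.eqOn hΩ (hw ⟨v, hv⟩) hx]
  exact (ContinuousMap.norm_coe_le_norm (T' ⟨v, hv⟩) ⟨x, hx⟩).trans (T'.le_opNorm ⟨v, hv⟩)

end ContRep

/-! ### The solutions with initial value in the eigenspace -/

/-- Uniqueness identifies a solution with the Mittag-Leffler function, if `A` agrees with the
bounded operator `B` along the latter and is accretive. -/
theorem IsSolution.eq_mittagLeffler {d : ℕ} {Ω : Set (E d)} (hΩ : IsOpen Ω)
    (hbd : Bornology.IsBounded Ω) {α : ℝ} (hα0 : 0 < α) (hα1 : α < 1)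
    {a : Fin d → Fin d → E d → ℝ} {b : Fin d → E d → ℝ} {c : E d → ℝ}
    (hac : ∀ i j, ContinuousOn (a i j) (closure Ω))
    (hacc : ∀ v f : L2 Ω, IsImage Ω a b c v f → 0 ≤ (inner ℂ v f).re)
    {u₀ : L2 Ω} {u : ℝ → L2 Ω} (hu : IsSolution Ω a b c α u₀ u) {B : L2 Ω →L[ℂ] L2 Ω}
    (hB : ∀ t : ℝ, 0 < t → IsImage Ω a b c (mittagLeffler α (B.restrictScalars ℝ) u₀ t)
      (B (mittagLeffler α (B.restrictScalars ℝ) u₀ t))) {t : ℝ} (ht : 0 ≤ t) :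
    u t = mittagLeffler α (B.restrictScalars ℝ) u₀ t := by
  set S : ℝ → L2 Ω := mittagLeffler α (B.restrictScalars ℝ) u₀ with hS
  have hSder : ∀ t : ℝ, 0 < t → DifferentiableAt ℝ S t := fun t ht =>
    (hasDerivAt_mittagLeffler (B.restrictScalars ℝ) u₀ hα0 ht).differentiableAt
  have hScap := fun t (ht : 0 < t) =>
    caputo_mittagLeffler (B.restrictScalars ℝ) u₀ hα0 hα1 ht
  have hder : ∀ t : ℝ, 0 < t → ∀ s ∈ uIoc 0 t,
      (t - s) ^ (-α) • deriv (fun t => u t - S t) s =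
        (t - s) ^ (-α) • deriv u s - (t - s) ^ (-α) • deriv S s := by
    intro t ht s hs
    rw [uIoc_of_le ht.le] at hs
    rw [deriv_fun_sub (hu.differentiableAt s hs.1) (hSder s hs.1), smul_sub]
  refine sub_eq_zero.mp (eq_zero_of_re_inner_caputo_nonpos hα0 hα1
    (v := fun t => u t - S t) ?_ ?_ ?_ ?_ ?_ ht)
  · exact hu.continuousOn.sub
      (continuous_mittagLeffler (B.restrictScalars ℝ) u₀ hα0).continuousOn
  · change u 0 - S 0 = 0
    rw [hu.initial, hS, mittagLeffler_zero _ _ hα0, sub_self]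
  · exact fun t ht => (hu.differentiableAt t ht).sub (hSder t ht)
  · intro t ht
    exact IntervalIntegrable.congr (fun s hs => (hder t ht s hs).symm)
      ((hu.integrable t ht).sub (hScap t ht).1)
  · intro t ht
    obtain ⟨f, hf, hcap⟩ := hu.equation t ht
    have h1 : caputo α (fun t => u t - S t) t = -(f - B (S t)) := by
      have h2 : caputo α (fun t => u t - S t) t = caputo α u t - caputo α S t := by
        rw [caputo, intervalIntegral.integral_congr_ae (Eventually.of_forall (hder t ht)),
          intervalIntegral.integral_sub (hu.integrable t ht) (hScap t ht).1, smul_sub]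
        rfl
      rw [h2, hcap, (hScap t ht).2]
      change -f - -(B (S t)) = _
      abel
    have h3 := hacc _ _ (IsImage.sub hΩ hbd hac hf (hB t ht))
    rw [h1, inner_neg_right, Complex.neg_re]
    linarith

end FracDiff

/-! ### The asymptotic expansion -/

theorem proposition3
    (d : ℕ) (hd1 : 1 ≤ d) (hd3 : d ≤ 3)
    (Ω : Set (FracDiff.E d)) (hΩ : FracDiff.IsSmoothBoundedDomain Ω)
    (α : ℝ) (hα0 : 0 < α) (hα1 : α < 1)
    -- the coefficients of the operator
    (a : Fin d → Fin d → FracDiff.E d → ℝ) (b : Fin d → FracDiff.E d → ℝ)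
    (c : FracDiff.E d → ℝ)
    (ha : ∀ i j, FracDiff.IsC1Closure Ω (a i j))
    (ha_symm : ∀ i j, ∀ x ∈ closure Ω, a i j x = a j i x)
    (hb : ∀ j, ContDiffOn ℝ 1 (b j) Ω)
    (hb_bdd : ∃ M : ℝ, ∀ j, ∀ x ∈ Ω, |b j x| ≤ M)
    (hc : ContinuousOn c (closure Ω))
    (hc_nonpos : ∀ x ∈ closure Ω, c x ≤ 0)
    -- uniform ellipticity
    (σ : ℝ) (hσ : 0 < σ)
    (h_ell : ∀ x ∈ closure Ω, ∀ ζ : Fin d → ℝ,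
      σ * ∑ i, ζ i ^ 2 ≤ ∑ i, ∑ j, a i j x * ζ i * ζ j)
    -- the positivity condition, with a Poincaré constant of the domain
    (CΩ : ℝ) (hCΩ : 0 < CΩ) (h_poincare : FracDiff.IsPoincareConstant Ω CΩ)
    (h_pos : ∃ δ : ℝ, 0 < δ ∧ ∀ x ∈ Ω,
      δ ≤ (1 / 2 * ∑ j, FracDiff.partialDeriv j (b j) x - c x) + CΩ * σ)
    -- a point of the spectrum, and a circle around it that encloses no other one
    (lam : ℂ) (hlam : lam ∈ FracDiff.spectrumOf (FracDiff.IsImage Ω a b c))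
    (r : ℝ) (hr : 0 < r)
    (h_isol : ∀ z ∈ Metric.closedBall lam r,
      z ∈ FracDiff.spectrumOf (FracDiff.IsImage Ω a b c) → z = lam)
    -- the initial value
    (u₀ : FracDiff.L2 Ω)
    (hu₀ : u₀ ∈ Set.range (FracDiff.eigenprojection (FracDiff.IsImage Ω a b c) lam r))
    (t₀ : ℝ) (ht₀ : 0 < t₀) :
    -- `W` is the unique element `A⁻¹ P u₀` of the domain with `A W = P u₀`
    (∃ W : FracDiff.L2 Ω,
      (∀ V : FracDiff.L2 Ω,
        FracDiff.IsImage Ω a b c V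
          (FracDiff.eigenprojection (FracDiff.IsImage Ω a b c) lam r u₀) ↔ V = W) ∧
      ∃ w : FracDiff.E d → ℂ, FracDiff.IsContRep Ω W w ∧
      ∃ C : ℝ, 0 < C ∧
        ∀ u : ℝ → FracDiff.L2 Ω, FracDiff.IsSolution Ω a b c α u₀ u →
          ∃ U R : FracDiff.E d → ℝ → ℂ, ∀ t : ℝ, t₀ ≤ t →
            FracDiff.IsContRep Ω (u t) (fun x => U x t) ∧
            ContinuousOn (fun x => R x t) (closure Ω) ∧
            (∀ x ∈ closure Ω,
              U x t = w x / ((Real.Gamma (1 - α) * t ^ α : ℝ) : ℂ) + R x t) ∧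
            ∀ x ∈ closure Ω, ‖R x t‖ ≤ C / t ^ (2 * α)) ∧
    -- the identity for the coefficients
    ∀ j : ℕ, 1 ≤ j → FracDiff.Phi α j = 1 / Real.Gamma (1 - α) := by
  refine ⟨?_, fun j hj => FracDiff.Phi_eq α hα0 j hj⟩
  obtain ⟨δ, hδ, hpos⟩ := h_pos
  have hac : ∀ i j, ContinuousOn (a i j) (closure Ω) := fun i j => (ha i j).1
  have hcoer : ∀ v f : FracDiff.L2 Ω, FracDiff.IsImage Ω a b c v f →
      δ * ‖v‖ ^ 2 ≤ (inner ℂ v f).re := fun v f h =>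
    FracDiff.IsImage.re_inner_ge hΩ.isOpen hΩ.isBounded hac hb hb_bdd hc hσ h_ell h_poincare hpos h
  set G := FracDiff.IsImage Ω a b c with hG
  have hPP := FracDiff.eigenprojection_mul_self (G := G) hr h_isol
  obtain ⟨B, hBP, hGB⟩ := FracDiff.exists_bounded_on_eigenspace (G := G) hr h_isol
  set P := FracDiff.eigenprojection G lam r with hP
  have hPu₀ : P u₀ = u₀ := by
    obtain ⟨v, rfl⟩ := hu₀
    exact congrArg (fun T : FracDiff.L2 Ω →L[ℂ] FracDiff.L2 Ω => T v) hPP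
  have hGBv : ∀ v, P v = v → G v (B v) := fun v hv => by
    have h := hGB v
    rwa [hv] at h
  obtain ⟨W, hPW, hBW, C, hC, hasymp⟩ := FracDiff.exists_mittagLeffler_asymptotics (P := P) (B := B)
    hα0 hα1 hδ hBP (fun v hv => hcoer v (B v) (hGBv v hv)) hPu₀
  have hGW : G W u₀ := hBW ▸ hGBv W hPW
  set S : ℝ → FracDiff.L2 Ω := FracDiff.mittagLeffler α (B.restrictScalars ℝ) u₀ with hS
  set M : Submodule ℂ (FracDiff.L2 Ω) :=
    LinearMap.ker ((1 - P : FracDiff.L2 Ω →L[ℂ] FracDiff.L2 Ω) :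
      FracDiff.L2 Ω →ₗ[ℂ] FracDiff.L2 Ω) with hM
  have hmem : ∀ v, v ∈ M ↔ P v = v := fun v => by
    rw [hM, LinearMap.mem_ker]
    change v - P v = 0 ↔ _
    rw [sub_eq_zero, eq_comm]
  have hrep : ∀ v, P v = v → ∃ w, FracDiff.IsContRep Ω v w := fun v hv =>
    FracDiff.MemH2.exists_contRep hd3 hΩ (hGBv v hv).1
  obtain ⟨K, hK, hsup⟩ := FracDiff.exists_norm_contRep_le hΩ.isOpen hΩ.isBounded (M := M)
    (ContinuousLinearMap.isClosed_ker (1 - P)) fun v hv => hrep v ((hmem v).mp hv)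
  obtain ⟨w, hw⟩ := hrep W hPW
  refine ⟨W, fun V => ⟨fun hV => ?_, fun hV => ?_⟩, w, hw, K * C + 1, by positivity,
    fun u hu => ?_⟩
  · rw [hPu₀] at hV
    have h1 := FracDiff.IsImage.sub hΩ.isOpen hΩ.isBounded hac hV hGW
    have h2 := hcoer _ _ h1
    rw [sub_self, inner_zero_right, Complex.zero_re] at h2
    have h3 : ‖V - W‖ ^ 2 ≤ 0 := by
      by_contra h
      have := mul_pos hδ (not_le.mp h)
      linarith
    have h4 := pow_eq_zero_iff two_ne_zero |>.mp (le_antisymm h3 (by positivity))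
    exact sub_eq_zero.mp (norm_eq_zero.mp h4)
  · rw [hPu₀, hV]
    exact hGW
  · have huS : ∀ t : ℝ, 0 ≤ t → u t = S t := fun t ht =>
      hu.eq_mittagLeffler hΩ.isOpen hΩ.isBounded hα0 hα1 hac
        (fun v f h => (by positivity : 0 ≤ δ * ‖v‖ ^ 2).trans (hcoer v f h))
        (fun s hs => hGBv _ (hasymp s hs).1) ht
    -- a function is also needed for `t ≤ 0`, where the equation gives no information on `u t`
    have hex : ∀ t : ℝ, ∃ U : FracDiff.E d → ℂ, 0 < t → FracDiff.IsContRep Ω (u t) U := by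
      intro t
      by_cases ht : 0 < t
      · obtain ⟨f, hf, -⟩ := hu.equation t ht
        obtain ⟨U, hU⟩ := FracDiff.MemH2.exists_contRep hd3 hΩ hf.1
        exact ⟨U, fun _ => hU⟩
      · exact ⟨0, fun h => absurd h ht⟩
    choose U hU using hex
    refine ⟨fun x t => U t x,
      fun x t => U t x + -(((Real.Gamma (1 - α) * t ^ α)⁻¹ : ℝ) : ℂ) * w x, fun t htt => ?_⟩
    have ht : 0 < t := ht₀.trans_le htt
    have hR := (hU t ht).add (hw.smul (-(((Real.Gamma (1 - α) * t ^ α)⁻¹ : ℝ) : ℂ)))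
    refine ⟨hU t ht, hR.1, fun x _ => ?_, fun x hx => ?_⟩
    · simp only
      rw [div_eq_mul_inv, Complex.ofReal_inv]
      ring
    · have hmemR : u t + -(((Real.Gamma (1 - α) * t ^ α)⁻¹ : ℝ) : ℂ) • W ∈ M := by
        rw [hmem, huS t ht.le, map_add, map_smul, hPW, (hasymp t ht).1]
      -- the remainder represents an element of the eigenspace
      have h1 := hsup _ hmemR _ hR x hx
      rw [huS t ht.le, neg_smul, ← sub_eq_add_neg] at h1
      have htp : 0 < t ^ (2 * α) := by positivity
      calc _ ≤ K * (C / t ^ (2 * α)) := h1.trans (by gcongr; exact (hasymp t ht).2)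
        _ = K * C / t ^ (2 * α) := by ring
        _ ≤ _ := by
          gcongr
          linarith
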